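/- **Setting.** Let $T>0$ and let $0=t_0<t_1<\dots<t_N=T$ be a mesh with elements $\tau_\ell=(t_{\ell-1},t_\ell)$ and sizes $h_\ell=t_\ell-t_{\ell-1}$ that satisfies $\max_\ell h_\ell\le T/2$ (so $N\ge 2$). Let $p_1,\dots,p_N\ge 1$ be polynomial degrees and let $\varphi_1,\dots,\varphi_M$ be a basis of the space of continuous functions on $[0,T]$ that are on each $\tau_\ell$ a polynomial of degree at most $p_\ell$, with $\varphi_j(0)=0$ for $j\ge2$. Assume that the basis is given by shape functions: there are polynomials $\psi^{p_\ell}_1,\dots,\psi^{p_\ell}_{p_\ell+1}$ of degree at most $p_\ell$ and, for each $\ell$, an injective map $m\mapsto\alpha(m,\ell)$ with $\varphi_{\alpha(m,\ell)}(t)=\psi^{p_\ell}_m\big((t-t_{\ell-1})/h_\ell\big)$ on $\overline{\tau_\ell}$, and $\varphi_i=0$ on $\overline{\tau_\ell}$ if $i\notin\{\alpha(m,\ell)\}_m$. For $v\in L^2(0,T)$ let $$\mathcal H_Tv=\sum_{k\ge0}v_k\cos\Big(\big(\tfrac\pi2+k\pi\big)\tfrac tT\Big)\in L^2(0,T),\qquad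 v_k=\frac2T\int_0^Tv(t)\sin\Big(\big(\tfrac\pi2+k\pi\big)\tfrac tT\Big)dt,$$ and let $$M^{\mathcal H_T}[i,j]=\langle\varphi_j,\mathcal H_T\varphi_i\rangle,\quad A^{\mathcal H_T}[i,j]=\langle\partial_t\varphi_j,\mathcal H_T\varphi_i\rangle,\quad B^{\mathcal H_T}[i,j]=\langle\partial_t\varphi_j,\mathcal H_T\partial_t\varphi_i\rangle$$ with the inner product of $L^2(0,T)$. Let $\mathcal K(s,t)=-\frac1\pi\ln\big[\tan\frac{\pi(s+t)}{4T}\tan\frac{\pi|t-s|}{4T}\big]$. For polynomials $a,q$ put $$D_{k,\ell}(a,q)=h_\ell\int_0^1a(\eta)\int_0^1\mathcal K(t_{k-1}+\xi h_k,t_{\ell-1}+\eta h_\ell)\,q'(\xi)\,d\xi\,d\eta,$$ $$E_{k,\ell}(a,q)=-\delta_{k,1}q(0)\frac{2h_\ell}\pi\int_0^1a(\eta)\ln\tan\frac{\pi(t_{\ell-1}+\eta h_\ell)}{4T}\,d\eta,$$ $$J^0_{k,\ell}[m]=-\pi\int_0^1\partial_t\psi^{p_\ell}_m(\eta)\,\mathcal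 K(t_{k-1},t_{\ell-1}+\eta h_\ell)\,d\eta,\qquad J^1_{k,\ell}[m]=-\pi\int_0^1\partial_t\psi^{p_\ell}_m(\eta)\,\mathcal K(t_k,t_{\ell-1}+\eta h_\ell)\,d\eta .$$ The local matrices (for $1\le n\le p_k+1$, $1\le m\le p_\ell+1$) are $$M^{\mathcal H_T}_{k,\ell}[n,m]=(E_{k,\ell}+D_{k,\ell})(\psi^{p_\ell}_m,\psi^{p_k}_n),\qquad A^{\mathcal H_T}_{k,\ell}[n,m]=(E_{k,\ell}+D_{k,\ell})\big(\tfrac1{h_\ell}\partial_t\psi^{p_\ell}_m,\psi^{p_k}_n\big),$$ $$B^{\mathcal H_T}_{k,\ell}[n,m]=-\frac{\partial_t\psi^{p_k}_n(0)}{\pi h_k}J^0_{k,\ell}[m]+\frac{\partial_t\psi^{p_k}_n(1)}{\pi h_k}J^1_{k,\ell}[m]+D_{k,\ell}\big(\tfrac1{h_\ell}\partial_t\psi^{p_\ell}_m,\tfrac1{h_k}\partial_t\psi^{p_k}_n\big).$$ **Quadratures.** For $K\in\mathbb N$ let $(\omega_{\nu,K},\xi_{\nu,K})$ and $(\hat\omega_{\nu,K},\hat\xi_{\nu,K})$,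 $\nu=1,\dots,K$, be the weights and the nodes in $[0,1]$ of the Gauß–Legendre rule, $\int_0^1g=\sum_\nu\omega_{\nu,K}\,g(\xi_{\nu,K})$, and of the Gauß–Jacobi rule for the logarithm, $-\int_0^1g(x)\ln x\,dx=\sum_\nu\hat\omega_{\nu,K}\,g(\hat\xi_{\nu,K})$, both exact for polynomials $g$ of degree at most $2K-1$. In the schemes below: * (L) an integral $\int_0^1f$, or $\int_0^1\!\int_0^1G(\xi,\eta)\,d\xi\,d\eta$, whose integrand is not written with a factor $\ln x$, $\ln y$ or $\ln|\xi-\eta|$ of the types below is computed by the Gauß–Legendre rule, or by the tensor Gauß rule $\sum_{\nu_1\le K_1}\sum_{\nu_2\le K_2}\omega_{\nu_1,K_1}\omega_{\nu_2,K_2}G(\xi_{\nu_1,K_1},\xi_{\nu_2,K_2})$; * (J1) $\int_0^1f(x)\ln x\,dx$, with $f$ a polynomial, is computed by $-\sum_\nu\hat\omega_{\nu,L}f(\hat\xi_{\nu,L})$; * (J2) $\int_0^1\!\int_0^1P(x,y)\ln y\,dx\,dy$, with $P$ a polynomial, is computed by $-\sum_{\mu\le L'}\sum_{\nu\le L}\omega_{\mu,L'}\hat\omega_{\nu,L}P(\xi_{\mu,L'},\hat\xi_{\nu,L})$;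 * (J3) $\int_0^1\!\int_0^1g(s,t)\ln|s-t|\,ds\,dt$, with $g$ a polynomial, is computed, with all rules of order $L$, by $$-\sum_{\mu,\nu}\hat\omega_\mu\hat\xi_\mu\omega_\nu\big(g((1-\xi_\nu)\hat\xi_\mu,\hat\xi_\mu)+g(1-(1-\xi_\nu)\hat\xi_\mu,1-\hat\xi_\mu)\big)-\sum_{\mu,\nu}\omega_\mu\xi_\mu\hat\omega_\nu\big(g((1-\hat\xi_\nu)\xi_\mu,\xi_\mu)+g(1-(1-\hat\xi_\nu)\xi_\mu,1-\xi_\mu)\big).$$ **Schemes.** Let $$F_{k,\ell}(s,t)=\begin{cases}\ln\Big[\dfrac{\tan\frac{\pi(s+t)}{4T}}{s+t}\,\dfrac{\tan\frac{\pi|t-s|}{4T}}{|s-t|}\Big],&k=\ell=1,\\[2mm]\ln\Big[\tan\frac{\pi(s+t)}{4T}\,(2T-s-t)\,\dfrac{\tan\frac{\pi|t-s|}{4T}}{|s-t|}\Big],&k=\ell=N,\\[2mm]\ln\Big[\tan\frac{\pi(s+t)}{4T}\,\dfrac{\tan\frac{\pi|t-s|}{4T}}{|s-t|}\Big],&\text{otherwise,}\end{cases}$$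 with the limits inserted at the removable singularities. The local entries are computed by replacing $D_{k,\ell}$, $E_{k,\ell}$, $J^0_{k,\ell}$, $J^1_{k,\ell}$ by the following expressions and all integrals in these by the quadratures above. 1. With $b=q'$ and $\Delta=\ln h_\ell\,(q(1)-q(0))\int_0^1a$, $$D_{k,\ell}(a,q)=-\frac{h_\ell}\pi\Big[\int_0^1\!\!\int_0^1a(\eta)F_{k,\ell}(t_{k-1}+(1-\xi)\eta h_k,t_{\ell-1}+\eta h_\ell)\,\eta\, b((1-\xi)\eta)\,d\xi d\eta+\int_0^1\!\!\int_0^1a((1-\eta)\xi)F_{k,\ell}(t_{k-1}+\xi h_k,t_{\ell-1}+(1-\eta)\xi h_\ell)\,\xi\, b(\xi)\,d\xi d\eta+S_{k,\ell}\Big].$$ Write $[P;r]=\int_0^1\!\int_0^1P(x,y)\ln y\,dx\,dy+\int_0^1\!\int_0^1P(x,y)\,r(x)\,dx\,dy$ (the first integral by (J2), the second by (L)). Then * $k=\ell=1$: $S=2\Delta+\int_0^1\!\int_0^1a(\eta)b(\xi)\ln|\xi-\eta|\,d\xi d\eta+[a(y)\,y\,b(xy);\ln(1+x)]+[a(xy)\,y\,b(y);\ln(1+x)]$;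 * $k=\ell=N$: $S=\int_0^1\!\int_0^1a(\eta)b(\xi)\ln|\xi-\eta|\,d\xi d\eta-[a(1-y)b(1-xy)y;\ln(1+x)]-[a(1-xy)b(1-y)y;\ln(1+x)]$; * $1<k=\ell<N$: $S=\Delta+\int_0^1\!\int_0^1a(\eta)b(\xi)\ln|\xi-\eta|\,d\xi d\eta$; * $k=\ell+1$: $S=[a(1-y)b(xy)y;\ln(xh_k+h_\ell)]+[a(1-y+xy)b(y)y;\ln((1-x)h_\ell+h_k)]$; * $k+1=\ell$: $S=[a((1-x)y)b(1-y)y;\ln(h_k+(1-x)h_\ell)]+[a(y)b(1-y+xy)y;\ln((1-x)h_k+h_\ell)]$; * otherwise: $S=\int_0^1\!\int_0^1a(\eta)b(\xi)\ln|t_{k-1}+\xi h_k-t_{\ell-1}-\eta h_\ell|\,d\xi d\eta$. 2. $E_{k,\ell}(a,q)$ is $0$ for $k\ne1$. For $k=1$ it is $-q(0)\frac{2h_\ell}\pi$ times $\int_0^1a(\eta)\ln\tan\frac{\pi(t_{\ell-1}+\eta h_\ell)}{4T}d\eta$ if $\ell>1$, and times $\int_0^1a(\eta)\ln\frac{\tan(\pi\eta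 h_1/(4T))}{\eta h_1}d\eta+\int_0^1a(\eta)\ln\eta\,d\eta+\ln h_1\int_0^1a$ if $\ell=1$. 3. With $d=\partial_t\psi^{p_\ell}_m$ and $\Gamma=\ln h_\ell\,(\psi^{p_\ell}_m(1)-\psi^{p_\ell}_m(0))$ (evaluated without quadrature), $J^0_{k,\ell}[m]=\int_0^1d(\eta)F_{k,\ell}(t_{k-1},t_{\ell-1}+\eta h_\ell)d\eta+R^0$, where $R^0$ is * $2\Gamma+2\int_0^1d(\eta)\ln\eta\,d\eta$ for $k=\ell=1$; * $\int_0^1d(\eta)\ln\eta\,d\eta-\int_0^1d(\eta)\ln(2-\eta)d\eta$ for $k=\ell=N$; * $\Gamma+\int_0^1d(\eta)\ln\eta\,d\eta$ for $1<k=\ell<N$; * $\Gamma+\int_0^1d(1-\eta)\ln\eta\,d\eta$ for $k=\ell+1$; * $\int_0^1d(\eta)\ln(h_k+\eta h_\ell)d\eta$ for $k+1=\ell$; * $\int_0^1d(\eta)\ln|t_{k-1}-t_{\ell-1}-\eta h_\ell|d\eta$ otherwise. 4. $J^1_{N,N}[m]=0$, and in all other cases $J^1_{k,\ell}[m]=\int_0^1d(\eta)F_{k,\ell}(t_k,t_{\ell-1}+\eta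 h_\ell)d\eta+R^1$, where $R^1$ is * $2\Gamma+\int_0^1d(\eta)\ln(1+\eta)d\eta+\int_0^1d(1-\eta)\ln\eta\,d\eta$ for $k=\ell=1$; * $\Gamma+\int_0^1d(1-\eta)\ln\eta\,d\eta$ for $1<k=\ell<N$; * $\int_0^1d(\eta)\ln(h_k+(1-\eta)h_\ell)d\eta$ for $k=\ell+1$; * $\Gamma+\int_0^1d(\eta)\ln\eta\,d\eta$ for $k+1=\ell$; * $\int_0^1d(\eta)\ln|t_k-t_{\ell-1}-\eta h_\ell|d\eta$ otherwise. **Theorem.** (i) For each of the finitely many integrals of type (L) in the schemes for the entries of $M^{\mathcal H_T}_{k,\ell}$, $A^{\mathcal H_T}_{k,\ell}$, $B^{\mathcal H_T}_{k,\ell}$ (all $k,\ell,n,m$) there are $C$ and $\rho\in(0,1)$ such that the error of the Gauß–Legendre quadrature is at most $C\rho^K$ for all orders $K\ge1$, or the error of the tensor Gauß quadrature is at most $C(\rho^{K_1}+\rho^{K_2})$ for all orders $K_1,K_2\ge1$. (ii) For the entry with indices $k,\ell,n,m$, the quadratures (J1), (J2), (J3) are exact whenever all their orders are at least $(p_k+p_\ell+1)/2$.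 (iii) Choose the orders of all quadratures (J1), (J2), (J3) in any way (they may differ from integral to integral) such that each of them computes its integral exactly, and use the order $K$ (in each direction) for all quadratures (L). Then each computed local entry converges exponentially to the entry of $M^{\mathcal H_T}_{k,\ell}$, $A^{\mathcal H_T}_{k,\ell}$, $B^{\mathcal H_T}_{k,\ell}$, that is, with an error of at most $C\rho^K$ for all $K\ge1$, with some $C$ and $\rho\in(0,1)$ independent of $K$. The same holds for the entries of $M^{\mathcal H_T}$, $A^{\mathcal H_T}$, $B^{\mathcal H_T}$ when they are computed by adding, for all $k,\ell,n,m$, the computed local entry with these indices to the entry $[\alpha(n,k),\alpha(m,\ell)]$. -/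

import Mathlib

noncomputable section

namespace ModHilbert

open Real Set MeasureTheory Polynomial

/-! ### The modified Hilbert transformation on `L²(0,T)` -/

/-- Lebesgue measure on the interval `(0,T)`. -/
abbrev vol (T : ℝ) : Measure ℝ := volume.restrict (Ioo 0 T)

/-- The frequencies `(π/2 + kπ)/T`. -/
def freq (T : ℝ) (k : ℕ) : ℝ := (π / 2 + k * π) / T

/-- The Fourier coefficients `v_k = (2/T) ∫₀ᵀ v(x) sin((π/2 + kπ) x / T) dx`. -/
def sinCoeff (T : ℝ) (v : ℝ → ℝ) (k : ℕ) : ℝ :=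
  2 / T * ∫ x in Ioo 0 T, v x * sin (freq T k * x)

theorem memLp_cos (T : ℝ) (k : ℕ) : MemLp (fun x => cos (freq T k * x)) 2 (vol T) :=
  MemLp.of_bound (by fun_prop) 1 (Filter.Eventually.of_forall fun x => by
    simpa using abs_cos_le_one (freq T k * x))

/-- `cos((π/2 + kπ) x / T)` as an element of `L²(0,T)`. -/
def cosLp (T : ℝ) (k : ℕ) : Lp ℝ 2 (vol T) := (memLp_cos T k).toLp _

/-- The modified Hilbert transformation `v ↦ ∑ₖ v_k cos((π/2 + kπ) x / T)`, for
`v` square integrable on `(0,T)`; the series converges (unconditionally) in `L²(0,T)`. -/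
def modHilbert (T : ℝ) (v : ℝ → ℝ) : Lp ℝ 2 (vol T) :=
  ∑' k : ℕ, sinCoeff T v k • cosLp T k

/-- The kernel `𝒦(s,t) = -(1/π) ln[tan(π(s+t)/(4T)) tan(π|t-s|/(4T))]`. -/
def kern (T s t : ℝ) : ℝ :=
  -(1 / π) * log (tan (π * (s + t) / (4 * T)) * tan (π * |t - s| / (4 * T)))

/-! ### Gauß rules on `[0,1]` -/

/-- A `K`-point Gauß rule on `[0,1]` for the weight function `w`: it integrates all polynomials
of degree at most `2K - 1` exactly against `w`. -/
structure GaussRule (w : ℝ → ℝ) (K : ℕ) where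
  node : Fin K → ℝ
  weight : Fin K → ℝ
  node_mem : ∀ ν, node ν ∈ Icc (0 : ℝ) 1
  exact : ∀ g : ℝ[X], g.natDegree + 1 ≤ 2 * K →
    ∫ x in (0 : ℝ)..1, g.eval x * w x = ∑ ν, weight ν * g.eval (node ν)

/-- Gauß–Legendre rules. -/
abbrev LegendreRule (K : ℕ) := GaussRule (fun _ => 1) K

/-- Gauß–Jacobi rules for the logarithmic weight `-ln`. -/
abbrev LogRule (K : ℕ) := GaussRule (fun x => -log x) K

/-- Exponential convergence to zero of a sequence of errors indexed by `K ≥ 1`. -/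
def ExpConv (e : ℕ → ℝ) : Prop :=
  ∃ C ρ : ℝ, 0 < ρ ∧ ρ < 1 ∧ ∀ K : ℕ, 1 ≤ K → |e K| ≤ C * ρ ^ K

/-- The same for errors that depend on two orders. -/
def ExpConv₂ (e : ℕ → ℕ → ℝ) : Prop :=
  ∃ C ρ : ℝ, 0 < ρ ∧ ρ < 1 ∧
    ∀ K₁ K₂ : ℕ, 1 ≤ K₁ → 1 ≤ K₂ → |e K₁ K₂| ≤ C * (ρ ^ K₁ + ρ ^ K₂)

/-- `∑ ω_ν f(ξ_ν)`, the Gauß–Legendre quadrature of order `K`. -/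
def quadLeg (LR : ∀ K, LegendreRule K) (K : ℕ) (f : ℝ → ℝ) : ℝ :=
  ∑ ν, (LR K).weight ν * f ((LR K).node ν)

/-- The tensor Gauß quadrature with orders `K₁`, `K₂`. -/
def quadTensor (LR : ∀ K, LegendreRule K) (K₁ K₂ : ℕ) (G : ℝ → ℝ → ℝ) : ℝ :=
  ∑ ν₁, ∑ ν₂, (LR K₁).weight ν₁ * (LR K₂).weight ν₂ * G ((LR K₁).node ν₁) ((LR K₂).node ν₂)

/-- The approximation `-∑ ω̂_ν f(ξ̂_ν)` of `∫₀¹ f(x) ln x dx`. -/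
def quadLog (JR : ∀ K, LogRule K) (K : ℕ) (f : ℝ → ℝ) : ℝ :=
  -∑ ν, (JR K).weight ν * f ((JR K).node ν)

/-- The approximation `-∑ ∑ ω_μ ω̂_ν G(ξ_μ, ξ̂_ν)` of `∫₀¹ ∫₀¹ G(x,y) ln y dx dy`. -/
def quadMixed (LR : ∀ K, LegendreRule K) (JR : ∀ K, LogRule K) (K₁ K₂ : ℕ)
    (G : ℝ → ℝ → ℝ) : ℝ :=
  -∑ μ, ∑ ν, (LR K₁).weight μ * (JR K₂).weight ν * G ((LR K₁).node μ) ((JR K₂).node ν)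

/-- The quadrature of order `K` for `∫₀¹ ∫₀¹ g(s,t) ln|s-t| ds dt`. -/
def quadLogTensor (LR : ∀ K, LegendreRule K) (JR : ∀ K, LogRule K) (K : ℕ)
    (g : ℝ → ℝ → ℝ) : ℝ :=
  let ω := (LR K).weight
  let ξ := (LR K).node
  let ω' := (JR K).weight
  let ξ' := (JR K).node
  0 - (∑ μ, ∑ ν, ω' μ * ξ' μ * ω ν *
        (g ((1 - ξ ν) * ξ' μ) (ξ' μ) + g (1 - (1 - ξ ν) * ξ' μ) (1 - ξ' μ)))
    - ∑ μ, ∑ ν, ω μ * ξ μ * ω' ν *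
        (g ((1 - ξ' ν) * ξ μ) (ξ μ) + g (1 - (1 - ξ' ν) * ξ μ) (1 - ξ μ))

/-- The summands of the quadrature schemes: a coefficient `c` times an integral, together with the
kind of quadrature that is applied to this integral. -/
inductive QTerm
  /-- a number that needs no quadrature -/
  | const (c : ℝ)
  /-- `c ∫₀¹ f(x) dx`, Gauß–Legendre -/
  | leg (c : ℝ) (f : ℝ → ℝ)
  /-- `c ∫₀¹ ∫₀¹ G(x,y) dx dy`, tensor Gauß -/
  | tensor (c : ℝ) (G : ℝ → ℝ → ℝ)
  /-- `c ∫₀¹ f(x) ln x dx`, Gauß–Jacobi -/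
  | log (c : ℝ) (f : ℝ → ℝ)
  /-- `c ∫₀¹ ∫₀¹ G(x,y) ln y dx dy`, Gauß–Legendre in `x` and Gauß–Jacobi in `y` -/
  | mixed (c : ℝ) (G : ℝ → ℝ → ℝ)
  /-- `c ∫₀¹ ∫₀¹ g(s,t) ln|s-t| ds dt`, the logarithmic tensor quadrature -/
  | logTensor (c : ℝ) (g : ℝ → ℝ → ℝ)

/-- The computed value of a summand: the (tensor) Gauß–Legendre quadratures use the order `K` (per
direction), the quadratures for the logarithmic integrals use the orders `o`. -/
def QTerm.quad (LR : ∀ K, LegendreRule K) (JR : ∀ K, LogRule K) (K : ℕ) (o : ℕ × ℕ) : QTerm → ℝ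
  | .const c => c
  | .leg c f => c * quadLeg LR K f
  | .tensor c G => c * quadTensor LR K K G
  | .log c f => c * quadLog JR o.1 f
  | .mixed c G => c * quadMixed LR JR o.1 o.2 G
  | .logTensor c g => c * quadLogTensor LR JR o.1 g

/-- With the orders `o`, the quadrature applied to this logarithmic integral is exact (no condition
on the other summands). -/
def QTerm.LogExact (LR : ∀ K, LegendreRule K) (JR : ∀ K, LogRule K) (o : ℕ × ℕ) : QTerm → Prop
  | .const _ => True
  | .leg _ _ => True
  | .tensor _ _ => True
  | .log _ f => quadLog JR o.1 f = ∫ x in (0 : ℝ)..1, f x * Real.log x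
  | .mixed _ G => quadMixed LR JR o.1 o.2 G =
      ∫ y in (0 : ℝ)..1, ∫ x in (0 : ℝ)..1, G x y * Real.log y
  | .logTensor _ g => quadLogTensor LR JR o.1 g =
      ∫ t in (0 : ℝ)..1, ∫ s in (0 : ℝ)..1, g s t * Real.log |s - t|

/-- The (tensor) Gauß–Legendre quadrature applied to this integral converges exponentially (no
condition on the other summands). -/
def QTerm.LegConv (LR : ∀ K, LegendreRule K) : QTerm → Prop
  | .const _ => True
  | .leg _ f => ExpConv fun K => quadLeg LR K f - ∫ x in (0 : ℝ)..1, f x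
  | .tensor _ G => ExpConv₂ fun K₁ K₂ =>
      quadTensor LR K₁ K₂ G - ∫ y in (0 : ℝ)..1, ∫ x in (0 : ℝ)..1, G x y
  | .log _ _ => True
  | .mixed _ _ => True
  | .logTensor _ _ => True

/-! ### Regular parts of the kernel

The quotient `tan(πx/(4T))/x` and the product `tan(πx/(4T)) (2T-x)` carry their limits at the
removable singularities `x = 0` and `x = 2T`. -/

def tanQuot (T x : ℝ) : ℝ := if x = 0 then π / (4 * T) else tan (π * x / (4 * T)) / x

def tanProd (T x : ℝ) : ℝ :=
  if x = 2 * T then 4 * T / π else tan (π * x / (4 * T)) * (2 * T - x)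

section Scheme

/-! ### Quadrature schemes

The mesh is `0 = t₀ < … < t_N = T`. The element with index `ℓ : Fin N` is
`(t ℓ.castSucc, t ℓ.succ)`, so that the indices `0, …, N-1` stand for `1, …, N`. -/

variable (T : ℝ) {N : ℕ} (t : Fin (N + 1) → ℝ) (k ℓ : Fin N)

/-- Left end point of an element. -/
def lft (t : Fin (N + 1) → ℝ) (ℓ : Fin N) : ℝ := t ℓ.castSucc

/-- Right end point of an element. -/
def rgt (t : Fin (N + 1) → ℝ) (ℓ : Fin N) : ℝ := t ℓ.succ

/-- Mesh size of an element. -/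
def msize (t : Fin (N + 1) → ℝ) (ℓ : Fin N) : ℝ := rgt t ℓ - lft t ℓ

/-- Both elements are the first one. -/
def BothFirst (k ℓ : Fin N) : Prop := (k : ℕ) = 0 ∧ (ℓ : ℕ) = 0

/-- Both elements are the last one. -/
def BothLast (k ℓ : Fin N) : Prop := (k : ℕ) + 1 = N ∧ (ℓ : ℕ) + 1 = N

open Classical in
/-- The regular part `F_{k,ℓ}(s,t)` of `ln[tan(π(s+t)/(4T)) tan(π|t-s|/(4T))]`. -/
def regF (s x : ℝ) : ℝ :=
  if BothFirst k ℓ then Real.log (tanQuot T (s + x) * tanQuot T |x - s|)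
  else if BothLast k ℓ then Real.log (tanProd T (s + x) * tanQuot T |x - s|)
  else Real.log (tan (π * (s + x) / (4 * T)) * tanQuot T |x - s|)

/-- `c ∫₀¹ ∫₀¹ P(x,y) (ln y + r(x)) dx dy`, split into its logarithmic and its regular part. -/
def splitTerms (c : ℝ) (P : ℝ → ℝ → ℝ) (r : ℝ → ℝ) : List QTerm :=
  [.mixed c P, .tensor c fun x y => P x y * r x]

open Classical in
/-- Scheme for the singular part of `h_ℓ ∫₀¹ a(η) ∫₀¹ 𝒦(t_{k-1} + ξ h_k, t_{ℓ-1} + η h_ℓ) q'(ξ) dξ dη`,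
where `a`, `q` are polynomials. -/
def singTerms (a q : ℝ[X]) : List QTerm :=
  let A := fun x : ℝ => a.eval x
  let b := fun x : ℝ => q.derivative.eval x
  let hk := msize t k
  let hl := msize t ℓ
  let c := -(hl / π)
  if BothFirst k ℓ then
    [.leg (c * (Real.log hl * (q.eval 1 - q.eval 0))) A,
     .logTensor c fun ξ η => A η * b ξ,
     .leg (c * (Real.log hl * (q.eval 1 - q.eval 0))) A] ++
    splitTerms c (fun x y => A y * y * b (x * y)) (fun x => Real.log (1 + x)) ++
    splitTerms c (fun x y => A (y * x) * y * b y) (fun x => Real.log (1 + x))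
  else if BothLast k ℓ then
    [.logTensor c fun ξ η => A η * b ξ] ++
    splitTerms (-c) (fun x y => A (1 - y) * b (1 - y * x) * y) (fun x => Real.log (1 + x)) ++
    splitTerms (-c) (fun x y => A (1 - y * x) * b (1 - y) * y) (fun x => Real.log (1 + x))
  else if (k : ℕ) = ℓ then
    [.leg (c * (Real.log hl * (q.eval 1 - q.eval 0))) A,
     .logTensor c fun ξ η => A η * b ξ]
  else if (k : ℕ) = ℓ + 1 then
    splitTerms c (fun x y => A (1 - y) * b (y * x) * y) (fun x => Real.log (x * hk + hl)) ++
    splitTerms c (fun x y => A (1 - y + x * y) * b y * y)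
      (fun x => Real.log ((1 - x) * hl + hk))
  else if (k : ℕ) + 1 = ℓ then
    splitTerms c (fun x y => A ((1 - x) * y) * b (1 - y) * y)
      (fun x => Real.log (hk + (1 - x) * hl)) ++
    splitTerms c (fun x y => A y * b (1 - y + x * y) * y)
      (fun x => Real.log ((1 - x) * hk + hl))
  else
    [.tensor c fun ξ η =>
      A η * b ξ * Real.log |(lft t k + ξ * hk) - (lft t ℓ + η * hl)|]

/-- Scheme for `h_ℓ ∫₀¹ a(η) ∫₀¹ 𝒦(t_{k-1} + ξ h_k, t_{ℓ-1} + η h_ℓ) q'(ξ) dξ dη`. -/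
def kernTerms (a q : ℝ[X]) : List QTerm :=
  let A := fun x : ℝ => a.eval x
  let b := fun x : ℝ => q.derivative.eval x
  let hk := msize t k
  let hl := msize t ℓ
  let c := -(hl / π)
  [.tensor c fun ξ η =>
      A η * (regF T k ℓ (lft t k + (1 - ξ) * η * hk) (lft t ℓ + η * hl) * η) * b ((1 - ξ) * η),
   .tensor c fun ξ η =>
      A ((1 - η) * ξ) * (regF T k ℓ (lft t k + ξ * hk) (lft t ℓ + (1 - η) * ξ * hl) * ξ) * b ξ] ++
  singTerms t k ℓ a q

/-- Scheme for `-δ_{k,1} q(0) (2 h_ℓ/π) ∫₀¹ a(η) ln tan(π(t_{ℓ-1} + η h_ℓ)/(4T)) dη`. -/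
def initTerms (a q : ℝ[X]) : List QTerm :=
  let A := fun x : ℝ => a.eval x
  let hl := msize t ℓ
  let c := -(q.eval 0 * (2 * hl / π))
  if (k : ℕ) = 0 then
    if (ℓ : ℕ) = 0 then
      [.leg c fun η => A η * Real.log (tanQuot T (η * hl)),
       .log c A,
       .leg (c * Real.log hl) A]
    else
      [.leg c fun η => A η * Real.log (tan (π * (lft t ℓ + η * hl) / (4 * T)))]
  else []

open Classical in
/-- Scheme for `c J⁰_{k,ℓ}`, where `J⁰_{k,ℓ} = -π ∫₀¹ u'(η) 𝒦(t_{k-1}, t_{ℓ-1} + η h_ℓ) dη`. -/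
def J0Terms (c : ℝ) (u : ℝ[X]) : List QTerm :=
  let d := fun x : ℝ => u.derivative.eval x
  let hk := msize t k
  let hl := msize t ℓ
  let jump := u.eval 1 - u.eval 0
  [.leg c fun η => d η * regF T k ℓ (lft t k) (lft t ℓ + η * hl)] ++
  if BothFirst k ℓ then
    [.log (2 * c) d, .const (c * (2 * Real.log hl * jump))]
  else if BothLast k ℓ then
    [.log c d, .leg (-c) fun η => d η * Real.log (2 - η)]
  else if (k : ℕ) = ℓ then
    [.const (c * (Real.log hl * jump)), .log c d]
  else if (k : ℕ) = ℓ + 1 then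
    [.const (c * (Real.log hl * jump)), .log c fun η => d (1 - η)]
  else if (k : ℕ) + 1 = ℓ then
    [.leg c fun η => d η * Real.log (hk + η * hl)]
  else
    [.leg c fun η => d η * Real.log |lft t k - (lft t ℓ + η * hl)|]

open Classical in
/-- Scheme for `c J¹_{k,ℓ}`, where `J¹_{k,ℓ} = -π ∫₀¹ u'(η) 𝒦(t_k, t_{ℓ-1} + η h_ℓ) dη`
(which vanishes for `k = ℓ = N`). -/
def J1Terms (c : ℝ) (u : ℝ[X]) : List QTerm :=
  let d := fun x : ℝ => u.derivative.eval x
  let hk := msize t k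
  let hl := msize t ℓ
  let jump := u.eval 1 - u.eval 0
  if BothLast k ℓ then []
  else
    [.leg c fun η => d η * regF T k ℓ (rgt t k) (lft t ℓ + η * hl)] ++
    if BothFirst k ℓ then
      [.leg c fun η => d η * Real.log (1 + η), .log c fun η => d (1 - η),
       .const (c * (2 * Real.log hl * jump))]
    else if (k : ℕ) = ℓ then
      [.const (c * (Real.log hl * jump)), .log c fun η => d (1 - η)]
    else if (k : ℕ) = ℓ + 1 then
      [.leg c fun η => d η * Real.log (hk + (1 - η) * hl)]
    else if (k : ℕ) + 1 = ℓ then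
      [.const (c * (Real.log hl * jump)), .log c d]
    else
      [.leg c fun η => d η * Real.log |rgt t k - (lft t ℓ + η * hl)|]

/-- The three matrices. -/
inductive Kind
  | M
  | A
  | B

/-- The quadrature scheme for the local entry with trial shape function `un` on the element `k` and
test shape function `um` on the element `ℓ`. -/
def scheme (un um : ℝ[X]) : Kind → List QTerm
  | .M => initTerms T t k ℓ um un ++ kernTerms T t k ℓ um un
  | .A =>
    initTerms T t k ℓ (C (1 / msize t ℓ) * derivative um) un ++
    kernTerms T t k ℓ (C (1 / msize t ℓ) * derivative um) un
  | .B =>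
    J0Terms T t k ℓ (-1 / (π * msize t k) * (derivative un).eval 0) um ++
    J1Terms T t k ℓ (1 / (π * msize t k) * (derivative un).eval 1) um ++
    kernTerms T t k ℓ (C (1 / msize t ℓ) * derivative um) (C (1 / msize t k) * derivative un)

/-- The computed local entry. The (tensor) Gauß–Legendre quadratures have order `K`, and `L` chooses
the orders of the quadratures for the logarithmic integrals. -/
def localQuad (LR : ∀ K, LegendreRule K) (JR : ∀ K, LogRule K) (L : QTerm → ℕ × ℕ)
    (un um : ℝ[X]) (X : Kind) (K : ℕ) : ℝ :=
  ((scheme T t k ℓ un um X).map fun τ => τ.quad LR JR K (L τ)).sum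

/-- `J⁰_{k,ℓ}`. -/
def J0 (um : ℝ[X]) : ℝ :=
  -π * ∫ η in (0 : ℝ)..1, (derivative um).eval η * kern T (lft t k) (lft t ℓ + η * msize t ℓ)

/-- `J¹_{k,ℓ}`. -/
def J1 (um : ℝ[X]) : ℝ :=
  -π * ∫ η in (0 : ℝ)..1, (derivative um).eval η * kern T (rgt t k) (lft t ℓ + η * msize t ℓ)

/-- The entries of the local matrices. -/
def localEntry (un um : ℝ[X]) : Kind → ℝ
  | .M =>
    -((if (k : ℕ) = 0 then 1 else 0) * un.eval 0 * (2 * msize t ℓ / π) *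
      ∫ η in (0 : ℝ)..1, um.eval η * Real.log (tan (π * (lft t ℓ + η * msize t ℓ) / (4 * T)))) +
    msize t ℓ * ∫ η in (0 : ℝ)..1, um.eval η *
      ∫ ξ in (0 : ℝ)..1, kern T (lft t k + ξ * msize t k) (lft t ℓ + η * msize t ℓ) *
        (derivative un).eval ξ
  | .A =>
    -((if (k : ℕ) = 0 then 1 else 0) * un.eval 0 * (2 / π) *
      ∫ η in (0 : ℝ)..1, (derivative um).eval η *
        Real.log (tan (π * (lft t ℓ + η * msize t ℓ) / (4 * T)))) +
    ∫ η in (0 : ℝ)..1, (derivative um).eval η *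
      ∫ ξ in (0 : ℝ)..1, kern T (lft t k + ξ * msize t k) (lft t ℓ + η * msize t ℓ) *
        (derivative un).eval ξ
  | .B =>
    -1 / (π * msize t k) * (derivative un).eval 0 * J0 T t k ℓ um +
    1 / (π * msize t k) * (derivative un).eval 1 * J1 T t k ℓ um +
    1 / msize t k * ∫ η in (0 : ℝ)..1, (derivative um).eval η *
      ∫ ξ in (0 : ℝ)..1, kern T (lft t k + ξ * msize t k) (lft t ℓ + η * msize t ℓ) *
        (derivative (derivative un)).eval ξ

end Scheme

section FE

/-! ### Finite element functions and the global matrices -/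

variable (T : ℝ) {N : ℕ} (t : Fin (N + 1) → ℝ) (p : Fin N → ℕ)

/-- The continuous functions on `[0,T]` that are on each element `ℓ` a polynomial of degree at
most `p ℓ`. -/
def splineSpace : Set (Icc (0 : ℝ) T → ℝ) :=
  {v | Continuous v ∧ ∀ ℓ : Fin N, ∃ g : ℝ[X], g.natDegree ≤ p ℓ ∧
    ∀ x : Icc (0 : ℝ) T, (x : ℝ) ∈ Ioo (lft t ℓ) (rgt t ℓ) → v x = g.eval (x : ℝ)}

/-- `φ` is a basis of the space of piecewise polynomials for which only the first function is nonzero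
at `0`, and which is locally given by the shape functions `ψ q 0, …, ψ q q` on `[0,1]` of the
polynomial degrees `q = p ℓ`: on the closed element `ℓ`, the function with the global index `α ℓ m`
is the `m`-th shape function, and the functions without a local index vanish. -/
structure IsFEBasis {M : ℕ} (φ : Fin M → ℝ → ℝ) (ψ : (q : ℕ) → Fin (q + 1) → ℝ[X])
    (α : (ℓ : Fin N) → Fin (p ℓ + 1) → Fin M) : Prop where
  linearIndependent : LinearIndependent ℝ fun i => (Icc (0 : ℝ) T).domRestrict (φ i)
  span_eq : (Submodule.span ℝ (range fun i => (Icc (0 : ℝ) T).domRestrict (φ i)) :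
    Set (Icc (0 : ℝ) T → ℝ)) = splineSpace T t p
  eval_zero : ∀ j : Fin M, (j : ℕ) ≠ 0 → φ j 0 = 0
  natDegree_le : ∀ ℓ m, (ψ (p ℓ) m).natDegree ≤ p ℓ
  eq_shape : ∀ ℓ m, ∀ x ∈ Icc (lft t ℓ) (rgt t ℓ),
    φ (α ℓ m) x = (ψ (p ℓ) m).eval ((x - lft t ℓ) / msize t ℓ)
  index_injective : ∀ ℓ, Function.Injective (α ℓ)
  eq_zero : ∀ ℓ i, i ∉ range (α ℓ) → ∀ x ∈ Icc (lft t ℓ) (rgt t ℓ), φ i x = 0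

/-- The matrices `⟨φ_j, H φ_i⟩`, `⟨φ_j', H φ_i⟩`, `⟨φ_j', H φ_i'⟩`, with the inner product of `L²(0,T)`
and the modified Hilbert transformation `H`. -/
def globalEntry {M : ℕ} (φ : Fin M → ℝ → ℝ) (i j : Fin M) : Kind → ℝ
  | .M => ∫ x in Ioo 0 T, φ j x * modHilbert T (φ i) x
  | .A => ∫ x in Ioo 0 T, deriv (φ j) x * modHilbert T (φ i) x
  | .B => ∫ x in Ioo 0 T, deriv (φ j) x * modHilbert T (deriv (φ i)) x

/-- The entries of the matrices that are assembled element-wise from the computed local matrices. -/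
def globalQuad {M : ℕ} (ψ : (q : ℕ) → Fin (q + 1) → ℝ[X])
    (α : (ℓ : Fin N) → Fin (p ℓ + 1) → Fin M)
    (LR : ∀ K, LegendreRule K) (JR : ∀ K, LogRule K) (L : QTerm → ℕ × ℕ)
    (X : Kind) (K : ℕ) (i j : Fin M) : ℝ :=
  ∑ k : Fin N, ∑ ℓ : Fin N, ∑ n : Fin (p k + 1), ∑ m : Fin (p ℓ + 1),
    if α k n = i ∧ α ℓ m = j then
      localQuad T t k ℓ LR JR L (ψ (p k) n) (ψ (p ℓ) m) X K
    else 0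

end FE

end ModHilbert

end

/-!
The argument has four parts.

*Gauß–Legendre quadratures.* A function on the unit square is called `PolyApprox₂` if polynomials
approximate it uniformly with an error that decays exponentially in the degree. By Taylor expansion this
holds for `ln u` and `ln (tan(πu/(4T))/u)`, where `u` is of degree one in each variable and stays away
from the singularities of these functions; with sums and products, this covers all integrands of the
schemes, `PolyApprox₂.regF` being the main case. As Gauß weights are positive, the quadrature error is
bounded by the approximation error (`PolyApprox₂.expConv₂`, `legConv_scheme`).

*Logarithmic quadratures.* In each of them the factor of the logarithm is a polynomial of degree at most
`p k + p ℓ` in each variable, also after the transformation of the two triangles of the square that is built into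
the rule for `ln|s - t|` (`logExact_scheme`).

*Consistency of the schemes.* Off the singularities, `ln[tan tan]` is the sum of the regular part `regF`
and the singular part `singF`. The transformation of the two triangles to the square
(`SqIntegrable.sqInt_duffy`), under which `ln(αx + βy)` becomes `ln y` plus a smooth function, turns the
integral of each part into the integrals in the schemes (`exactSum_scheme`).

*Global matrices.* The local entries sum up to the global ones (`globalEntry_eq_sum`): the sine
coefficients of a piecewise polynomial are integrated by parts on each element, and the cosine series
that arises is the kernel. This series does not converge absolutely, but its Abel sums have a closed
form that is bounded by the limit (`oddCosSum_bound`), so it can be integrated termwise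
(`hasSum_sumKern`, `hasSum_sin_mul_cos`). The boundary terms between neighbouring elements
cancel for a continuous function; the kernel vanishes at `T`, and the terms at `0` are the explicit ones
in the local entries (`sum_boundary`).
-/

open ModHilbert Set MeasureTheory Polynomial Filter Topology

namespace ModHilbert

/-! ### Gauß–Legendre rules -/

/-- The square of the nodal polynomial of the other nodes has degree `2K - 2`, so it is integrated
exactly, and only the node `ν` contributes to the quadrature. -/
theorem LegendreRule.weight_pos {K : ℕ} (R : LegendreRule K) (ν : Fin K) : 0 < R.weight ν := by
  classical
  set g : ℝ[X] := ∏ j ∈ Finset.univ.erase ν, (X - C (R.node j)) ^ 2 with hg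
  have hcard : (Finset.univ.erase ν).card = K - 1 := by simp
  have hK : 0 < K := Fin.pos ν
  have hg0 : g ≠ 0 := Finset.prod_ne_zero_iff.2 fun j _ => pow_ne_zero _ (X_sub_C_ne_zero _)
  have hdeg : g.natDegree + 1 ≤ 2 * K := by
    have : g.natDegree ≤ ∑ j ∈ Finset.univ.erase ν, 2 :=
      (natDegree_prod_le _ _).trans (Finset.sum_le_sum fun j _ => by simp)
    rw [Finset.sum_const, hcard, smul_eq_mul] at this
    omega
  have hnn : ∀ x, 0 ≤ g.eval x := fun x => by
    rw [hg, eval_prod]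
    exact Finset.prod_nonneg fun j _ => by simp; positivity
  have hpos : 0 < ∫ x in (0 : ℝ)..1, g.eval x * 1 := by
    simp only [mul_one]
    rw [intervalIntegral.integral_pos_iff_support_of_nonneg_ae
      (Eventually.of_forall hnn) (g.continuous.intervalIntegrable _ _)]
    refine ⟨one_pos, ?_⟩
    have hfin : (g.rootSet ℝ).Finite := g.rootSet_finite ℝ
    have hsub : Ioc (0 : ℝ) 1 \ g.rootSet ℝ ⊆ (Function.support fun x => g.eval x) ∩ Ioc 0 1 := by
      rintro x ⟨hx, hx'⟩
      refine ⟨fun h => hx' ?_, hx⟩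
      rw [mem_rootSet]
      exact ⟨hg0, by simpa using h⟩
    refine lt_of_lt_of_le ?_ (measure_mono hsub)
    rw [measure_sdiff_null (hfin.measure_zero _)]
    simp
  rw [R.exact g hdeg, Finset.sum_eq_single ν] at hpos
  · exact pos_of_mul_pos_left hpos (hnn _)
  · intro j _ hj
    rw [hg, eval_prod, Finset.prod_eq_zero (Finset.mem_erase.2 ⟨hj, Finset.mem_univ j⟩), mul_zero]
    simp
  · simp

theorem LegendreRule.sum_weight {K : ℕ} (R : LegendreRule K) (hK : 1 ≤ K) :
    ∑ ν, R.weight ν = 1 := by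
  have := R.exact 1 (by simp; omega)
  simpa using this.symm

/-! ### Functions of two variables that are polynomials in each of them -/

/-- `H` is continuous, a polynomial of degree at most `m` in the first variable, and a polynomial of
degree at most `n` in the second one. -/
structure SepPoly (m n : ℕ) (H : ℝ → ℝ → ℝ) : Prop where
  cont : Continuous (Function.uncurry H)
  fst : ∀ y, ∃ p : ℝ[X], p.natDegree ≤ m ∧ ∀ x, H x y = p.eval x
  snd : ∀ x, ∃ p : ℝ[X], p.natDegree ≤ n ∧ ∀ y, H x y = p.eval y

namespace SepPoly

variable {m n m' n' : ℕ} {H H' : ℝ → ℝ → ℝ}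

theorem mono (h : SepPoly m n H) (hm : m ≤ m') (hn : n ≤ n') : SepPoly m' n' H where
  cont := h.cont
  fst y := let ⟨p, hp, e⟩ := h.fst y; ⟨p, hp.trans hm, e⟩
  snd x := let ⟨p, hp, e⟩ := h.snd x; ⟨p, hp.trans hn, e⟩

theorem bilinear (a b c d : ℝ) (h : ∀ x y, H x y = a + b * x + c * y + d * (x * y)) :
    SepPoly 1 1 H where
  cont := by
    have : H = fun x y => a + b * x + c * y + d * (x * y) := by ext; apply h
    subst this; simp only [Function.uncurry_def]; fun_prop
  fst y := ⟨C (a + c * y) + C (b + d * y) * X, by compute_degree, fun x => by simp [h]; ring⟩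
  snd x := ⟨C (a + b * x) + C (c + d * x) * X, by compute_degree, fun y => by simp [h]; ring⟩

theorem linear_snd (a b : ℝ) (h : ∀ x y, H x y = a + b * y) : SepPoly 0 1 H where
  cont := by
    have : H = fun x y => a + b * y := by ext; apply h
    subst this; simp only [Function.uncurry_def]; fun_prop
  fst y := ⟨C (a + b * y), natDegree_C _ |>.le, fun x => by simp [h]⟩
  snd x := ⟨C a + C b * X, by compute_degree, fun y => by simp [h]⟩

theorem linear_fst (a b : ℝ) (h : ∀ x y, H x y = a + b * x) : SepPoly 1 0 H where
  cont := by
    have : H = fun x y => a + b * x := by ext; apply h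
    subst this; simp only [Function.uncurry_def]; fun_prop
  fst y := ⟨C a + C b * X, by compute_degree, fun x => by simp [h]⟩
  snd x := ⟨C (a + b * x), natDegree_C _ |>.le, fun x => by simp [h]⟩

theorem mul (h : SepPoly m n H) (h' : SepPoly m' n' H') :
    SepPoly (m + m') (n + n') fun x y => H x y * H' x y where
  cont := h.cont.mul h'.cont
  fst y := by
    obtain ⟨p, hp, e⟩ := h.fst y
    obtain ⟨q, hq, e'⟩ := h'.fst y
    exact ⟨p * q, natDegree_mul_le.trans (add_le_add hp hq), fun x => by simp [e, e']⟩
  snd x := by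
    obtain ⟨p, hp, e⟩ := h.snd x
    obtain ⟨q, hq, e'⟩ := h'.snd x
    exact ⟨p * q, natDegree_mul_le.trans (add_le_add hp hq), fun x => by simp [e, e']⟩

theorem add (h : SepPoly m n H) (h' : SepPoly m n H') :
    SepPoly m n fun x y => H x y + H' x y where
  cont := h.cont.add h'.cont
  fst y := by
    obtain ⟨p, hp, e⟩ := h.fst y
    obtain ⟨q, hq, e'⟩ := h'.fst y
    exact ⟨p + q, natDegree_add_le_of_degree_le hp hq, fun x => by simp [e, e']⟩
  snd x := by
    obtain ⟨p, hp, e⟩ := h.snd x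
    obtain ⟨q, hq, e'⟩ := h'.snd x
    exact ⟨p + q, natDegree_add_le_of_degree_le hp hq, fun x => by simp [e, e']⟩

theorem eval_comp (q : ℝ[X]) {d : ℕ} (hd : q.natDegree ≤ d) (h : SepPoly m n H) :
    SepPoly (d * m) (d * n) fun x y => q.eval (H x y) where
  cont := q.continuous.comp h.cont
  fst y := by
    obtain ⟨p, hp, e⟩ := h.fst y
    exact ⟨q.comp p, natDegree_comp_le.trans (Nat.mul_le_mul hd hp), fun x => by simp [e]⟩
  snd x := by
    obtain ⟨p, hp, e⟩ := h.snd x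
    exact ⟨q.comp p, natDegree_comp_le.trans (Nat.mul_le_mul hd hp), fun x => by simp [e]⟩

end SepPoly

/-! ### Exponential approximation by polynomials -/

/-- On `[a,b]`, the best approximation errors of `f` by polynomials of degree at most `n` decay
exponentially in `n`. -/
def PolyApprox (f : ℝ → ℝ) (a b : ℝ) : Prop :=
  ∃ C ρ : ℝ, 0 < ρ ∧ ρ < 1 ∧ ∀ n : ℕ, ∃ p : ℝ[X], p.natDegree ≤ n ∧
    ∀ x ∈ Icc a b, |f x - p.eval x| ≤ C * ρ ^ n

/-- On the unit square, the best approximation errors of `G` by polynomials of degree at most `n` in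
each of the variables decay exponentially in `n`. -/
def PolyApprox₂ (G : ℝ → ℝ → ℝ) : Prop :=
  ∃ C ρ : ℝ, 0 < ρ ∧ ρ < 1 ∧ ∀ n : ℕ, ∃ H, SepPoly n n H ∧
    ∀ x ∈ Icc (0 : ℝ) 1, ∀ y ∈ Icc (0 : ℝ) 1, |G x y - H x y| ≤ C * ρ ^ n

/-- A holomorphic function is approximated by its Taylor polynomials on smaller discs; on the real
axis, the real parts of these are polynomials. -/
theorem PolyApprox.of_differentiableOn {F : ℂ → ℂ} {c R r : ℝ} (hr : 0 ≤ r) (hrR : r < R)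
    (hF : DifferentiableOn ℂ F (Metric.ball (c : ℂ) R)) :
    PolyApprox (fun x => (F x).re) (c - r) (c + r) := by
  obtain ⟨r₁, h1, h1R⟩ := exists_between hrR
  obtain ⟨R₁, h2, h2R⟩ := exists_between h1R
  lift r₁ to NNReal using by linarith
  lift R₁ to NNReal using by linarith [r₁.2]
  have hps := (hF.mono (Metric.closedBall_subset_ball h2R)).hasFPowerSeriesOnBall
    (by exact_mod_cast (lt_of_le_of_lt r₁.2 h2))
  obtain ⟨a, ha, D, hD, hb⟩ := hps.uniform_geometric_approx (r' := r₁) (by exact_mod_cast h2)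
  set P := cauchyPowerSeries F c R₁
  refine ⟨D, a, ha.1, ha.2, fun n =>
    ⟨∑ k ∈ Finset.range n, Polynomial.C (P.coeff k).re * (X - Polynomial.C c) ^ k, ?_, fun x hx => ?_⟩⟩
  · refine natDegree_sum_le_of_forall_le _ _ fun k hk => ?_
    refine (natDegree_C_mul_le _ _).trans ?_
    rw [natDegree_pow, natDegree_X_sub_C]
    simpa using (Finset.mem_range.1 hk).le
  · have hy : ((x - c : ℝ) : ℂ) ∈ Metric.ball (0 : ℂ) r₁ := by
      rw [mem_ball_zero_iff, Complex.norm_real, Real.norm_eq_abs]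
      refine lt_of_le_of_lt (abs_le.2 ⟨?_, ?_⟩) h1 <;> linarith [hx.1, hx.2]
    have := hb _ hy n
    have e1 : (c : ℂ) + ((x - c : ℝ) : ℂ) = x := by push_cast; ring
    rw [e1] at this
    refine le_trans ?_ ((Complex.abs_re_le_norm _).trans this)
    apply le_of_eq
    congr 1
    rw [Complex.sub_re, FormalMultilinearSeries.partialSum, Complex.re_sum, eval_finsetSum]
    congr 1
    refine Finset.sum_congr rfl fun k _ => ?_
    rw [FormalMultilinearSeries.apply_eq_pow_smul_coeff, smul_eq_mul, ← Complex.ofReal_pow,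
      Complex.re_ofReal_mul]
    simp; ring

theorem PolyApprox.congr {f g : ℝ → ℝ} {a b : ℝ} (h : PolyApprox f a b)
    (e : ∀ x ∈ Icc a b, g x = f x) : PolyApprox g a b := by
  obtain ⟨C, ρ, h0, h1, h⟩ := h
  refine ⟨C, ρ, h0, h1, fun n => ?_⟩
  obtain ⟨p, hp, hh⟩ := h n
  exact ⟨p, hp, fun x hx => by rw [e x hx]; exact hh x hx⟩

theorem PolyApprox.mono {f : ℝ → ℝ} {a b a' b' : ℝ} (h : PolyApprox f a b)
    (ha : a ≤ a') (hb : b' ≤ b) : PolyApprox f a' b' := by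
  obtain ⟨C, ρ, h0, h1, h⟩ := h
  refine ⟨C, ρ, h0, h1, fun n => ?_⟩
  obtain ⟨p, hp, hh⟩ := h n
  exact ⟨p, hp, fun x hx => hh x ⟨ha.trans hx.1, hx.2.trans hb⟩⟩

/-- The Taylor series of the logarithm at `R` converges on `(0,2R)`. -/
theorem PolyApprox.log {δ R : ℝ} (hδ : 0 < δ) : PolyApprox Real.log δ R := by
  rcases lt_or_ge R δ with h | h
  · exact ⟨0, 1 / 2, by norm_num, by norm_num, fun n => ⟨0, by simp, fun x hx =>
      absurd (hx.1.trans hx.2) (not_le.2 h)⟩⟩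
  have := PolyApprox.of_differentiableOn (F := Complex.log) (c := R) (R := R) (r := R - δ)
    (by linarith) (by linarith) (by
      intro z hz
      refine (differentiableAt_id.clog ?_).differentiableWithinAt
      left
      have := (Complex.abs_re_le_norm (z - R)).trans_lt (mem_ball_iff_norm.1 hz)
      rw [Complex.sub_re, Complex.ofReal_re] at this
      simp only [id]
      linarith [(abs_lt.1 this).1])
  refine (this.mono (a' := δ) (b' := R) (by linarith) (by linarith)).congr fun x _ => ?_
  rw [Complex.log_ofReal_re]

/-- The real part of `sin z / z` has the sign of `(x sin x) cosh y + cos x (y sinh y)`. -/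
theorem re_sinc_pos {z : ℂ} (hz : |z.re| < Real.pi / 2) : 0 < (dslope Complex.sin 0 z).re := by
  rcases eq_or_ne z 0 with rfl | h0
  · simp [dslope_same]
  rw [dslope_of_ne _ h0, slope_def_field, Complex.sin_zero, sub_zero, sub_zero, Complex.div_re,
    ← add_div]
  refine div_pos ?_ (Complex.normSq_pos.2 h0)
  obtain ⟨x, y⟩ := z
  have hs : Complex.sin ⟨x, y⟩ = ⟨Real.sin x * Real.cosh y, Real.cos x * Real.sinh y⟩ := by
    rw [Complex.sin_eq]
    apply Complex.ext <;> simp [Complex.sin_ofReal_re, Complex.cos_ofReal_re,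
      Complex.sinh_ofReal_re, Complex.cosh_ofReal_re]
  rw [hs]
  simp only at hz ⊢
  have hc : 0 < Real.cos x := Real.cos_pos_of_mem_Ioo (by
    rw [abs_lt] at hz; exact ⟨hz.1, hz.2⟩)
  have hy : 0 ≤ Real.sinh y * y := by
    rcases le_total 0 y with h | h
    · exact mul_nonneg (Real.sinh_nonneg_iff.2 h) h
    · exact mul_nonneg_of_nonpos_of_nonpos (Real.sinh_nonpos_iff.2 h) h
  have hx : x ≠ 0 → 0 < Real.sin x * x := by
    intro hx
    rw [abs_lt] at hz
    rcases lt_or_gt_of_ne hx with h | h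
    · exact mul_pos_of_neg_of_neg (Real.sin_neg_of_neg_of_neg_pi_lt h (by linarith [Real.pi_pos])) h
    · exact mul_pos (Real.sin_pos_of_pos_of_lt_pi h (by linarith [Real.pi_pos])) h
  have e : Real.sin x * Real.cosh y * x + Real.cos x * Real.sinh y * y
      = Real.sin x * x * Real.cosh y + Real.cos x * (Real.sinh y * y) := by ring
  rw [e]
  by_cases hx0 : x = 0
  · subst hx0
    have hy0 : y ≠ 0 := by rintro rfl; exact h0 rfl
    have : 0 < Real.sinh y * y := lt_of_le_of_ne hy (by
      symm; exact mul_ne_zero (by simpa [Real.sinh_eq_zero] using hy0) hy0)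
    simpa using this
  · have := mul_pos (hx hx0) (Real.cosh_pos y)
    have := mul_nonneg hc.le hy
    linarith

theorem re_cos_pos {z : ℂ} (hz : |z.re| < Real.pi / 2) : 0 < (Complex.cos z).re := by
  obtain ⟨x, y⟩ := z
  have hs : (Complex.cos ⟨x, y⟩).re = Real.cos x * Real.cosh y := by
    rw [Complex.cos_eq]; simp [Complex.sin_ofReal_re, Complex.cos_ofReal_re, Complex.sinh_ofReal_re,
      Complex.cosh_ofReal_re]
  rw [hs]
  exact mul_pos (Real.cos_pos_of_mem_Ioo (by rw [abs_lt] at hz; exact ⟨hz.1, hz.2⟩))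
    (Real.cosh_pos y)

theorem tanQuot_pos {T x : ℝ} (hT : 0 < T) (hx : |x| < 2 * T) : 0 < tanQuot T x := by
  have hpi := Real.pi_pos
  unfold tanQuot
  split_ifs with h
  · positivity
  · rw [abs_lt] at hx
    have h1 : Real.pi * x / (4 * T) < Real.pi / 2 := by
      rw [div_lt_div_iff₀ (by positivity) (by positivity)]; nlinarith
    have h2 : -(Real.pi / 2) < Real.pi * x / (4 * T) := by
      rw [← neg_div, div_lt_div_iff₀ (by positivity) (by positivity)]; nlinarith
    rcases lt_or_gt_of_ne h with h | h
    · exact div_pos_of_neg_of_neg (Real.tan_neg_of_neg_of_pi_div_two_lt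
        (div_neg_of_neg_of_pos (by nlinarith) (by positivity)) h2) h
    · exact div_pos (Real.tan_pos_of_pos_of_lt_pi_div_two (by positivity) h1) h

/-- On the disc `|z| < 2T`, the functions `sin(πz/(4T))/z` and `cos(πz/(4T))` have positive real parts,
so that the logarithm of `tan(πz/(4T))/z` is holomorphic there. -/
theorem PolyApprox.log_tanQuot {T r : ℝ} (hT : 0 < T) (hr0 : 0 ≤ r) (hr : r < 2 * T) :
    PolyApprox (fun u => Real.log (tanQuot T u)) (-r) r := by
  have hpi := Real.pi_pos
  have hκ : 0 < Real.pi / (4 * T) := by positivity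
  set κ := Real.pi / (4 * T) with hκd
  have hre : ∀ x : ℝ, |x| < 2 * T → |κ * x| < Real.pi / 2 := fun x hx => by
    rw [abs_mul, abs_of_pos hκ, hκd, div_mul_eq_mul_div, div_lt_div_iff₀ (by positivity) (by positivity)]
    nlinarith
  have hsin : Differentiable ℂ (dslope Complex.sin 0) := by
    rw [← differentiableOn_univ, Complex.differentiableOn_dslope univ_mem]
    exact Complex.differentiable_sin.differentiableOn
  have := PolyApprox.of_differentiableOn
    (F := fun z => Complex.log κ + Complex.log (dslope Complex.sin 0 (κ * z)) -
      Complex.log (Complex.cos (κ * z))) (c := 0) hr0 hr (by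
      intro z hz
      rw [Complex.ofReal_zero, mem_ball_zero_iff] at hz
      have h := hre z.re ((Complex.abs_re_le_norm z).trans_lt hz)
      have h' : |((κ : ℂ) * z).re| < Real.pi / 2 := by simpa using h
      have hlin : DifferentiableAt ℂ (fun z : ℂ => (κ : ℂ) * z) z := by fun_prop
      refine DifferentiableAt.differentiableWithinAt ?_
      refine ((differentiableAt_const _).add (((hsin _).comp z hlin).clog ?_)).sub
        (hlin.ccos.clog ?_)
      · left; exact re_sinc_pos h'
      · left; exact re_cos_pos h')
  rw [zero_sub, zero_add] at this
  refine this.congr fun x hx => ?_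
  have hxT : |x| < 2 * T := (abs_le.2 hx).trans_lt hr
  have hx' := hre x hxT
  have hcos : 0 < Real.cos (κ * x) :=
    Real.cos_pos_of_mem_Ioo (by rw [abs_lt] at hx'; exact ⟨hx'.1, hx'.2⟩)
  have hs := re_sinc_pos (z := (κ * x : ℝ)) (by simpa using hx')
  obtain ⟨σ, hσ⟩ : ∃ σ : ℝ, dslope Complex.sin 0 ((κ * x : ℝ) : ℂ) = σ ∧
      tanQuot T x = κ * σ / Real.cos (κ * x) := by
    rcases eq_or_ne x 0 with rfl | h0
    · refine ⟨1, by simp [dslope_same], by simp [tanQuot, hκd]⟩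
    · refine ⟨Real.sin (κ * x) / (κ * x), ?_, ?_⟩
      · have : ((κ * x : ℝ) : ℂ) ≠ 0 := by exact_mod_cast (mul_ne_zero hκ.ne' h0)
        rw [dslope_of_ne _ this, slope_def_field]
        push_cast; simp
      · rw [tanQuot, if_neg h0, Real.tan_eq_sin_div_cos]
        have : Real.pi * x / (4 * T) = κ * x := by rw [hκd]; ring
        rw [this]
        field_simp
  rw [hσ.1, Complex.ofReal_re] at hs
  have e1 : (κ : ℂ) * x = ((κ * x : ℝ) : ℂ) := by push_cast; rfl
  simp only [Complex.sub_re, Complex.add_re]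
  rw [e1, hσ.1, ← Complex.ofReal_cos, Complex.log_ofReal_re, Complex.log_ofReal_re,
    Complex.log_ofReal_re, hσ.2, Real.log_div (by positivity) (by positivity),
    Real.log_mul (by positivity) (by positivity)]

namespace PolyApprox₂

variable {G G' : ℝ → ℝ → ℝ}

theorem nonneg_const {C ρ : ℝ} (hρ : 0 < ρ) {f : ℝ → ℝ → ℝ} {n : ℕ}
    (h : ∀ x ∈ Icc (0 : ℝ) 1, ∀ y ∈ Icc (0 : ℝ) 1, |f x y| ≤ C * ρ ^ n) : 0 ≤ C := by
  have := (abs_nonneg _).trans (h 0 (by simp) 0 (by simp))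
  exact nonneg_of_mul_nonneg_left this (by positivity)

theorem congr (h : PolyApprox₂ G)
    (e : ∀ x ∈ Icc (0 : ℝ) 1, ∀ y ∈ Icc (0 : ℝ) 1, G' x y = G x y) : PolyApprox₂ G' := by
  obtain ⟨C, ρ, h0, h1, h⟩ := h
  refine ⟨C, ρ, h0, h1, fun n => ?_⟩
  obtain ⟨p, hp, hh⟩ := h n
  exact ⟨p, hp, fun x hx y hy => by rw [e x hx y hy]; exact hh x hx y hy⟩

theorem continuousOn (h : PolyApprox₂ G) :
    ContinuousOn (Function.uncurry G) (Icc (0 : ℝ) 1 ×ˢ Icc (0 : ℝ) 1) := by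
  obtain ⟨C, ρ, h0, h1, h⟩ := h
  choose H hH hb using h
  have : TendstoUniformlyOn (fun n => Function.uncurry (H n)) (Function.uncurry G) atTop
      (Icc (0 : ℝ) 1 ×ˢ Icc (0 : ℝ) 1) := by
    rw [Metric.tendstoUniformlyOn_iff]
    intro ε hε
    have ht : Tendsto (fun n : ℕ => C * ρ ^ n) atTop (𝓝 0) := by
      simpa using (tendsto_pow_atTop_nhds_zero_of_lt_one h0.le h1).const_mul C
    filter_upwards [ht.eventually_lt_const hε] with n hn z hz
    rw [Real.dist_eq]
    exact (hb n _ hz.1 _ hz.2).trans_lt hn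
  exact this.continuousOn (Frequently.of_forall fun n => (hH n).cont.continuousOn)

theorem bounded (h : PolyApprox₂ G) :
    ∃ B, ∀ x ∈ Icc (0 : ℝ) 1, ∀ y ∈ Icc (0 : ℝ) 1, |G x y| ≤ B := by
  obtain ⟨B, hB⟩ := (isCompact_Icc.prod isCompact_Icc).exists_bound_of_continuousOn h.continuousOn
  exact ⟨B, fun x hx y hy => hB (x, y) ⟨hx, hy⟩⟩

theorem of_sepPoly {m n : ℕ} (h : SepPoly m n G) : PolyApprox₂ G := by
  obtain ⟨B, hB⟩ := (isCompact_Icc.prod isCompact_Icc).exists_bound_of_continuousOn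
    (s := Icc (0 : ℝ) 1 ×ˢ Icc (0 : ℝ) 1) h.cont.continuousOn
  have hB' : ∀ x ∈ Icc (0 : ℝ) 1, ∀ y ∈ Icc (0 : ℝ) 1, |G x y| ≤ B :=
    fun x hx y hy => hB (x, y) ⟨hx, hy⟩
  have hB0 : 0 ≤ B := (abs_nonneg _).trans (hB' 0 (by simp) 0 (by simp))
  refine ⟨B * 2 ^ (max m n), 1 / 2, by norm_num, by norm_num, fun k => ?_⟩
  by_cases hk : max m n ≤ k
  · exact ⟨G, h.mono ((le_max_left _ _).trans hk) ((le_max_right _ _).trans hk),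
      fun x _ y _ => by rw [sub_self, abs_zero]; positivity⟩
  · refine ⟨fun _ _ => 0, ⟨by simp only [Function.uncurry_def]; fun_prop, fun _ => ⟨0, by simp⟩, fun _ => ⟨0, by simp⟩⟩,
      fun x hx y hy => ?_⟩
    rw [sub_zero]
    refine (hB' x hx y hy).trans ?_
    rw [mul_assoc]
    refine le_mul_of_one_le_right hB0 ?_
    rw [one_div, inv_pow, ← div_eq_mul_inv, one_le_div (by positivity)]
    exact pow_le_pow_right₀ (by norm_num) (not_le.1 hk).le

theorem mul (h : PolyApprox₂ G) (h' : PolyApprox₂ G') :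
    PolyApprox₂ fun x y => G x y * G' x y := by
  obtain ⟨B, hB⟩ := h.bounded
  obtain ⟨B', hB'⟩ := h'.bounded
  obtain ⟨C, ρ, h0, h1, h⟩ := h
  obtain ⟨C', ρ', h0', h1', h'⟩ := h'
  have hC : 0 ≤ C := by obtain ⟨H, -, hH⟩ := h 0; exact nonneg_const h0 hH
  have hC' : 0 ≤ C' := by obtain ⟨H, -, hH⟩ := h' 0; exact nonneg_const h0' hH
  have hB0 : 0 ≤ B := (abs_nonneg _).trans (hB 0 (by simp) 0 (by simp))
  have hB0' : 0 ≤ B' := (abs_nonneg _).trans (hB' 0 (by simp) 0 (by simp))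
  set σ := max ρ ρ' with hσ
  have hσ0 : 0 < σ := h0.trans_le (le_max_left _ _)
  have hσ1 : σ < 1 := max_lt h1 h1'
  have hs0 : 0 < Real.sqrt σ := Real.sqrt_pos.2 hσ0
  have hs1 : Real.sqrt σ < 1 := by rw [Real.sqrt_lt' one_pos]; simpa using hσ1
  refine ⟨((B + C) * C' + B' * C) / σ, Real.sqrt σ, hs0, hs1, fun n => ?_⟩
  -- each factor gets half of the degree, at the cost of the square root of the rate
  obtain ⟨H, hH, hb⟩ := h (n / 2)
  obtain ⟨H', hH', hb'⟩ := h' (n / 2)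
  refine ⟨fun x y => H x y * H' x y, (hH.mul hH').mono (by omega) (by omega), fun x hx y hy => ?_⟩
  have b1 : |H x y| ≤ B + C := by
    have e : H x y = G x y - (G x y - H x y) := by ring
    rw [e]
    refine (abs_sub _ _).trans (add_le_add (hB x hx y hy) ((hb x hx y hy).trans ?_))
    exact mul_le_of_le_one_right hC (pow_le_one₀ h0.le h1.le)
  have e : G x y * G' x y - H x y * H' x y
      = H x y * (G' x y - H' x y) + G' x y * (G x y - H x y) := by ring
  have l1 : |G x y - H x y| ≤ C * σ ^ (n / 2) := (hb x hx y hy).trans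
    (mul_le_mul_of_nonneg_left (pow_le_pow_left₀ h0.le (le_max_left _ _) _) hC)
  have l2 : |G' x y - H' x y| ≤ C' * σ ^ (n / 2) := (hb' x hx y hy).trans
    (mul_le_mul_of_nonneg_left (pow_le_pow_left₀ h0'.le (le_max_right _ _) _) hC')
  have l3 : |G x y * G' x y - H x y * H' x y| ≤ ((B + C) * C' + B' * C) * σ ^ (n / 2) := by
    rw [e]
    refine (abs_add_le _ _).trans ?_
    rw [abs_mul, abs_mul]
    calc _ ≤ (B + C) * (C' * σ ^ (n / 2)) + B' * (C * σ ^ (n / 2)) := by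
          gcongr; exact hB' x hx y hy
      _ = _ := by ring
  refine l3.trans ?_
  rw [div_mul_eq_mul_div, mul_div_assoc]
  refine mul_le_mul_of_nonneg_left ?_ (by positivity)
  rw [le_div_iff₀ hσ0, ← pow_succ]
  -- `n / 2` is rounded down: only `n ≤ 2 (n / 2 + 1)`, which the factor `1 / σ` makes up for
  conv_lhs => rw [← Real.sq_sqrt hσ0.le]
  rw [← pow_mul]
  exact pow_le_pow_of_le_one hs0.le hs1.le (by omega)

theorem add (h : PolyApprox₂ G) (h' : PolyApprox₂ G') :
    PolyApprox₂ fun x y => G x y + G' x y := by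
  obtain ⟨C, ρ, h0, h1, h⟩ := h
  obtain ⟨C', ρ', h0', h1', h'⟩ := h'
  have hC : 0 ≤ C := by obtain ⟨H, -, hH⟩ := h 0; exact nonneg_const h0 hH
  have hC' : 0 ≤ C' := by obtain ⟨H, -, hH⟩ := h' 0; exact nonneg_const h0' hH
  refine ⟨C + C', max ρ ρ', h0.trans_le (le_max_left _ _), max_lt h1 h1', fun n => ?_⟩
  obtain ⟨H, hH, hb⟩ := h n
  obtain ⟨H', hH', hb'⟩ := h' n
  refine ⟨_, hH.add hH', fun x hx y hy => ?_⟩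
  have e : G x y + G' x y - (H x y + H' x y) = (G x y - H x y) + (G' x y - H' x y) := by ring
  rw [e, add_mul]
  refine (abs_add_le _ _).trans (add_le_add ((hb x hx y hy).trans ?_) ((hb' x hx y hy).trans ?_))
  · exact mul_le_mul_of_nonneg_left (pow_le_pow_left₀ h0.le (le_max_left _ _) _) hC
  · exact mul_le_mul_of_nonneg_left (pow_le_pow_left₀ h0'.le (le_max_right _ _) _) hC'

theorem neg (h : PolyApprox₂ G) : PolyApprox₂ fun x y => -G x y :=
  ((of_sepPoly (SepPoly.bilinear (H := fun _ _ => -1) (-1) 0 0 0 (by simp))).mul h).congr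
    (by simp)

/-- An inner function of degree one in each variable keeps the degrees of the approximations. -/
theorem comp {f : ℝ → ℝ} {a b : ℝ} (hf : PolyApprox f a b) {u : ℝ → ℝ → ℝ}
    (hu : SepPoly 1 1 u) (hab : ∀ x ∈ Icc (0 : ℝ) 1, ∀ y ∈ Icc (0 : ℝ) 1, u x y ∈ Icc a b) :
    PolyApprox₂ fun x y => f (u x y) := by
  obtain ⟨C, ρ, h0, h1, h⟩ := hf
  refine ⟨C, ρ, h0, h1, fun n => ?_⟩
  obtain ⟨p, hp, hh⟩ := h n
  exact ⟨_, (hu.eval_comp p hp).mono (by omega) (by omega),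
    fun x hx y hy => hh _ (hab x hx y hy)⟩

end PolyApprox₂

/-! ### Convergence of the Gauß–Legendre quadratures -/

theorem quadTensor_sepPoly (LR : ∀ K, LegendreRule K) {K₁ K₂ m n : ℕ} {H : ℝ → ℝ → ℝ}
    (hH : SepPoly m n H) (hm : m + 1 ≤ 2 * K₁) (hn : n + 1 ≤ 2 * K₂) :
    quadTensor LR K₁ K₂ H = ∫ y in (0 : ℝ)..1, ∫ x in (0 : ℝ)..1, H x y := by
  have h1 : ∀ y, ∫ x in (0 : ℝ)..1, H x y = ∑ ν, (LR K₁).weight ν * H ((LR K₁).node ν) y := by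
    intro y
    obtain ⟨p, hp, e⟩ := hH.fst y
    have := (LR K₁).exact p (by omega)
    simpa [e] using this
  have h2 : ∀ x, ∫ y in (0 : ℝ)..1, H x y = ∑ ν, (LR K₂).weight ν * H x ((LR K₂).node ν) := by
    intro x
    obtain ⟨p, hp, e⟩ := hH.snd x
    have := (LR K₂).exact p (by omega)
    simpa [e] using this
  simp_rw [h1]
  rw [intervalIntegral.integral_finsetSum]
  · simp_rw [intervalIntegral.integral_const_mul, h2, quadTensor, Finset.mul_sum, mul_assoc]
  · intro ν _
    refine (Continuous.intervalIntegrable ?_ _ _)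
    exact continuous_const.mul (hH.cont.comp (by fun_prop : Continuous fun y => ((LR K₁).node ν, y)))

/-- The measure of the unit square is written as a product of measures on the unit interval. -/
theorem integrable_square {G : ℝ → ℝ → ℝ}
    (hG : ContinuousOn (Function.uncurry G) (Icc (0 : ℝ) 1 ×ˢ Icc (0 : ℝ) 1)) :
    Integrable (Function.uncurry G)
      ((volume.restrict (Ioc (0 : ℝ) 1)).prod (volume.restrict (Ioc (0 : ℝ) 1))) := by
  rw [Measure.prod_restrict]
  exact (hG.integrableOn_compact (isCompact_Icc.prod isCompact_Icc)).mono_set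
    (prod_mono Ioc_subset_Icc_self Ioc_subset_Icc_self)

/-- The rules are exact for the approximating polynomial of degree `min K₁ K₂`, and, as the weights are
positive with sum one, the approximation error enters with the factor one in the quadrature as well as
in the integral. -/
theorem PolyApprox₂.expConv₂ {G : ℝ → ℝ → ℝ} (hG : PolyApprox₂ G) (LR : ∀ K, LegendreRule K) :
    ExpConv₂ fun K₁ K₂ =>
      quadTensor LR K₁ K₂ G - ∫ y in (0 : ℝ)..1, ∫ x in (0 : ℝ)..1, G x y := by
  have hcont := hG.continuousOn
  obtain ⟨C, ρ, h0, h1, h⟩ := hG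
  have hC : 0 ≤ C := by obtain ⟨H, -, hH⟩ := h 0; exact nonneg_const h0 hH
  refine ⟨2 * C, ρ, h0, h1, fun K₁ K₂ hK₁ hK₂ => ?_⟩
  set n := min K₁ K₂ with hn
  obtain ⟨H, hH, hb⟩ := h n
  have hex := quadTensor_sepPoly LR hH (K₁ := K₁) (K₂ := K₂) (by omega) (by omega)
  have e1 : |quadTensor LR K₁ K₂ G - quadTensor LR K₁ K₂ H| ≤ C * ρ ^ n := by
    unfold quadTensor
    simp_rw [← Finset.sum_sub_distrib, ← mul_sub]
    refine (Finset.abs_sum_le_sum_abs _ _).trans ?_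
    have : ∑ ν₁, ∑ ν₂, (LR K₁).weight ν₁ * (LR K₂).weight ν₂ * (C * ρ ^ n) = C * ρ ^ n := by
      simp_rw [← Finset.sum_mul, ← Finset.mul_sum]
      rw [LegendreRule.sum_weight _ hK₂]
      simp_rw [mul_one]
      rw [LegendreRule.sum_weight _ hK₁, one_mul]
    rw [← this]
    refine Finset.sum_le_sum fun ν₁ _ => (Finset.abs_sum_le_sum_abs _ _).trans
      (Finset.sum_le_sum fun ν₂ _ => ?_)
    have w1 := (LR K₁).weight_pos ν₁
    have w2 := (LR K₂).weight_pos ν₂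
    rw [abs_mul, abs_of_pos (mul_pos w1 w2)]
    exact mul_le_mul_of_nonneg_left (hb _ ((LR K₁).node_mem _) _ ((LR K₂).node_mem _))
      (mul_pos w1 w2).le
  have hGx : ∀ y ∈ Icc (0 : ℝ) 1, ContinuousOn (fun x => G x y) (Icc 0 1) := fun y hy =>
    hcont.comp (f := fun x => (x, y)) (by fun_prop) fun x hx => ⟨hx, hy⟩
  have hGi : IntervalIntegrable (fun y => ∫ x in (0 : ℝ)..1, G x y) volume 0 1 := by
    rw [intervalIntegrable_iff_integrableOn_Ioc_of_le zero_le_one]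
    simp_rw [intervalIntegral.integral_of_le zero_le_one]
    exact (integrable_square hcont).integral_prod_right
  have hHi : IntervalIntegrable (fun y => ∫ x in (0 : ℝ)..1, H x y) volume 0 1 := by
    rw [intervalIntegrable_iff_integrableOn_Ioc_of_le zero_le_one]
    simp_rw [intervalIntegral.integral_of_le zero_le_one]
    exact (integrable_square hH.cont.continuousOn).integral_prod_right
  have e2 : |(∫ y in (0 : ℝ)..1, ∫ x in (0 : ℝ)..1, G x y) -
      ∫ y in (0 : ℝ)..1, ∫ x in (0 : ℝ)..1, H x y| ≤ C * ρ ^ n := by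
    rw [← intervalIntegral.integral_sub hGi hHi, ← Real.norm_eq_abs]
    refine (intervalIntegral.norm_integral_le_of_norm_le_const (C := C * ρ ^ n)
      fun y hy => ?_).trans (by simp)
    rw [uIoc_of_le zero_le_one] at hy
    have hy' := Ioc_subset_Icc_self hy
    rw [← intervalIntegral.integral_sub
      ((hGx y hy').intervalIntegrable_of_Icc zero_le_one)
      (g := fun x => H x y)
      ((hH.cont.comp (by fun_prop : Continuous fun x => (x, y))).intervalIntegrable _ _)]
    refine (intervalIntegral.norm_integral_le_of_norm_le_const (C := C * ρ ^ n)
      fun x hx => ?_).trans (by simp)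
    rw [uIoc_of_le zero_le_one] at hx
    exact hb _ (Ioc_subset_Icc_self hx) _ hy'
  have e3 : ρ ^ n ≤ ρ ^ K₁ + ρ ^ K₂ := by
    rcases min_choice K₁ K₂ with hm | hm <;> rw [hn, hm]
    · exact le_add_of_nonneg_right (by positivity)
    · exact le_add_of_nonneg_left (by positivity)
  have e4 : quadTensor LR K₁ K₂ G - ∫ y in (0 : ℝ)..1, ∫ x in (0 : ℝ)..1, G x y =
      (quadTensor LR K₁ K₂ G - quadTensor LR K₁ K₂ H) -
        ((∫ y in (0 : ℝ)..1, ∫ x in (0 : ℝ)..1, G x y) -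
          ∫ y in (0 : ℝ)..1, ∫ x in (0 : ℝ)..1, H x y) := by
    rw [hex]; ring
  beta_reduce
  rw [e4]
  calc _ ≤ C * ρ ^ n + C * ρ ^ n := (abs_sub _ _).trans (add_le_add e1 e2)
    _ = 2 * C * ρ ^ n := by ring
    _ ≤ _ := mul_le_mul_of_nonneg_left e3 (by positivity)

/-- A one-dimensional quadrature is a tensor quadrature of a function that does not depend on the
second variable. -/
theorem PolyApprox₂.expConv {f : ℝ → ℝ} (hf : PolyApprox₂ fun x _ => f x)
    (LR : ∀ K, LegendreRule K) :
    ExpConv fun K => quadLeg LR K f - ∫ x in (0 : ℝ)..1, f x := by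
  obtain ⟨C, ρ, h0, h1, h⟩ := hf.expConv₂ LR
  refine ⟨2 * C, ρ, h0, h1, fun K hK => ?_⟩
  have := h K K hK hK
  have e : quadTensor LR K K (fun x _ => f x) = quadLeg LR K f := by
    unfold quadTensor quadLeg
    refine Finset.sum_congr rfl fun ν _ => ?_
    simp_rw [mul_right_comm _ _ (f _), ← Finset.mul_sum]
    rw [LegendreRule.sum_weight _ hK, mul_one]
  beta_reduce at this
  rw [e] at this
  simp only [intervalIntegral.integral_const, sub_zero, one_smul] at this
  exact this.trans (le_of_eq (by ring))

/-! ### Geometry of the mesh -/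

/-- The assumptions on the mesh `0 = t₀ < … < t_N = T`. -/
structure IsMesh (T : ℝ) {N : ℕ} (t : Fin (N + 1) → ℝ) : Prop where
  pos : 0 < T
  strictMono : StrictMono t
  zero : t 0 = 0
  last : t (Fin.last N) = T
  msize_le : ∀ ℓ, msize t ℓ ≤ T / 2

namespace IsMesh

variable {T : ℝ} {N : ℕ} {t : Fin (N + 1) → ℝ} (h : IsMesh T t) {k ℓ : Fin N}
include h

theorem lft_lt_rgt (k : Fin N) : lft t k < rgt t k :=
  h.strictMono Fin.castSucc_lt_succ

theorem msize_pos (k : Fin N) : 0 < msize t k := sub_pos.2 (h.lft_lt_rgt k)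

theorem lft_nonneg (k : Fin N) : 0 ≤ lft t k := h.zero ▸ h.strictMono.monotone (Fin.zero_le _)

theorem rgt_le (k : Fin N) : rgt t k ≤ T := by
  conv_rhs => rw [← h.last]
  exact h.strictMono.monotone (Fin.le_last _)

theorem lft_eq_zero (hk : (k : ℕ) = 0) : lft t k = 0 := by
  rw [← h.zero, lft]; congr 1; ext; simpa using hk

theorem lft_pos (hk : (k : ℕ) ≠ 0) : 0 < lft t k := by
  rw [← h.zero]; exact h.strictMono (Fin.lt_def.2 (by simp; omega))

theorem rgt_eq (hk : (k : ℕ) + 1 = N) : rgt t k = T := by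
  rw [← h.last, rgt]; congr 1; ext; simpa using hk

theorem rgt_lt (hk : (k : ℕ) + 1 ≠ N) : rgt t k < T := by
  conv_rhs => rw [← h.last]
  exact h.strictMono (Fin.lt_def.2 (by simp; omega))

theorem rgt_le_lft (hk : k < ℓ) : rgt t k ≤ lft t ℓ :=
  h.strictMono.monotone (Fin.le_def.2 (by simpa using hk))

omit h in
theorem rgt_eq_lft (hk : (k : ℕ) + 1 = ℓ) : rgt t k = lft t ℓ := by
  unfold rgt lft; congr 1; ext; simpa using hk

theorem rgt_lt_lft (hk : (k : ℕ) + 1 < ℓ) : rgt t k < lft t ℓ :=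
  h.strictMono (Fin.lt_def.2 (by simpa using hk))

omit h in
theorem lft_add_msize (k : Fin N) : lft t k + msize t k = rgt t k := by simp [msize]

theorem add_mul_mem (k : Fin N) {x : ℝ} (hx : x ∈ Icc (0 : ℝ) 1) :
    lft t k + x * msize t k ∈ Icc (lft t k) (rgt t k) := by
  have := h.msize_pos k
  constructor
  · nlinarith [hx.1]
  · rw [← lft_add_msize]; nlinarith [hx.2]

end IsMesh

/-! ### Regular parts of the kernel -/

theorem SepPoly.const (c : ℝ) : SepPoly 0 0 fun _ _ => c where
  cont := continuous_const
  fst _ := ⟨C c, natDegree_C c |>.le, fun x => by simp⟩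
  snd _ := ⟨C c, natDegree_C c |>.le, fun x => by simp⟩

theorem SepPoly.sub {m n : ℕ} {H H' : ℝ → ℝ → ℝ} (h : SepPoly m n H) (h' : SepPoly m n H') :
    SepPoly m n fun x y => H x y - H' x y := by
  have := h.add (((SepPoly.const (-1)).mul h').mono (m' := m) (n' := n) (by omega) (by omega))
  simpa [sub_eq_add_neg] using this

theorem PolyApprox₂.poly (q : ℝ[X]) {m n : ℕ} {u : ℝ → ℝ → ℝ} (hu : SepPoly m n u) :
    PolyApprox₂ fun x y => q.eval (u x y) := of_sepPoly (hu.eval_comp q le_rfl)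

theorem PolyApprox₂.log {u : ℝ → ℝ → ℝ} (hu : SepPoly 1 1 u)
    (hpos : ∀ x ∈ Icc (0 : ℝ) 1, ∀ y ∈ Icc (0 : ℝ) 1, 0 < u x y) :
    PolyApprox₂ fun x y => Real.log (u x y) := by
  have hK : IsCompact (Icc (0 : ℝ) 1 ×ˢ Icc (0 : ℝ) 1) := isCompact_Icc.prod isCompact_Icc
  have hne : (Icc (0 : ℝ) 1 ×ˢ Icc (0 : ℝ) 1).Nonempty := ⟨(0, 0), by simp⟩
  obtain ⟨z, hz, hmin⟩ := hK.exists_isMinOn hne hu.cont.continuousOn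
  obtain ⟨w, hw, hmax⟩ := hK.exists_isMaxOn hne hu.cont.continuousOn
  exact PolyApprox₂.comp (PolyApprox.log (hpos _ hz.1 _ hz.2)) hu fun x hx y hy =>
    ⟨hmin (show (x, y) ∈ _ from ⟨hx, hy⟩), hmax (show (x, y) ∈ _ from ⟨hx, hy⟩)⟩

theorem tanQuot_abs (T x : ℝ) : tanQuot T |x| = tanQuot T x := by
  rcases abs_choice x with h | h <;> rw [h]
  unfold tanQuot
  simp only [neg_eq_zero, mul_neg, neg_div, Real.tan_neg, div_neg, neg_neg]

/-- The angles of `x` and `2T - x` are complementary. -/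
theorem tanProd_eq {T : ℝ} (hT : 0 < T) (x : ℝ) : tanProd T x = (tanQuot T (2 * T - x))⁻¹ := by
  unfold tanProd tanQuot
  by_cases hx : x = 2 * T
  · simp [hx]
  · rw [if_neg hx, if_neg (by intro h; apply hx; linarith), inv_div]
    have : Real.pi * x / (4 * T) = Real.pi / 2 - Real.pi * (2 * T - x) / (4 * T) := by
      field_simp; ring
    rw [this, Real.tan_pi_div_two_sub]
    ring

theorem tan_eq_tanQuot_mul {T x : ℝ} (hx : x ≠ 0) :
    Real.tan (Real.pi * x / (4 * T)) = tanQuot T x * x := by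
  rw [tanQuot, if_neg hx]; field_simp

section
variable {T : ℝ} {N : ℕ} {t : Fin (N + 1) → ℝ}

theorem PolyApprox₂.log_tanQuot (hT : 0 < T) {u : ℝ → ℝ → ℝ} (hu : SepPoly 1 1 u)
    (hb : ∀ x ∈ Icc (0 : ℝ) 1, ∀ y ∈ Icc (0 : ℝ) 1, |u x y| < 2 * T) :
    PolyApprox₂ fun x y => Real.log (tanQuot T (u x y)) := by
  have hK : IsCompact (Icc (0 : ℝ) 1 ×ˢ Icc (0 : ℝ) 1) := isCompact_Icc.prod isCompact_Icc
  have hne : (Icc (0 : ℝ) 1 ×ˢ Icc (0 : ℝ) 1).Nonempty := ⟨(0, 0), by simp⟩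
  obtain ⟨w, hw, hmax⟩ := hK.exists_isMaxOn hne hu.cont.abs.continuousOn
  exact PolyApprox₂.comp (PolyApprox.log_tanQuot hT (abs_nonneg _) (hb _ hw.1 _ hw.2)) hu
    fun x hx y hy => abs_le.1 (hmax (show (x, y) ∈ _ from ⟨hx, hy⟩))

theorem PolyApprox₂.log_tan (hT : 0 < T) {u : ℝ → ℝ → ℝ} (hu : SepPoly 1 1 u)
    (hpos : ∀ x ∈ Icc (0 : ℝ) 1, ∀ y ∈ Icc (0 : ℝ) 1, 0 < u x y)
    (hlt : ∀ x ∈ Icc (0 : ℝ) 1, ∀ y ∈ Icc (0 : ℝ) 1, u x y < 2 * T) :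
    PolyApprox₂ fun x y => Real.log (Real.tan (Real.pi * u x y / (4 * T))) := by
  have hb : ∀ x ∈ Icc (0 : ℝ) 1, ∀ y ∈ Icc (0 : ℝ) 1, |u x y| < 2 * T := fun x hx y hy => by
    rw [abs_of_pos (hpos x hx y hy)]; exact hlt x hx y hy
  refine ((PolyApprox₂.log_tanQuot hT hu hb).add (PolyApprox₂.log hu hpos)).congr
    fun x hx y hy => ?_
  rw [tan_eq_tanQuot_mul (hpos x hx y hy).ne', Real.log_mul (tanQuot_pos hT (hb x hx y hy)).ne'
    (hpos x hx y hy).ne']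

/-- The three cases of the definition of the regular part keep the argument of each factor away
from the zeros and the poles of the tangent. The pole at `2T` is reached only on the last element. -/
theorem PolyApprox₂.regF (h : IsMesh T t) (k ℓ : Fin N) {S X : ℝ → ℝ → ℝ} (hS : SepPoly 1 1 S)
    (hX : SepPoly 1 1 X)
    (hSm : ∀ x ∈ Icc (0 : ℝ) 1, ∀ y ∈ Icc (0 : ℝ) 1, S x y ∈ Icc (lft t k) (rgt t k))
    (hXm : ∀ x ∈ Icc (0 : ℝ) 1, ∀ y ∈ Icc (0 : ℝ) 1, X x y ∈ Icc (lft t ℓ) (rgt t ℓ))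
    (hlast : BothLast k ℓ ∨ ∀ x ∈ Icc (0 : ℝ) 1, ∀ y ∈ Icc (0 : ℝ) 1, S x y + X x y < 2 * T) :
    PolyApprox₂ fun x y => ModHilbert.regF T k ℓ (S x y) (X x y) := by
  have hT := h.pos
  have hk0 := h.lft_nonneg k
  have hkT := h.rgt_le k
  have hl0 := h.lft_nonneg ℓ
  have hlT := h.rgt_le ℓ
  have hdb : ∀ x ∈ Icc (0 : ℝ) 1, ∀ y ∈ Icc (0 : ℝ) 1, |X x y - S x y| < 2 * T :=
    fun x hx y hy => by
      have := hSm x hx y hy; have := hXm x hx y hy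
      rw [abs_lt]; constructor <;> linarith [(hSm x hx y hy).1, (hSm x hx y hy).2,
        (hXm x hx y hy).1, (hXm x hx y hy).2]
  have hd := PolyApprox₂.log_tanQuot hT (hX.sub hS) hdb
  unfold ModHilbert.regF
  simp_rw [tanQuot_abs]
  by_cases hf : BothFirst k ℓ
  · simp_rw [if_pos hf]
    -- the mesh sizes are at most `T / 2`, so that `S + X ≤ T`
    have hub : ∀ x ∈ Icc (0 : ℝ) 1, ∀ y ∈ Icc (0 : ℝ) 1, |S x y + X x y| < 2 * T :=
      fun x hx y hy => by
        have h1 := h.msize_le k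
        have h2 := h.msize_le ℓ
        rw [msize, h.lft_eq_zero hf.1] at h1
        rw [msize, h.lft_eq_zero hf.2] at h2
        rw [abs_lt]; constructor <;> linarith [(hSm x hx y hy).1, (hSm x hx y hy).2,
          (hXm x hx y hy).1, (hXm x hx y hy).2]
    refine ((PolyApprox₂.log_tanQuot hT (hS.add hX) hub).add hd).congr fun x hx y hy => ?_
    rw [Real.log_mul (tanQuot_pos hT (hub x hx y hy)).ne' (tanQuot_pos hT (hdb x hx y hy)).ne']
  simp_rw [if_neg hf]
  by_cases hl : BothLast k ℓ
  · simp_rw [if_pos hl, tanProd_eq hT]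
    -- likewise `2T - (S + X) ≤ T`
    have hub : ∀ x ∈ Icc (0 : ℝ) 1, ∀ y ∈ Icc (0 : ℝ) 1, |2 * T - (S x y + X x y)| < 2 * T :=
      fun x hx y hy => by
        have h1 := h.msize_le k
        have h2 := h.msize_le ℓ
        rw [msize, h.rgt_eq hl.1] at h1
        rw [msize, h.rgt_eq hl.2] at h2
        rw [abs_lt]; constructor <;> linarith [(hSm x hx y hy).1, (hSm x hx y hy).2,
          (hXm x hx y hy).1, (hXm x hx y hy).2]
    have hu : SepPoly 1 1 fun x y => 2 * T - (S x y + X x y) :=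
      ((SepPoly.const (2 * T)).mono (m' := 1) (n' := 1) (by omega) (by omega)).sub (hS.add hX)
    refine ((PolyApprox₂.log_tanQuot hT hu hub).neg.add hd).congr fun x hx y hy => ?_
    rw [Real.log_mul (inv_pos.2 (tanQuot_pos hT (hub x hx y hy))).ne'
      (tanQuot_pos hT (hdb x hx y hy)).ne', Real.log_inv]
  simp_rw [if_neg hl]
  replace hlast := hlast.resolve_left hl
  have hpos : ∀ x ∈ Icc (0 : ℝ) 1, ∀ y ∈ Icc (0 : ℝ) 1, 0 < S x y + X x y := fun x hx y hy => by
    by_cases h0 : (k : ℕ) = 0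
    · have := h.lft_pos (k := ℓ) fun h1 => hf ⟨h0, h1⟩
      linarith [(hSm x hx y hy).1, (hXm x hx y hy).1]
    · have := h.lft_pos h0
      linarith [(hSm x hx y hy).1, (hXm x hx y hy).1]
  refine ((PolyApprox₂.log_tan hT (hS.add hX) hpos hlast).add hd).congr fun x hx y hy => ?_
  rw [Real.log_mul _ (tanQuot_pos hT (hdb x hx y hy)).ne']
  rw [tan_eq_tanQuot_mul (hpos x hx y hy).ne']
  exact mul_ne_zero (tanQuot_pos hT (by
    rw [abs_of_pos (hpos x hx y hy)]; exact hlast x hx y hy)).ne' (hpos x hx y hy).ne'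

theorem not_bothLast_lt (h : IsMesh T t) {k ℓ : Fin N} :
    BothLast k ℓ ∨ rgt t k + rgt t ℓ < 2 * T := by
  by_cases hk : (k : ℕ) + 1 = N
  · by_cases hl : (ℓ : ℕ) + 1 = N
    · exact Or.inl ⟨hk, hl⟩
    · exact Or.inr (by linarith [h.rgt_le k, h.rgt_lt hl])
  · exact Or.inr (by linarith [h.rgt_le ℓ, h.rgt_lt hk])

/-- The condition at `2T` in `PolyApprox₂.regF` always holds. -/
theorem PolyApprox₂.regF' (h : IsMesh T t) (k ℓ : Fin N) {S X : ℝ → ℝ → ℝ} (hS : SepPoly 1 1 S)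
    (hX : SepPoly 1 1 X)
    (hSm : ∀ x ∈ Icc (0 : ℝ) 1, ∀ y ∈ Icc (0 : ℝ) 1, S x y ∈ Icc (lft t k) (rgt t k))
    (hXm : ∀ x ∈ Icc (0 : ℝ) 1, ∀ y ∈ Icc (0 : ℝ) 1, X x y ∈ Icc (lft t ℓ) (rgt t ℓ)) :
    PolyApprox₂ fun x y => ModHilbert.regF T k ℓ (S x y) (X x y) :=
  PolyApprox₂.regF h k ℓ hS hX hSm hXm ((not_bothLast_lt h).imp_right fun hlt x hx y hy => by
    linarith [(hSm x hx y hy).2, (hXm x hx y hy).2])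

/-! ### Exponential convergence of the Gauß–Legendre quadratures in the schemes -/

theorem legConv_splitTerms (LR : ∀ K, LegendreRule K) (c : ℝ) {P : ℝ → ℝ → ℝ} {r : ℝ → ℝ}
    (hP : PolyApprox₂ P) (hr : PolyApprox₂ fun x _ => r x) :
    ∀ τ ∈ splitTerms c P r, τ.LegConv LR := by
  simp only [splitTerms, List.forall_mem_cons, List.not_mem_nil, false_imp_iff, implies_true,
    and_true]
  exact ⟨trivial, (hP.mul hr).expConv₂ LR⟩

theorem mul_one_sub_mem {x y : ℝ} (hx : x ∈ Icc (0 : ℝ) 1) (hy : y ∈ Icc (0 : ℝ) 1) :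
    (1 - x) * y ∈ Icc (0 : ℝ) 1 :=
  ⟨mul_nonneg (by linarith [hx.2]) hy.1, by nlinarith [hx.1, hx.2, hy.1, hy.2]⟩

/-- Elements that are not adjacent have a positive distance. -/
theorem PolyApprox₂.log_abs_sub_sub (h : IsMesh T t) {k ℓ : Fin N}
    (hkl : (k : ℕ) + 1 < ℓ ∨ (ℓ : ℕ) + 1 < k) :
    PolyApprox₂ fun ξ η => Real.log |(lft t k + ξ * msize t k) - (lft t ℓ + η * msize t ℓ)| := by
  rcases hkl with hkl | hkl
  · have hu : SepPoly 1 1 fun x y => (lft t ℓ + y * msize t ℓ) - (lft t k + x * msize t k) :=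
      SepPoly.bilinear (lft t ℓ - lft t k) (-msize t k) (msize t ℓ) 0 (by intros; ring)
    refine (PolyApprox₂.log hu fun x hx y hy => ?_).congr fun x hx y hy => ?_
    · linarith [(h.add_mul_mem k hx).2, (h.add_mul_mem ℓ hy).1, h.rgt_lt_lft hkl]
    · rw [abs_sub_comm, Real.log_abs]
  · have hu : SepPoly 1 1 fun x y => (lft t k + x * msize t k) - (lft t ℓ + y * msize t ℓ) :=
      SepPoly.bilinear (lft t k - lft t ℓ) (msize t k) (-msize t ℓ) 0 (by intros; ring)
    refine (PolyApprox₂.log hu fun x hx y hy => ?_).congr fun x hx y hy => ?_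
    · linarith [(h.add_mul_mem k hx).1, (h.add_mul_mem ℓ hy).2, h.rgt_lt_lft hkl]
    · rw [Real.log_abs]

theorem legConv_singTerms (h : IsMesh T t) (LR : ∀ K, LegendreRule K) (k ℓ : Fin N) (a q : ℝ[X]) :
    ∀ τ ∈ singTerms t k ℓ a q, τ.LegConv LR := by
  have hk := h.msize_pos k
  have hl := h.msize_pos ℓ
  have hA : PolyApprox₂ fun x _ => a.eval x :=
    PolyApprox₂.poly a (SepPoly.linear_fst 0 1 (by intros; ring))
  have hlog : PolyApprox₂ fun x _ => Real.log (1 + x) :=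
    PolyApprox₂.log (SepPoly.bilinear 1 1 0 0 (by intros; ring))
      fun x hx y hy => by linarith [hx.1]
  have hY : PolyApprox₂ fun _ y => y := PolyApprox₂.of_sepPoly
    (SepPoly.linear_snd 0 1 (by intros; ring))
  unfold singTerms
  split_ifs with h1 h2 h3 h4 h5
  · simp only [List.forall_mem_append, List.forall_mem_cons, List.not_mem_nil, false_imp_iff,
      implies_true, and_true]
    refine ⟨⟨⟨hA.expConv LR, trivial, hA.expConv LR⟩, legConv_splitTerms LR _ ?_ hlog⟩,
      legConv_splitTerms LR _ ?_ hlog⟩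
    · exact ((PolyApprox₂.poly a (SepPoly.linear_snd 0 1 (by intros; ring))).mul hY).mul
        (PolyApprox₂.poly _ (SepPoly.bilinear 0 0 0 1 (by intros; ring)))
    · exact ((PolyApprox₂.poly a (SepPoly.bilinear 0 0 0 1 (by intros; ring))).mul hY).mul
        (PolyApprox₂.poly _ (SepPoly.linear_snd 0 1 (by intros; ring)))
  · simp only [List.forall_mem_append, List.forall_mem_cons, List.not_mem_nil, false_imp_iff,
      implies_true, and_true]
    refine ⟨⟨trivial, legConv_splitTerms LR _ ?_ hlog⟩, legConv_splitTerms LR _ ?_ hlog⟩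
    · exact ((PolyApprox₂.poly a (SepPoly.linear_snd 1 (-1) (by intros; ring))).mul
        (PolyApprox₂.poly _ (SepPoly.bilinear 1 0 0 (-1) (by intros; ring)))).mul hY
    · exact ((PolyApprox₂.poly a (SepPoly.bilinear 1 0 0 (-1) (by intros; ring))).mul
        (PolyApprox₂.poly _ (SepPoly.linear_snd 1 (-1) (by intros; ring)))).mul hY
  · simp only [List.forall_mem_cons, List.not_mem_nil, false_imp_iff,
      implies_true, and_true]
    exact ⟨hA.expConv LR, trivial⟩
  · simp only [List.forall_mem_append]
    refine ⟨legConv_splitTerms LR _ ?_ ?_, legConv_splitTerms LR _ ?_ ?_⟩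
    · exact ((PolyApprox₂.poly a (SepPoly.linear_snd 1 (-1) (by intros; ring))).mul
        (PolyApprox₂.poly _ (SepPoly.bilinear 0 0 0 1 (by intros; ring)))).mul hY
    · exact PolyApprox₂.log (SepPoly.bilinear (msize t ℓ) (msize t k) 0 0 (by intros; ring))
        fun x hx y hy => by nlinarith [hx.1]
    · exact ((PolyApprox₂.poly a (SepPoly.bilinear 1 0 (-1) 1 (by intros; ring))).mul
        (PolyApprox₂.poly _ (SepPoly.linear_snd 0 1 (by intros; ring)))).mul hY
    · exact PolyApprox₂.log (SepPoly.bilinear (msize t ℓ + msize t k) (-msize t ℓ) 0 0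
        (by intros; ring)) fun x hx y hy => by nlinarith [hx.2]
  · simp only [List.forall_mem_append]
    refine ⟨legConv_splitTerms LR _ ?_ ?_, legConv_splitTerms LR _ ?_ ?_⟩
    · exact ((PolyApprox₂.poly a (SepPoly.bilinear 0 0 1 (-1) (by intros; ring))).mul
        (PolyApprox₂.poly _ (SepPoly.linear_snd 1 (-1) (by intros; ring)))).mul hY
    · exact PolyApprox₂.log (SepPoly.bilinear (msize t k + msize t ℓ) (-msize t ℓ) 0 0
        (by intros; ring)) fun x hx y hy => by nlinarith [hx.2]
    · exact ((PolyApprox₂.poly a (SepPoly.linear_snd 0 1 (by intros; ring))).mul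
        (PolyApprox₂.poly _ (SepPoly.bilinear 1 0 (-1) 1 (by intros; ring)))).mul hY
    · exact PolyApprox₂.log (SepPoly.bilinear (msize t k + msize t ℓ) (-msize t k) 0 0
        (by intros; ring)) fun x hx y hy => by nlinarith [hx.2]
  · simp only [List.forall_mem_cons, List.not_mem_nil, false_imp_iff,
      implies_true, and_true]
    refine PolyApprox₂.expConv₂ (((PolyApprox₂.poly a (SepPoly.linear_snd 0 1 (by intros; ring))).mul
      (PolyApprox₂.poly _ (SepPoly.linear_fst 0 1 (by intros; ring)))).mul ?_) LR
    exact PolyApprox₂.log_abs_sub_sub h (by omega)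

theorem PolyApprox₂.regF_duffy_fst (h : IsMesh T t) (k ℓ : Fin N) :
    PolyApprox₂ fun ξ η => ModHilbert.regF T k ℓ (lft t k + (1 - ξ) * η * msize t k)
      (lft t ℓ + η * msize t ℓ) :=
  PolyApprox₂.regF' h k ℓ
    (SepPoly.bilinear (lft t k) 0 (msize t k) (-msize t k) (by intros; ring))
    (SepPoly.bilinear (lft t ℓ) 0 (msize t ℓ) 0 (by intros; ring))
    (fun _ hx _ hy => h.add_mul_mem k (mul_one_sub_mem hx hy)) (fun _ _ _ hy => h.add_mul_mem ℓ hy)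

theorem PolyApprox₂.regF_duffy_snd (h : IsMesh T t) (k ℓ : Fin N) :
    PolyApprox₂ fun ξ η => ModHilbert.regF T k ℓ (lft t k + ξ * msize t k)
      (lft t ℓ + (1 - η) * ξ * msize t ℓ) :=
  PolyApprox₂.regF' h k ℓ
    (SepPoly.bilinear (lft t k) (msize t k) 0 0 (by intros; ring))
    (SepPoly.bilinear (lft t ℓ) (msize t ℓ) 0 (-msize t ℓ) (by intros; ring))
    (fun _ hx _ _ => h.add_mul_mem k hx) (fun _ hx _ hy => h.add_mul_mem ℓ (mul_one_sub_mem hy hx))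

theorem legConv_kernTerms (h : IsMesh T t) (LR : ∀ K, LegendreRule K) (k ℓ : Fin N) (a q : ℝ[X]) :
    ∀ τ ∈ kernTerms T t k ℓ a q, τ.LegConv LR := by
  simp only [kernTerms, List.forall_mem_append, List.forall_mem_cons, List.not_mem_nil,
    false_imp_iff, implies_true, and_true]
  refine ⟨⟨PolyApprox₂.expConv₂ ?_ LR, PolyApprox₂.expConv₂ ?_ LR⟩, legConv_singTerms h LR k ℓ a q⟩
  · exact ((PolyApprox₂.poly a (SepPoly.linear_snd 0 1 (by intros; ring))).mul
      ((PolyApprox₂.regF_duffy_fst h k ℓ).mul (PolyApprox₂.of_sepPoly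
        (SepPoly.linear_snd 0 1 (by intros; ring))))).mul
      (PolyApprox₂.poly _ (SepPoly.bilinear 0 0 1 (-1) (by intros; ring)))
  · exact ((PolyApprox₂.poly a (SepPoly.bilinear 0 1 0 (-1) (by intros; ring))).mul
      ((PolyApprox₂.regF_duffy_snd h k ℓ).mul (PolyApprox₂.of_sepPoly
        (SepPoly.linear_fst 0 1 (by intros; ring))))).mul
      (PolyApprox₂.poly _ (SepPoly.linear_fst 0 1 (by intros; ring)))

theorem PolyApprox₂.fst_poly (q : ℝ[X]) : PolyApprox₂ fun x _ => q.eval x :=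
  PolyApprox₂.poly q (SepPoly.linear_fst 0 1 (by intros; ring))

theorem PolyApprox₂.log_tanQuot_init (h : IsMesh T t) {ℓ : Fin N} (hl : (ℓ : ℕ) = 0) :
    PolyApprox₂ fun η _ => Real.log (tanQuot T (η * msize t ℓ)) :=
  PolyApprox₂.log_tanQuot h.pos (SepPoly.bilinear 0 (msize t ℓ) 0 0 (by intros; ring))
    fun x hx y hy => by
      have := h.add_mul_mem ℓ hx
      rw [h.lft_eq_zero hl, zero_add] at this
      rw [abs_of_nonneg this.1]
      linarith [this.2, h.rgt_le ℓ, h.pos]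

theorem PolyApprox₂.log_tan_init (h : IsMesh T t) {ℓ : Fin N} (hl : (ℓ : ℕ) ≠ 0) :
    PolyApprox₂ fun η _ =>
      Real.log (Real.tan (Real.pi * (lft t ℓ + η * msize t ℓ) / (4 * T))) :=
  PolyApprox₂.log_tan h.pos (SepPoly.bilinear (lft t ℓ) (msize t ℓ) 0 0 (by intros; ring))
    (fun x hx y hy => by linarith [(h.add_mul_mem ℓ hx).1, h.lft_pos hl])
    (fun x hx y hy => by linarith [(h.add_mul_mem ℓ hx).2, h.rgt_le ℓ, h.pos])

theorem legConv_initTerms (h : IsMesh T t) (LR : ∀ K, LegendreRule K) (k ℓ : Fin N) (a q : ℝ[X]) :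
    ∀ τ ∈ initTerms T t k ℓ a q, τ.LegConv LR := by
  unfold initTerms
  split_ifs with h1 h2
  · simp only [List.forall_mem_cons, List.not_mem_nil, false_imp_iff, implies_true, and_true]
    exact ⟨((PolyApprox₂.fst_poly a).mul (PolyApprox₂.log_tanQuot_init h h2)).expConv LR, trivial,
      (PolyApprox₂.fst_poly a).expConv LR⟩
  · simp only [List.forall_mem_cons, List.not_mem_nil, false_imp_iff, implies_true, and_true]
    exact ((PolyApprox₂.fst_poly a).mul (PolyApprox₂.log_tan_init h h2)).expConv LR
  · simp

theorem PolyApprox₂.log_abs_sub (h : IsMesh T t) {ℓ : Fin N} {s : ℝ}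
    (hs : s < lft t ℓ ∨ rgt t ℓ < s) :
    PolyApprox₂ fun η _ => Real.log |s - (lft t ℓ + η * msize t ℓ)| := by
  rcases hs with hs | hs
  · refine (PolyApprox₂.log (u := fun x y => lft t ℓ + x * msize t ℓ - s)
      (SepPoly.bilinear (lft t ℓ - s) (msize t ℓ) 0 0 (by intros; ring)) fun x hx y hy => ?_).congr
      fun x hx y hy => by rw [abs_sub_comm, Real.log_abs]
    linarith [(h.add_mul_mem ℓ hx).1]
  · refine (PolyApprox₂.log (u := fun x y => s - (lft t ℓ + x * msize t ℓ))
      (SepPoly.bilinear (s - lft t ℓ) (-msize t ℓ) 0 0 (by intros; ring)) fun x hx y hy => ?_).congr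
      fun x hx y hy => by rw [Real.log_abs]
    linarith [(h.add_mul_mem ℓ hx).2]

theorem PolyApprox₂.regF_line (h : IsMesh T t) (k ℓ : Fin N) {s : ℝ}
    (hs : s ∈ Icc (lft t k) (rgt t k)) :
    PolyApprox₂ fun η _ => ModHilbert.regF T k ℓ s (lft t ℓ + η * msize t ℓ) :=
  PolyApprox₂.regF' h k ℓ (S := fun _ _ => s) (SepPoly.bilinear s 0 0 0 (by intros; ring))
    (SepPoly.bilinear (lft t ℓ) (msize t ℓ) 0 0 (by intros; ring)) (fun _ _ _ _ => hs)
    (fun _ hx _ _ => h.add_mul_mem ℓ hx)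

theorem expConv_mul_log (LR : ∀ K, LegendreRule K) (q : ℝ[X]) (u : ℝ → ℝ) (a b : ℝ)
    (hu : ∀ x, u x = a + b * x) (hpos : ∀ x ∈ Icc (0 : ℝ) 1, 0 < u x) :
    ExpConv fun K => quadLeg LR K (fun η => q.eval η * Real.log (u η)) -
      ∫ η in (0 : ℝ)..1, q.eval η * Real.log (u η) :=
  ((PolyApprox₂.fst_poly q).mul (PolyApprox₂.log (u := fun x _ => u x)
    (SepPoly.bilinear a b 0 0 fun x y => by rw [hu]; ring) fun x hx _ _ => hpos x hx)).expConv LR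

theorem legConv_J0Terms (h : IsMesh T t) (LR : ∀ K, LegendreRule K) (k ℓ : Fin N) (c : ℝ)
    (u : ℝ[X]) : ∀ τ ∈ J0Terms T t k ℓ c u, τ.LegConv LR := by
  have hd := PolyApprox₂.fst_poly u.derivative
  have hk := h.msize_pos k
  have hl := h.msize_pos ℓ
  unfold J0Terms
  rw [List.forall_mem_append]
  constructor
  · simp only [List.forall_mem_cons, List.not_mem_nil, false_imp_iff, implies_true, and_true]
    exact (hd.mul (PolyApprox₂.regF_line h k ℓ ⟨le_rfl, (h.lft_lt_rgt k).le⟩)).expConv LR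
  · split_ifs with h1 h2 h3 h4 h5 <;>
      simp only [List.forall_mem_cons, List.not_mem_nil, false_imp_iff, implies_true, and_true]
    · exact ⟨trivial, trivial⟩
    · exact ⟨trivial, expConv_mul_log LR _ (fun η => 2 - η) 2 (-1) (fun x => by ring)
        fun x hx => by linarith [hx.2]⟩
    · exact ⟨trivial, trivial⟩
    · exact ⟨trivial, trivial⟩
    · exact expConv_mul_log LR _ (fun η => msize t k + η * msize t ℓ) (msize t k) (msize t ℓ)
        (fun x => by ring) fun x hx => by nlinarith [hx.1]
    · refine (hd.mul (PolyApprox₂.log_abs_sub h ?_)).expConv LR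
      rcases lt_or_ge (k : ℕ) ℓ with hlt | hge
      · exact Or.inl ((h.lft_lt_rgt k).trans_le (h.rgt_le_lft hlt))
      · exact Or.inr (h.rgt_lt_lft (by omega))

theorem legConv_J1Terms (h : IsMesh T t) (LR : ∀ K, LegendreRule K) (k ℓ : Fin N) (c : ℝ)
    (u : ℝ[X]) : ∀ τ ∈ J1Terms T t k ℓ c u, τ.LegConv LR := by
  have hd := PolyApprox₂.fst_poly u.derivative
  have hk := h.msize_pos k
  have hl := h.msize_pos ℓ
  unfold J1Terms
  by_cases hlast : BothLast k ℓ
  · simp [hlast]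
  simp only [if_neg hlast]
  rw [List.forall_mem_append]
  constructor
  · simp only [List.forall_mem_cons, List.not_mem_nil, false_imp_iff, implies_true, and_true]
    exact (hd.mul (PolyApprox₂.regF_line h k ℓ ⟨(h.lft_lt_rgt k).le, le_rfl⟩)).expConv LR
  · split_ifs with h1 h3 h4 h5 <;>
      simp only [List.forall_mem_cons, List.not_mem_nil, false_imp_iff, implies_true, and_true]
    · exact ⟨expConv_mul_log LR _ (fun η => 1 + η) 1 1 (fun x => by ring)
        fun x hx => by linarith [hx.1], trivial, trivial⟩
    · exact ⟨trivial, trivial⟩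
    · exact expConv_mul_log LR _ (fun η => msize t k + (1 - η) * msize t ℓ)
        (msize t k + msize t ℓ) (-msize t ℓ) (fun x => by ring) fun x hx => by nlinarith [hx.2]
    · exact ⟨trivial, trivial⟩
    · refine (hd.mul (PolyApprox₂.log_abs_sub h ?_)).expConv LR
      rcases lt_or_ge (k : ℕ) ℓ with hlt | hge
      · exact Or.inl (h.rgt_lt_lft (by omega))
      · exact Or.inr ((h.rgt_le_lft (show ℓ < k from Fin.lt_def.2 (by omega))).trans_lt
          (h.lft_lt_rgt k))

theorem legConv_scheme (h : IsMesh T t) (LR : ∀ K, LegendreRule K) (k ℓ : Fin N) (un um : ℝ[X])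
    (X : Kind) : ∀ τ ∈ scheme T t k ℓ un um X, τ.LegConv LR := by
  cases X <;> simp only [scheme, List.forall_mem_append]
  · exact ⟨legConv_initTerms h LR _ _ _ _, legConv_kernTerms h LR _ _ _ _⟩
  · exact ⟨legConv_initTerms h LR _ _ _ _, legConv_kernTerms h LR _ _ _ _⟩
  · exact ⟨⟨legConv_J0Terms h LR _ _ _ _, legConv_J1Terms h LR _ _ _ _⟩, legConv_kernTerms h LR _ _ _ _⟩

end

/-! ### Exactness of the quadratures for the logarithmic integrals -/

section
variable {K m n : ℕ} {H : ℝ → ℝ → ℝ}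

theorem LogRule.integral_mul_log (R : LogRule K) (p : ℝ[X]) (hp : p.natDegree + 1 ≤ 2 * K) :
    ∫ x in (0 : ℝ)..1, p.eval x * Real.log x = -∑ ν, R.weight ν * p.eval (R.node ν) := by
  rw [← R.exact p hp, ← intervalIntegral.integral_neg]
  simp

theorem SepPoly.continuous_fst (hH : SepPoly m n H) (y : ℝ) : Continuous fun x => H x y :=
  hH.cont.comp (by fun_prop : Continuous fun x => (x, y))

theorem SepPoly.continuous_snd (hH : SepPoly m n H) (x : ℝ) : Continuous fun y => H x y :=
  hH.cont.comp (by fun_prop : Continuous fun y => (x, y))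

theorem intervalIntegrable_mul_log {f : ℝ → ℝ} (hf : Continuous f) (a b : ℝ) :
    IntervalIntegrable (fun x => f x * Real.log x) volume a b :=
  intervalIntegral.intervalIntegrable_log'.continuousOn_mul hf.continuousOn

theorem LegendreRule.integral_fst (R : LegendreRule K) (hH : SepPoly m n H) (hm : m + 1 ≤ 2 * K)
    (y : ℝ) : ∫ x in (0 : ℝ)..1, H x y = ∑ ν, R.weight ν * H (R.node ν) y := by
  obtain ⟨p, hp, e⟩ := hH.fst y
  have := R.exact p (by omega)
  simpa [e] using this

theorem LegendreRule.integral_snd (R : LegendreRule K) (hH : SepPoly m n H) (hn : n + 1 ≤ 2 * K)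
    (x : ℝ) : ∫ y in (0 : ℝ)..1, H x y = ∑ ν, R.weight ν * H x (R.node ν) := by
  obtain ⟨p, hp, e⟩ := hH.snd x
  have := R.exact p (by omega)
  simpa [e] using this

theorem LogRule.integral_fst (R : LogRule K) (hH : SepPoly m n H) (hm : m + 1 ≤ 2 * K) (y : ℝ) :
    ∫ x in (0 : ℝ)..1, H x y * Real.log x = -∑ ν, R.weight ν * H (R.node ν) y := by
  obtain ⟨p, hp, e⟩ := hH.fst y
  simp_rw [e]
  exact R.integral_mul_log p (by omega)

theorem LogRule.integral_snd (R : LogRule K) (hH : SepPoly m n H) (hn : n + 1 ≤ 2 * K) (x : ℝ) :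
    ∫ y in (0 : ℝ)..1, H x y * Real.log y = -∑ ν, R.weight ν * H x (R.node ν) := by
  obtain ⟨p, hp, e⟩ := hH.snd x
  simp_rw [e]
  exact R.integral_mul_log p (by omega)

theorem quadMixed_exact (LR : ∀ K, LegendreRule K) (JR : ∀ K, LogRule K) {K₁ K₂ : ℕ}
    (hH : SepPoly m n H) (hm : m + 1 ≤ 2 * K₁) (hn : n + 1 ≤ 2 * K₂) :
    quadMixed LR JR K₁ K₂ H =
      ∫ y in (0 : ℝ)..1, ∫ x in (0 : ℝ)..1, H x y * Real.log y := by
  simp_rw [intervalIntegral.integral_mul_const, (LR K₁).integral_fst hH hm, Finset.sum_mul, mul_assoc]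
  rw [intervalIntegral.integral_finsetSum fun ν _ =>
    (intervalIntegrable_mul_log (hH.continuous_snd _) _ _).const_mul _]
  simp_rw [intervalIntegral.integral_const_mul, (JR K₂).integral_snd hH hn, quadMixed, mul_neg,
    Finset.mul_sum, Finset.sum_neg_distrib, mul_assoc]

/-- After the transformation of a triangle to the unit square, the logarithm of the distance to the
diagonal becomes `ln (x y) = ln x + ln y`; this is the integral over one of the variables. -/
theorem integral_mul_log_mul (R : LegendreRule K) (R' : LogRule K) (hH : SepPoly m n H)
    (hm : m + 1 ≤ 2 * K) {y : ℝ} (hy : y ≠ 0) :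
    ∫ x in (0 : ℝ)..1, H x y * Real.log (x * y) =
      -(∑ ν, R'.weight ν * H (R'.node ν) y) +
        (∑ ν, R.weight ν * H (R.node ν) y) * Real.log y := by
  have hc := hH.continuous_fst y
  rw [← R'.integral_fst hH hm, ← R.integral_fst hH hm, ← intervalIntegral.integral_mul_const,
    ← intervalIntegral.integral_add (intervalIntegrable_mul_log hc _ _)
      (g := fun x => H x y * Real.log y) ((hc.mul continuous_const).intervalIntegrable _ _)]
  refine intervalIntegral.integral_congr_ae (Eventually.of_forall fun x hx => ?_)
  rw [uIoc_of_le zero_le_one] at hx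
  rw [Real.log_mul hx.1.ne' hy]; ring

theorem intervalIntegrable_log_triangle (R : LegendreRule K) (R' : LogRule K)
    (hH : SepPoly m n H) (a b : ℝ) :
    IntervalIntegrable (fun y => -(∑ ν, R'.weight ν * H (R'.node ν) y) +
        (∑ ν, R.weight ν * H (R.node ν) y) * Real.log y) volume a b := by
  refine IntervalIntegrable.add (Continuous.intervalIntegrable ?_ _ _)
    (intervalIntegrable_mul_log ?_ _ _)
  · exact (continuous_finsetSum _ fun ν _ => continuous_const.mul (hH.continuous_snd _)).neg
  · exact continuous_finsetSum _ fun ν _ => continuous_const.mul (hH.continuous_snd _)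

theorem integral_log_triangle (R : LegendreRule K) (R' : LogRule K) (hH : SepPoly m n H)
    (hn : n + 1 ≤ 2 * K) :
    ∫ y in (0 : ℝ)..1, (-(∑ ν, R'.weight ν * H (R'.node ν) y) +
        (∑ ν, R.weight ν * H (R.node ν) y) * Real.log y) =
      -(∑ μ, ∑ ν, R'.weight μ * R.weight ν * H (R.node ν) (R'.node μ)) -
        ∑ μ, ∑ ν, R.weight μ * R'.weight ν * H (R'.node ν) (R.node μ) := by
  have hc := hH.continuous_snd
  simp_rw [Finset.sum_mul, mul_assoc]
  have i1 : ∀ ν, IntervalIntegrable (fun y => R'.weight ν * H (R'.node ν) y) volume 0 1 :=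
    fun ν => (continuous_const.mul (hc _)).intervalIntegrable _ _
  have i2 : ∀ ν, IntervalIntegrable (fun y => R.weight ν * (H (R.node ν) y * Real.log y)) volume
      0 1 := fun ν => (intervalIntegrable_mul_log (hc _) _ _).const_mul _
  have s1 : IntervalIntegrable (fun y => -∑ ν, R'.weight ν * H (R'.node ν) y) volume 0 1 :=
    (continuous_finsetSum _ fun ν _ => continuous_const.mul (hc _)).neg.intervalIntegrable _ _
  have s2 : IntervalIntegrable (fun y => ∑ ν, R.weight ν * (H (R.node ν) y * Real.log y)) volume
      0 1 := by
    simpa [Finset.sum_fn] using IntervalIntegrable.sum Finset.univ fun ν _ => i2 ν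
  rw [intervalIntegral.integral_add s1 s2, intervalIntegral.integral_neg,
    intervalIntegral.integral_finsetSum fun ν _ => i1 ν,
    intervalIntegral.integral_finsetSum fun ν _ => i2 ν]
  simp_rw [intervalIntegral.integral_const_mul, R.integral_snd hH hn, R'.integral_snd hH hn,
    mul_neg, Finset.mul_sum, Finset.sum_neg_distrib]
  rw [add_comm, sub_eq_add_neg]
  congr 2
  · rw [Finset.sum_comm]
    exact Finset.sum_congr rfl fun _ _ => Finset.sum_congr rfl fun _ _ => by ring
  · rw [Finset.sum_comm]
    exact Finset.sum_congr rfl fun _ _ => Finset.sum_congr rfl fun _ _ => by ring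

/-- The square is split along its diagonal, and each of the triangles is mapped to the unit
square. -/
theorem quadLogTensor_exact (LR : ∀ K, LegendreRule K) (JR : ∀ K, LogRule K) {g : ℝ → ℝ → ℝ}
    (hg : Continuous (Function.uncurry g))
    (h1 : SepPoly m n fun x y => y * g ((1 - x) * y) y)
    (h2 : SepPoly m n fun x y => y * g (1 - (1 - x) * y) (1 - y))
    (hm : m + 1 ≤ 2 * K) (hn : n + 1 ≤ 2 * K) :
    quadLogTensor LR JR K g =
      ∫ t in (0 : ℝ)..1, ∫ s in (0 : ℝ)..1, g s t * Real.log |s - t| := by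
  set R := LR K
  set R' := JR K
  have hgt : ∀ t, Continuous fun s => g s t := fun t =>
    hg.comp (by fun_prop : Continuous fun s => (s, t))
  have hlog : ∀ t a b : ℝ, IntervalIntegrable (fun s => g s t * Real.log |s - t|) volume a b := by
    intro t a b
    have : IntervalIntegrable (fun s => Real.log (s - t)) volume a b := by
      have := (intervalIntegral.intervalIntegrable_log' (a := a - t) (b := b - t)).comp_sub_right t
      simpa using this
    simp_rw [Real.log_abs]
    exact this.continuousOn_mul (hgt t).continuousOn
  have hin : ∀ t ∈ Ioo (0 : ℝ) 1, ∫ s in (0 : ℝ)..1, g s t * Real.log |s - t| =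
      (∫ x in (0 : ℝ)..1, t * g ((1 - x) * t) t * Real.log (x * t)) +
      ∫ x in (0 : ℝ)..1, (1 - t) * g (1 - (1 - x) * (1 - t)) (1 - (1 - t)) *
        Real.log (x * (1 - t)) := by
    intro t ht
    rw [← intervalIntegral.integral_add_adjacent_intervals (hlog t 0 t) (hlog t t 1)]
    congr 1
    · have := intervalIntegral.mul_integral_comp_sub_mul (a := 0) (b := 1)
        (f := fun s => g s t * Real.log |s - t|) t t
      rw [mul_zero, mul_one, sub_self, sub_zero] at this
      rw [← this, ← intervalIntegral.integral_const_mul]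
      refine intervalIntegral.integral_congr fun x _ => ?_
      have e1 : t - t * x - t = -(x * t) := by ring
      have e2 : t - t * x = (1 - x) * t := by ring
      simp only [Real.log_abs]
      rw [e1, e2, Real.log_neg_eq_log]; ring
    · have := intervalIntegral.mul_integral_comp_add_mul (a := 0) (b := 1)
        (f := fun s => g s t * Real.log |s - t|) (1 - t) t
      rw [mul_zero, mul_one, add_zero, add_sub_cancel] at this
      rw [← this, ← intervalIntegral.integral_const_mul]
      refine intervalIntegral.integral_congr fun x _ => ?_
      have e1 : t + (1 - t) * x - t = x * (1 - t) := by ring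
      have e2 : t + (1 - t) * x = 1 - (1 - x) * (1 - t) := by ring
      simp only [Real.log_abs]
      rw [e1, e2, sub_sub_cancel]; ring
  have hae : ∫ t in (0 : ℝ)..1, ∫ s in (0 : ℝ)..1, g s t * Real.log |s - t| =
      ∫ t in (0 : ℝ)..1,
        ((-(∑ ν, R'.weight ν * (t * g ((1 - R'.node ν) * t) t)) +
          (∑ ν, R.weight ν * (t * g ((1 - R.node ν) * t) t)) * Real.log t) +
        (-(∑ ν, R'.weight ν * ((1 - t) * g (1 - (1 - R'.node ν) * (1 - t)) (1 - (1 - t)))) +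
          (∑ ν, R.weight ν * ((1 - t) * g (1 - (1 - R.node ν) * (1 - t)) (1 - (1 - t)))) *
            Real.log (1 - t))) := by
    rw [intervalIntegral.integral_of_le zero_le_one, intervalIntegral.integral_of_le zero_le_one,
      integral_Ioc_eq_integral_Ioo, integral_Ioc_eq_integral_Ioo]
    refine setIntegral_congr_fun measurableSet_Ioo fun t ht => ?_
    rw [hin t ht, integral_mul_log_mul R R' h1 hm ht.1.ne',
      integral_mul_log_mul R R' h2 hm (y := 1 - t) (by linarith [ht.2])]
  rw [hae, intervalIntegral.integral_add (intervalIntegrable_log_triangle R R' h1 _ _)]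
  rotate_left
  · have := (intervalIntegrable_log_triangle R R' h2 1 0).comp_sub_left 1
    simpa using this
  rw [intervalIntegral.integral_comp_sub_left (a := 0) (b := 1) (fun t =>
    -(∑ ν, R'.weight ν * (t * g (1 - (1 - R'.node ν) * t) (1 - t))) +
          (∑ ν, R.weight ν * (t * g (1 - (1 - R.node ν) * t) (1 - t))) *
            Real.log t) 1, sub_self, sub_zero, integral_log_triangle R R' h1 hn,
    integral_log_triangle R R' h2 hn]
  simp only [quadLogTensor, mul_add, Finset.sum_add_distrib]
  have e : ∀ a b c d a' b' c' d' : ℝ, a = a' → b = b' → c = c' → d = d' →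
      0 - (a + b) - (c + d) = -a' - c' + (-b' - d') := by
    rintro _ _ _ _ _ _ _ _ rfl rfl rfl rfl; ring
  apply e <;>
    exact Finset.sum_congr rfl fun _ _ => Finset.sum_congr rfl fun _ _ => by ring

end

section
variable {T : ℝ} {N : ℕ} {t : Fin (N + 1) → ℝ} {m n : ℕ} {o : ℕ × ℕ}

theorem logExact_splitTerms (LR : ∀ K, LegendreRule K) (JR : ∀ K, LogRule K) (c : ℝ)
    {P : ℝ → ℝ → ℝ} (r : ℝ → ℝ) (hP : SepPoly m n P) (h1 : m + 1 ≤ 2 * o.1) (h2 : n + 1 ≤ 2 * o.2) :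
    ∀ τ ∈ splitTerms c P r, τ.LogExact LR JR o := by
  simp only [splitTerms, List.forall_mem_cons, List.not_mem_nil, false_imp_iff, implies_true,
    and_true]
  exact ⟨quadMixed_exact LR JR hP h1 h2, trivial⟩

theorem logExact_log (LR : ∀ K, LegendreRule K) (JR : ∀ K, LogRule K) (c : ℝ) {f : ℝ → ℝ}
    (p : ℝ[X]) (hf : ∀ x, f x = p.eval x) (hp : p.natDegree + 1 ≤ 2 * o.1) :
    (QTerm.log c f).LogExact LR JR o := by
  obtain rfl : f = fun x => p.eval x := funext hf
  exact ((JR o.1).integral_mul_log p hp).symm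

variable {a q : ℝ[X]} (ha : a.natDegree ≤ m) (hq : q.natDegree ≤ n) (hn : 1 ≤ n)
  (ho1 : n + m + 1 ≤ 2 * o.1) (ho2 : n + m + 1 ≤ 2 * o.2)

include ha hq hn ho1 in
theorem logExact_logTensor (LR : ∀ K, LegendreRule K) (JR : ∀ K, LogRule K) (c : ℝ) :
    (QTerm.logTensor c fun ξ η => a.eval η * q.derivative.eval ξ).LogExact LR JR o := by
  have hb : q.derivative.natDegree ≤ n - 1 := (natDegree_derivative_le q).trans (by omega)
  have hy : SepPoly 0 1 fun _ y : ℝ => y := SepPoly.linear_snd 0 1 (by intros; ring)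
  refine quadLogTensor_exact LR JR (m := n - 1) (n := n + m) ?_ ?_ ?_ (by omega) (by omega)
  · exact (a.continuous.comp continuous_snd).mul (q.derivative.continuous.comp continuous_fst)
  · exact (hy.mul ((SepPoly.eval_comp a ha hy).mul (SepPoly.eval_comp _ hb
      (SepPoly.bilinear 0 0 1 (-1) (by intros; ring))))).mono (by omega) (by omega)
  · exact (hy.mul ((SepPoly.eval_comp a ha (SepPoly.linear_snd 1 (-1) (by intros; ring))).mul
      (SepPoly.eval_comp _ hb
      (SepPoly.bilinear 1 0 (-1) 1 (by intros; ring))))).mono (by omega) (by omega)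

include ha hq hn ho1 ho2

theorem logExact_singTerms (LR : ∀ K, LegendreRule K) (JR : ∀ K, LogRule K) (k ℓ : Fin N) :
    ∀ τ ∈ singTerms t k ℓ a q, τ.LogExact LR JR o := by
  have hb : q.derivative.natDegree ≤ n - 1 := (natDegree_derivative_le q).trans (by omega)
  have hy : SepPoly 0 1 fun _ y : ℝ => y := SepPoly.linear_snd 0 1 (by intros; ring)
  unfold singTerms
  split_ifs with h1 h2 h3 h4 h5
  · simp only [List.forall_mem_append, List.forall_mem_cons, List.not_mem_nil, false_imp_iff,
      implies_true, and_true]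
    refine ⟨⟨⟨trivial, logExact_logTensor ha hq hn ho1 LR JR _, trivial⟩,
      logExact_splitTerms (m := n + m) (n := n + m) LR JR _ _ ?_ ho1 ho2⟩,
      logExact_splitTerms (m := n + m) (n := n + m) LR JR _ _ ?_ ho1 ho2⟩
    · exact (((SepPoly.eval_comp a ha hy).mul hy).mul
        (SepPoly.eval_comp _ hb (SepPoly.bilinear 0 0 0 1 (by intros; ring)))).mono
        (by omega) (by omega)
    · exact (((SepPoly.eval_comp a ha (SepPoly.bilinear 0 0 0 1 (by intros; ring))).mul hy).mul
        (SepPoly.eval_comp _ hb hy)).mono (by omega) (by omega)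
  · simp only [List.forall_mem_append, List.forall_mem_cons, List.not_mem_nil, false_imp_iff,
      implies_true, and_true]
    refine ⟨⟨logExact_logTensor ha hq hn ho1 LR JR _,
      logExact_splitTerms (m := n + m) (n := n + m) LR JR _ _ ?_ ho1 ho2⟩,
      logExact_splitTerms (m := n + m) (n := n + m) LR JR _ _ ?_ ho1 ho2⟩
    · exact (((SepPoly.eval_comp a ha (SepPoly.linear_snd 1 (-1) (by intros; ring))).mul
        (SepPoly.eval_comp _ hb (SepPoly.bilinear 1 0 0 (-1) (by intros; ring)))).mul hy).mono
        (by omega) (by omega)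
    · exact (((SepPoly.eval_comp a ha (SepPoly.bilinear 1 0 0 (-1) (by intros; ring))).mul
        (SepPoly.eval_comp _ hb (SepPoly.linear_snd 1 (-1) (by intros; ring)))).mul hy).mono
        (by omega) (by omega)
  · simp only [List.forall_mem_cons, List.not_mem_nil, false_imp_iff,
      implies_true, and_true]
    exact ⟨trivial, logExact_logTensor ha hq hn ho1 LR JR _⟩
  · simp only [List.forall_mem_append]
    refine ⟨logExact_splitTerms (m := n + m) (n := n + m) LR JR _ _ ?_ ho1 ho2,
      logExact_splitTerms (m := n + m) (n := n + m) LR JR _ _ ?_ ho1 ho2⟩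
    · exact (((SepPoly.eval_comp a ha (SepPoly.linear_snd 1 (-1) (by intros; ring))).mul
        (SepPoly.eval_comp _ hb (SepPoly.bilinear 0 0 0 1 (by intros; ring)))).mul hy).mono
        (by omega) (by omega)
    · exact (((SepPoly.eval_comp a ha (SepPoly.bilinear 1 0 (-1) 1 (by intros; ring))).mul
        (SepPoly.eval_comp _ hb hy)).mul hy).mono (by omega) (by omega)
  · simp only [List.forall_mem_append]
    refine ⟨logExact_splitTerms (m := n + m) (n := n + m) LR JR _ _ ?_ ho1 ho2,
      logExact_splitTerms (m := n + m) (n := n + m) LR JR _ _ ?_ ho1 ho2⟩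
    · exact (((SepPoly.eval_comp a ha (SepPoly.bilinear 0 0 1 (-1) (by intros; ring))).mul
        (SepPoly.eval_comp _ hb (SepPoly.linear_snd 1 (-1) (by intros; ring)))).mul hy).mono
        (by omega) (by omega)
    · exact (((SepPoly.eval_comp a ha hy).mul
        (SepPoly.eval_comp _ hb (SepPoly.bilinear 1 0 (-1) 1 (by intros; ring)))).mul hy).mono
        (by omega) (by omega)
  · simp only [List.forall_mem_cons, List.not_mem_nil, false_imp_iff,
      implies_true, and_true]
    exact trivial

theorem logExact_kernTerms (LR : ∀ K, LegendreRule K) (JR : ∀ K, LogRule K) (k ℓ : Fin N) :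
    ∀ τ ∈ kernTerms T t k ℓ a q, τ.LogExact LR JR o := by
  simp only [kernTerms, List.forall_mem_append, List.forall_mem_cons, List.not_mem_nil,
    false_imp_iff, implies_true, and_true]
  exact ⟨⟨trivial, trivial⟩, logExact_singTerms ha hq hn ho1 ho2 LR JR k ℓ⟩

omit hq hn ho2 in
theorem logExact_initTerms (LR : ∀ K, LegendreRule K) (JR : ∀ K, LogRule K) (k ℓ : Fin N) :
    ∀ τ ∈ initTerms T t k ℓ a q, τ.LogExact LR JR o := by
  unfold initTerms
  split_ifs with h1 h2
  · simp only [List.forall_mem_cons, List.not_mem_nil, false_imp_iff, implies_true, and_true]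
    exact ⟨trivial, logExact_log LR JR _ a (fun _ => rfl) (by omega), trivial⟩
  · simp only [List.forall_mem_cons, List.not_mem_nil, false_imp_iff, implies_true, and_true]
    trivial
  · simp

omit hq hn ho2 in
theorem logExact_J0Terms (LR : ∀ K, LegendreRule K) (JR : ∀ K, LogRule K) (k ℓ : Fin N) (c : ℝ) :
    ∀ τ ∈ J0Terms T t k ℓ c a, τ.LogExact LR JR o := by
  have hd : a.derivative.natDegree ≤ m := (natDegree_derivative_le a).trans (by omega)
  have hd' : (a.derivative.comp (1 - X)).natDegree ≤ m := by
    refine natDegree_comp_le.trans ((Nat.mul_le_mul hd ?_).trans (mul_one m).le)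
    compute_degree
  unfold J0Terms
  simp only [List.forall_mem_append, List.forall_mem_cons, List.not_mem_nil, false_imp_iff,
    implies_true, and_true]
  refine ⟨trivial, ?_⟩
  split_ifs <;>
    simp only [List.forall_mem_cons, List.not_mem_nil, false_imp_iff, implies_true, and_true]
  · exact ⟨logExact_log LR JR _ a.derivative (fun _ => rfl) (by omega), trivial⟩
  · exact ⟨logExact_log LR JR _ a.derivative (fun _ => rfl) (by omega), trivial⟩
  · exact ⟨trivial, logExact_log LR JR _ a.derivative (fun _ => rfl) (by omega)⟩
  · exact ⟨trivial, logExact_log LR JR _ (a.derivative.comp (1 - X)) (fun _ => by simp) (by omega)⟩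
  · trivial
  · trivial

omit hq hn ho2 in
theorem logExact_J1Terms (LR : ∀ K, LegendreRule K) (JR : ∀ K, LogRule K) (k ℓ : Fin N) (c : ℝ) :
    ∀ τ ∈ J1Terms T t k ℓ c a, τ.LogExact LR JR o := by
  have hd : a.derivative.natDegree ≤ m := (natDegree_derivative_le a).trans (by omega)
  have hd' : (a.derivative.comp (1 - X)).natDegree ≤ m := by
    refine natDegree_comp_le.trans ((Nat.mul_le_mul hd ?_).trans (mul_one m).le)
    compute_degree
  unfold J1Terms
  by_cases hlast : BothLast k ℓ
  · simp [hlast]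
  simp only [if_neg hlast, List.forall_mem_append, List.forall_mem_cons, List.not_mem_nil,
    false_imp_iff, implies_true, and_true]
  refine ⟨trivial, ?_⟩
  split_ifs <;>
    simp only [List.forall_mem_cons, List.not_mem_nil, false_imp_iff, implies_true, and_true]
  · exact ⟨trivial, logExact_log LR JR _ (a.derivative.comp (1 - X)) (fun _ => by simp) (by omega),
      trivial⟩
  · exact ⟨trivial, logExact_log LR JR _ (a.derivative.comp (1 - X)) (fun _ => by simp) (by omega)⟩
  · trivial
  · exact ⟨trivial, logExact_log LR JR _ a.derivative (fun _ => rfl) (by omega)⟩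
  · trivial

theorem logExact_scheme (LR : ∀ K, LegendreRule K) (JR : ∀ K, LogRule K) (k ℓ : Fin N) (X : Kind) :
    ∀ τ ∈ scheme T t k ℓ q a X, τ.LogExact LR JR o := by
  have hC : ∀ (c : ℝ) (p : ℝ[X]), (C c * derivative p).natDegree ≤ p.natDegree := fun c p =>
    (natDegree_C_mul_le _ _).trans ((natDegree_derivative_le p).trans (Nat.sub_le _ _))
  cases X <;> simp only [scheme, List.forall_mem_append]
  · exact ⟨logExact_initTerms ha ho1 LR JR k ℓ, logExact_kernTerms ha hq hn ho1 ho2 LR JR k ℓ⟩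
  · exact ⟨logExact_initTerms ((hC _ _).trans ha) ho1 LR JR k ℓ,
      logExact_kernTerms ((hC _ _).trans ha) hq hn ho1 ho2 LR JR k ℓ⟩
  · exact ⟨⟨logExact_J0Terms ha ho1 LR JR k ℓ _, logExact_J1Terms ha ho1 LR JR k ℓ _⟩,
      logExact_kernTerms ((hC _ _).trans ha) ((hC _ _).trans hq) hn ho1 ho2 LR JR k ℓ⟩

end

/-! ### Integrals over the unit square -/

/-- The iterated integral over the unit square, with the first variable as the inner one. -/
noncomputable def sqInt (G : ℝ → ℝ → ℝ) : ℝ := ∫ y in (0 : ℝ)..1, ∫ x in (0 : ℝ)..1, G x y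

/-- Lebesgue measure on the unit interval. -/
noncomputable abbrev unitVol : Measure ℝ := volume.restrict (Ioc (0 : ℝ) 1)

/-- Integrability over the unit square. -/
def SqIntegrable (G : ℝ → ℝ → ℝ) : Prop := Integrable (Function.uncurry G) (unitVol.prod unitVol)

section
variable {G G' : ℝ → ℝ → ℝ}

theorem SqIntegrable.sqInt_eq (hG : SqIntegrable G) :
    sqInt G = ∫ z, Function.uncurry G z ∂(unitVol.prod unitVol) := by
  simp only [sqInt, intervalIntegral.integral_of_le zero_le_one]
  exact (integral_prod_symm _ hG).symm

theorem SqIntegrable.sqInt_swap (hG : SqIntegrable G) : sqInt G = sqInt fun x y => G y x := by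
  rw [hG.sqInt_eq, integral_prod _ hG]
  simp only [sqInt, intervalIntegral.integral_of_le zero_le_one]
  rfl

theorem SqIntegrable.sqInt_add (hG : SqIntegrable G) (hG' : SqIntegrable G') :
    sqInt (fun x y => G x y + G' x y) = sqInt G + sqInt G' := by
  have : SqIntegrable fun x y => G x y + G' x y := hG.add hG'
  rw [this.sqInt_eq, hG.sqInt_eq, hG'.sqInt_eq, ← integral_add hG hG']
  rfl

theorem sqInt_const_mul (c : ℝ) (G : ℝ → ℝ → ℝ) :
    sqInt (fun x y => c * G x y) = c * sqInt G := by
  simp [sqInt, intervalIntegral.integral_const_mul]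

theorem sqInt_congr_ae (h : ∀ y ∈ Ioo (0 : ℝ) 1, ∀ᵐ x, x ∈ Ioo (0 : ℝ) 1 → G x y = G' x y) :
    sqInt G = sqInt G' := by
  simp only [sqInt, intervalIntegral.integral_of_le zero_le_one, integral_Ioc_eq_integral_Ioo]
  exact setIntegral_congr_fun measurableSet_Ioo fun y hy =>
    setIntegral_congr_ae measurableSet_Ioo (h y hy)

theorem sqInt_congr (h : ∀ x ∈ Ioo (0 : ℝ) 1, ∀ y ∈ Ioo (0 : ℝ) 1, G x y = G' x y) :
    sqInt G = sqInt G' :=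
  sqInt_congr_ae fun y hy => Eventually.of_forall fun x hx => h x hx y hy

theorem ae_ne_unitVol : ∀ᵐ z ∂(unitVol.prod unitVol), z.1 ≠ z.2 := by
  rw [Measure.ae_prod_iff_ae_ae (by
    exact (measurableSet_eq_fun measurable_fst measurable_snd).compl)]
  exact Eventually.of_forall fun x => ae_restrict_of_ae (by
    filter_upwards [compl_mem_ae_iff.2 (measure_singleton (μ := volume) x)] with y hy
    exact fun e => hy e.symm)

/-- The diagonal does not matter for integrals over the square. -/
theorem SqIntegrable.congr_of_ne (hG : SqIntegrable G')
    (h : ∀ x ∈ Ioc (0 : ℝ) 1, ∀ y ∈ Ioc (0 : ℝ) 1, x ≠ y → G x y = G' x y) :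
    SqIntegrable G ∧ sqInt G = sqInt G' := by
  constructor
  · refine Integrable.congr hG ?_
    have : ∀ᵐ z ∂(unitVol.prod unitVol), z ∈ Ioc (0 : ℝ) 1 ×ˢ Ioc (0 : ℝ) 1 := by
      rw [Measure.prod_restrict]
      exact ae_restrict_mem (measurableSet_Ioc.prod measurableSet_Ioc)
    filter_upwards [this, ae_ne_unitVol] with z hz hne
    exact (h _ hz.1 _ hz.2 hne).symm
  · refine sqInt_congr_ae fun y hy => ?_
    filter_upwards [compl_mem_ae_iff.2 (measure_singleton (μ := volume) y)] with x hx hx'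
    exact h x (Ioo_subset_Ioc_self hx') y (Ioo_subset_Ioc_self hy) hx

theorem measurePreserving_one_sub : MeasurePreserving (fun x : ℝ => 1 - x) unitVol unitVol := by
  have := (Measure.measurePreserving_sub_left volume (1 : ℝ)).restrict_preimage
    (measurableSet_Ioc (a := (0 : ℝ)) (b := 1))
  have e : (fun x : ℝ => 1 - x) ⁻¹' Ioc 0 1 = Ico 0 1 := by
    ext x; simp only [mem_preimage, mem_Ioc, mem_Ico]; constructor <;> intro h <;>
      constructor <;> linarith [h.1, h.2]
  rw [e, restrict_Ico_eq_restrict_Ioc] at this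
  exact this

theorem SqIntegrable.flip_fst (hG : SqIntegrable G) : SqIntegrable fun x y => G (1 - x) y :=
  (measurePreserving_one_sub.prod (MeasurePreserving.id unitVol)).integrable_comp_of_integrable hG

theorem SqIntegrable.flip_snd (hG : SqIntegrable G) : SqIntegrable fun x y => G x (1 - y) :=
  ((MeasurePreserving.id unitVol).prod measurePreserving_one_sub).integrable_comp_of_integrable hG

theorem SqIntegrable.add (hG : SqIntegrable G) (hG' : SqIntegrable G') :
    SqIntegrable fun x y => G x y + G' x y := Integrable.add hG hG'

theorem SqIntegrable.const_mul (hG : SqIntegrable G) (c : ℝ) :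
    SqIntegrable fun x y => c * G x y := Integrable.const_mul hG c

theorem sqInt_flip_fst (G : ℝ → ℝ → ℝ) : sqInt G = sqInt fun x y => G (1 - x) y := by
  unfold sqInt
  congr 1; ext y
  rw [intervalIntegral.integral_comp_sub_left (fun x => G x y)]
  simp

theorem sqInt_flip_snd (G : ℝ → ℝ → ℝ) : sqInt G = sqInt fun x y => G x (1 - y) := by
  unfold sqInt
  rw [intervalIntegral.integral_comp_sub_left (fun y => ∫ x in (0 : ℝ)..1, G x y)]
  simp

theorem sqIntegrable_of_continuousOn
    (hG : ContinuousOn (Function.uncurry G) (Icc (0 : ℝ) 1 ×ˢ Icc (0 : ℝ) 1)) : SqIntegrable G :=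
  integrable_square hG

theorem SqIntegrable.continuousOn_mul (hG : SqIntegrable G)
    (hQ : ContinuousOn (Function.uncurry G') (Icc (0 : ℝ) 1 ×ˢ Icc (0 : ℝ) 1)) :
    SqIntegrable fun x y => G' x y * G x y := by
  obtain ⟨B, hB⟩ := (isCompact_Icc.prod isCompact_Icc).exists_bound_of_continuousOn hQ
  refine Integrable.bdd_mul (c := B) (f := Function.uncurry G') hG
    (integrable_square hQ).aestronglyMeasurable ?_
  rw [Measure.prod_restrict]
  exact ae_restrict_of_forall_mem (measurableSet_Ioc.prod measurableSet_Ioc) fun z hz =>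
    hB z ⟨Ioc_subset_Icc_self hz.1, Ioc_subset_Icc_self hz.2⟩

/-- The Duffy transformation: each of the triangles that the diagonal cuts from the unit square is
mapped to the unit square. -/
theorem SqIntegrable.sqInt_duffy (hG : SqIntegrable G) :
    sqInt G = sqInt (fun x y => y * G (x * y) y) + sqInt fun x y => y * G y (x * y) := by
  have hS : MeasurableSet {z : ℝ × ℝ | z.1 ≤ z.2} := measurableSet_le measurable_fst measurable_snd
  rw [hG.sqInt_eq, ← integral_add_compl hS hG]
  congr 1
  · rw [← integral_indicator hS, integral_prod_symm _ (hG.indicator hS), sqInt,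
      intervalIntegral.integral_of_le zero_le_one]
    refine setIntegral_congr_fun measurableSet_Ioc fun y hy => ?_
    have e : ∀ x, ({z : ℝ × ℝ | z.1 ≤ z.2}.indicator (Function.uncurry G)) (x, y) =
        (Iic y).indicator (fun x => G x y) x := fun x => by
      simp [indicator, Function.uncurry]
    simp_rw [e]
    rw [setIntegral_indicator measurableSet_Iic, Ioc_inter_Iic, min_eq_right hy.2,
      ← intervalIntegral.integral_of_le hy.1.le, intervalIntegral.integral_const_mul,
      intervalIntegral.mul_integral_comp_mul_right (f := fun x => G x y), zero_mul, one_mul]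
  · rw [← integral_indicator hS.compl, integral_prod _ (hG.indicator hS.compl), sqInt,
      intervalIntegral.integral_of_le zero_le_one]
    refine setIntegral_congr_fun measurableSet_Ioc fun y hy => ?_
    have e : ∀ x, ({z : ℝ × ℝ | z.1 ≤ z.2}ᶜ.indicator (Function.uncurry G)) (y, x) =
        (Iio y).indicator (fun x => G y x) x := fun x => by
      simp [indicator, Function.uncurry]
    simp_rw [e]
    have hI : Ioc (0 : ℝ) 1 ∩ Iio y = Ioo 0 y := by
      ext x; simp only [mem_inter_iff, mem_Ioc, mem_Iio, mem_Ioo]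
      exact ⟨fun h => ⟨h.1.1, h.2⟩, fun h => ⟨⟨h.1, h.2.le.trans hy.2⟩, h.2⟩⟩
    rw [setIntegral_indicator measurableSet_Iio, hI, ← integral_Ioc_eq_integral_Ioo,
      ← intervalIntegral.integral_of_le hy.1.le, intervalIntegral.integral_const_mul,
      intervalIntegral.mul_integral_comp_mul_right (f := fun x => G y x), zero_mul, one_mul]

/-! ### Logarithmic integrals over the unit square -/

theorem integrable_log_mul (c : ℝ) : Integrable (fun x => Real.log (c * x)) unitVol := by
  rcases eq_or_ne c 0 with rfl | hc
  · simp
  have : Integrable (fun x => Real.log c + Real.log x) unitVol :=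
    (integrable_const _).add ((intervalIntegrable_iff_integrableOn_Ioc_of_le zero_le_one).1
      intervalIntegral.intervalIntegrable_log')
  refine this.congr ?_
  filter_upwards [ae_restrict_mem measurableSet_Ioc] with x hx
  rw [Real.log_mul hc hx.1.ne']

theorem sqIntegrable_log_snd : SqIntegrable fun _ y => Real.log y := by
  have := (integrable_const (1 : ℝ) (μ := unitVol)).mul_prod (integrable_log_mul 1)
  simpa [SqIntegrable, Function.uncurry_def] using this

theorem sqIntegrable_log_add {α β : ℝ} (hα : 0 < α) (hβ : 0 < β) :
    SqIntegrable fun x y => Real.log (α * x + β * y) := by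
  have hb : Integrable (fun z : ℝ × ℝ => (|Real.log (α * z.1)| + |Real.log (α + β)|) * 1)
      (unitVol.prod unitVol) :=
    ((integrable_log_mul α).abs.add (integrable_const _)).mul_prod (integrable_const 1)
  refine hb.mono' (by
    apply Measurable.aestronglyMeasurable
    simp only [Function.uncurry_def]; fun_prop) ?_
  rw [Measure.prod_restrict]
  refine ae_restrict_of_forall_mem (measurableSet_Ioc.prod measurableSet_Ioc) fun z hz => ?_
  obtain ⟨⟨h1, h2⟩, h3, h4⟩ := hz
  have l : α * z.1 ≤ α * z.1 + β * z.2 := by nlinarith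
  have u : α * z.1 + β * z.2 ≤ α + β := by nlinarith
  have p : 0 < α * z.1 := by positivity
  have := Real.log_le_log p l
  have := Real.log_le_log (p.trans_le l) u
  simp only [Function.uncurry_def, Real.norm_eq_abs, mul_one]
  rw [abs_le]
  constructor
  · linarith [neg_abs_le (Real.log (α * z.1)), abs_nonneg (Real.log (α + β))]
  · linarith [le_abs_self (Real.log (α + β)), abs_nonneg (Real.log (α * z.1))]

/-- A function of the difference of the variables is the integrand of a convolution. -/
theorem integrable_comp_sub {f : ℝ → ℝ} {a b c d : ℝ} (hf : ∀ u v, IntervalIntegrable f volume u v) :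
    Integrable (fun z : ℝ × ℝ => f (z.1 - z.2))
      ((volume.restrict (Ioc a b)).prod (volume.restrict (Ioc c d))) := by
  have h1 : Integrable ((Ioc c d).indicator fun _ => (1 : ℝ)) :=
    (integrable_indicator_iff measurableSet_Ioc).2 (integrableOn_const (by simp))
  have h2 : Integrable ((Ioc (a - d) (b - c)).indicator f) := by
    rw [integrable_indicator_iff measurableSet_Ioc]
    exact (hf (a - d) (b - c)).1
  have := h1.convolution_integrand (ContinuousLinearMap.mul ℝ ℝ) h2
  rw [Measure.prod_restrict]
  refine (this.integrableOn (s := Ioc a b ×ˢ Ioc c d)).congr_fun (fun z hz => ?_)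
    (measurableSet_Ioc.prod measurableSet_Ioc)
  obtain ⟨⟨h1, h2⟩, h3, h4⟩ := hz
  have e : z.1 - z.2 ∈ Ioc (a - d) (b - c) := ⟨by linarith, by linarith⟩
  simp [indicator_of_mem e, indicator_of_mem (show z.2 ∈ Ioc c d from ⟨h3, h4⟩)]

theorem sqIntegrable_log_abs_sub : SqIntegrable fun x y => Real.log |x - y| := by
  simp_rw [Real.log_abs]
  exact integrable_comp_sub fun u v => intervalIntegral.intervalIntegrable_log'

/-- On the transformed triangles, `ln (α x + β y)` splits into `ln y` and a smooth function. -/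
theorem sqInt_mul_log_add {Q : ℝ → ℝ → ℝ} (hQ : Continuous (Function.uncurry Q)) {α β : ℝ}
    (hα : 0 < α) (hβ : 0 < β) :
    sqInt (fun x y => Q x y * Real.log (α * x + β * y)) =
      (sqInt (fun x y => Q (x * y) y * y * Real.log y) +
        sqInt (fun x y => Q (x * y) y * y * Real.log (x * α + β))) +
      (sqInt (fun x y => Q y (x * y) * y * Real.log y) +
        sqInt (fun x y => Q y (x * y) * y * Real.log (x * β + α))) := by
  have c1 : Continuous (Function.uncurry fun x y => Q (x * y) y * y) :=
    (hQ.comp (by fun_prop : Continuous fun z : ℝ × ℝ => (z.1 * z.2, z.2))).mul continuous_snd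
  have c2 : Continuous (Function.uncurry fun x y => Q y (x * y) * y) :=
    (hQ.comp (by fun_prop : Continuous fun z : ℝ × ℝ => (z.2, z.1 * z.2))).mul continuous_snd
  have l : ∀ {u v : ℝ}, 0 < u → 0 < v → ContinuousOn
      (Function.uncurry fun x _ => Real.log (x * u + v)) (Icc (0 : ℝ) 1 ×ˢ Icc (0 : ℝ) 1) := by
    intro u v hu hv
    refine ContinuousOn.log (by fun_prop) fun z hz => ?_
    have := hz.1.1
    positivity
  rw [((sqIntegrable_log_add hα hβ).continuousOn_mul hQ.continuousOn).sqInt_duffy]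
  congr 1
  · rw [← SqIntegrable.sqInt_add (sqIntegrable_log_snd.continuousOn_mul c1.continuousOn)
      (sqIntegrable_of_continuousOn
        (G := fun x y => Q (x * y) y * y * Real.log (x * α + β)) (c1.continuousOn.mul (l hα hβ)))]
    refine sqInt_congr fun x hx y hy => ?_
    have e : α * (x * y) + β * y = y * (x * α + β) := by ring
    have := hx.1
    rw [e, Real.log_mul hy.1.ne' (by positivity)]; ring
  · rw [← SqIntegrable.sqInt_add (sqIntegrable_log_snd.continuousOn_mul c2.continuousOn)
      (sqIntegrable_of_continuousOn
        (G := fun x y => Q y (x * y) * y * Real.log (x * β + α)) (c2.continuousOn.mul (l hβ hα)))]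
    refine sqInt_congr fun x hx y hy => ?_
    have e : α * y + β * (x * y) = y * (x * β + α) := by ring
    have := hx.1
    rw [e, Real.log_mul hy.1.ne' (by positivity)]; ring

end

/-! ### Exact values of the summands -/

/-- The value of a summand of a quadrature scheme with exact integrals. -/
noncomputable def QTerm.exactValue : QTerm → ℝ
  | .const c => c
  | .leg c f => c * ∫ x in (0 : ℝ)..1, f x
  | .tensor c G => c * sqInt G
  | .log c f => c * ∫ x in (0 : ℝ)..1, f x * Real.log x
  | .mixed c G => c * sqInt fun x y => G x y * Real.log y
  | .logTensor c g => c * sqInt fun s t => g s t * Real.log |s - t|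

/-- The value of a list of summands with exact integrals. -/
noncomputable def exactSum (l : List QTerm) : ℝ := (l.map QTerm.exactValue).sum

theorem exactSum_append (l l' : List QTerm) : exactSum (l ++ l') = exactSum l + exactSum l' := by
  simp [exactSum]

theorem exactSum_cons (τ : QTerm) (l : List QTerm) :
    exactSum (τ :: l) = τ.exactValue + exactSum l := by
  simp [exactSum]

theorem exactSum_nil : exactSum [] = 0 := rfl

theorem exactSum_splitTerms (c : ℝ) (P : ℝ → ℝ → ℝ) (r : ℝ → ℝ) :
    exactSum (splitTerms c P r) =
      c * (sqInt (fun x y => P x y * Real.log y) + sqInt fun x y => P x y * r x) := by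
  simp [splitTerms, exactSum_cons, exactSum_nil, QTerm.exactValue, mul_add]

section
variable {T : ℝ} {N : ℕ} {t : Fin (N + 1) → ℝ}

open Classical in
/-- The singular part of `ln[tan(π(s+x)/(4T)) tan(π|x-s|/(4T))]`, the counterpart of `regF`. -/
noncomputable def singF (T : ℝ) {N : ℕ} (k ℓ : Fin N) (s x : ℝ) : ℝ :=
  Real.log |s - x| + if BothFirst k ℓ then Real.log (s + x)
    else if BothLast k ℓ then -Real.log (2 * T - s - x) else 0

/-- The singular part is the logarithm of the linear factors that `regF` divides by. -/
theorem log_tan_mul_tan (h : IsMesh T t) {k ℓ : Fin N} {s x : ℝ} (hs : s ∈ Icc (lft t k) (rgt t k))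
    (hsx : s ≠ x) (h0 : 0 < s + x) (h2 : s + x < 2 * T) :
    Real.log (Real.tan (Real.pi * (s + x) / (4 * T)) * Real.tan (Real.pi * |x - s| / (4 * T))) =
      regF T k ℓ s x + singF T k ℓ s x := by
  have hT := h.pos
  have hk0 := h.lft_nonneg k
  have hkT := h.rgt_le k
  have hd : x - s ≠ 0 := sub_ne_zero.2 hsx.symm
  have hdb : |x - s| < 2 * T := by
    rw [abs_lt]; constructor <;> linarith [hs.1, hs.2]
  have hq := tanQuot_pos hT hdb
  have hq' : 0 < tanQuot T |x - s| := by rwa [tanQuot_abs]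
  have hp : 0 < tanQuot T (s + x) := tanQuot_pos hT (by rwa [abs_of_pos h0])
  have hp' : 0 < tanQuot T (2 * T - (s + x)) := tanQuot_pos hT (by
    rw [abs_of_pos (by linarith)]; linarith)
  have hlogabs : Real.log |x - s| = Real.log |s - x| := by rw [abs_sub_comm]
  have habs : |x - s| ≠ 0 := abs_ne_zero.2 hd
  have e1 := tan_eq_tanQuot_mul (T := T) h0.ne'
  have e2 := tan_eq_tanQuot_mul (T := T) habs
  unfold regF singF
  split_ifs with hf hl
  · rw [e1, e2, Real.log_mul (by positivity) (by positivity), Real.log_mul (by positivity) h0.ne',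
      Real.log_mul hq'.ne' habs, Real.log_mul (by positivity) (by positivity), hlogabs]
    ring
  · have e3 : Real.tan (Real.pi * (s + x) / (4 * T)) = tanProd T (s + x) * (2 * T - s - x)⁻¹ := by
      rw [tanProd, if_neg h2.ne, ← sub_sub, mul_assoc, mul_inv_cancel₀ (by linarith), mul_one]
    have h3 : 0 < tanProd T (s + x) := by rw [tanProd_eq hT]; positivity
    have h4 : 0 < 2 * T - s - x := by linarith
    rw [e3, e2, Real.log_mul (by positivity) (by positivity), Real.log_mul (by positivity)
      (by positivity), Real.log_mul hq'.ne' habs, Real.log_mul (by positivity) (by positivity),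
      Real.log_inv, hlogabs]
    ring
  · have h3 : 0 < Real.tan (Real.pi * (s + x) / (4 * T)) := by rw [e1]; positivity
    rw [e2, ← mul_assoc, Real.log_mul (by positivity) habs, hlogabs, add_zero]

theorem add_mem_of_mem_Ioo (h : IsMesh T t) {k ℓ : Fin N} {s : ℝ} (hs : s ∈ Icc (lft t k) (rgt t k))
    {η : ℝ} (hη : η ∈ Ioo (0 : ℝ) 1) :
    0 < s + (lft t ℓ + η * msize t ℓ) ∧ s + (lft t ℓ + η * msize t ℓ) < 2 * T := by
  have hl := h.msize_pos ℓ
  have h1 : lft t ℓ + msize t ℓ = rgt t ℓ := IsMesh.lft_add_msize ℓ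
  have := h.lft_nonneg k
  have := h.lft_nonneg ℓ
  have := h.rgt_le k
  have := h.rgt_le ℓ
  constructor
  · have := mul_pos hη.1 hl; linarith [hs.1]
  · have := mul_lt_mul_of_pos_right hη.2 hl; linarith [hs.2]

theorem exactSum_splitTerms_flip (c : ℝ) (P : ℝ → ℝ → ℝ) (r : ℝ → ℝ) :
    exactSum (splitTerms c P r) =
      exactSum (splitTerms c (fun x y => P (1 - x) y) fun x => r (1 - x)) := by
  rw [exactSum_splitTerms, exactSum_splitTerms,
    sqInt_flip_fst fun x y => P x y * Real.log y, sqInt_flip_fst fun x y => P x y * r x]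

/-- The terms that the Duffy transformation makes of an integral with `ln (α x + β y)`. -/
theorem exactSum_splitTerms_pair (c : ℝ) {Q P₁ P₂ : ℝ → ℝ → ℝ} {r₁ r₂ : ℝ → ℝ}
    (hQ : Continuous (Function.uncurry Q)) {α β : ℝ} (hα : 0 < α) (hβ : 0 < β)
    (h₁ : ∀ x y, P₁ x y = Q (x * y) y * y) (h₁' : ∀ x, r₁ x = Real.log (x * α + β))
    (h₂ : ∀ x y, P₂ x y = Q y (x * y) * y) (h₂' : ∀ x, r₂ x = Real.log (x * β + α)) :
    exactSum (splitTerms c P₁ r₁) + exactSum (splitTerms c P₂ r₂) =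
      c * sqInt fun x y => Q x y * Real.log (α * x + β * y) := by
  obtain rfl : P₁ = _ := funext fun x => funext (h₁ x)
  obtain rfl : P₂ = _ := funext fun x => funext (h₂ x)
  obtain rfl : r₁ = _ := funext h₁'
  obtain rfl : r₂ = _ := funext h₂'
  rw [exactSum_splitTerms, exactSum_splitTerms, sqInt_mul_log_add hQ hα hβ]
  ring

theorem sqInt_poly_mul_poly (a q : ℝ[X]) (c : ℝ) :
    sqInt (fun ξ η => a.eval η * q.derivative.eval ξ * c) =
      c * (q.eval 1 - q.eval 0) * ∫ η in (0 : ℝ)..1, a.eval η := by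
  have : ∫ ξ in (0 : ℝ)..1, q.derivative.eval ξ = q.eval 1 - q.eval 0 :=
    intervalIntegral.integral_eq_sub_of_hasDerivAt (fun x _ => q.hasDerivAt x)
      (q.derivative.continuous.intervalIntegrable _ _)
  simp only [sqInt, intervalIntegral.integral_mul_const, intervalIntegral.integral_const_mul, this]
  ring

theorem continuous_poly_mul_poly (a b : ℝ[X]) :
    Continuous (Function.uncurry fun ξ η => a.eval η * b.eval ξ) :=
  (a.continuous.comp continuous_snd).mul (b.continuous.comp continuous_fst)

theorem continuous_poly_mul_poly_flip (a b : ℝ[X]) :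
    (Continuous (Function.uncurry fun ξ η => a.eval (1 - η) * b.eval ξ)) ∧
    (Continuous (Function.uncurry fun ξ η => a.eval η * b.eval (1 - ξ))) ∧
    (Continuous (Function.uncurry fun ξ η => a.eval (1 - η) * b.eval (1 - ξ))) := by
  have ha := a.continuous
  have hb := b.continuous
  simp only [Function.uncurry_def]
  refine ⟨?_, ?_, ?_⟩ <;> fun_prop

/-- In local coordinates, the singular part has integrals over the square that are of the types in
the scheme. -/
theorem exactSum_singTerms (h : IsMesh T t) (k ℓ : Fin N) (a q : ℝ[X]) :
    SqIntegrable (fun ξ η => a.eval η * q.derivative.eval ξ *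
      singF T k ℓ (lft t k + ξ * msize t k) (lft t ℓ + η * msize t ℓ)) ∧
    exactSum (singTerms t k ℓ a q) = -(msize t ℓ / Real.pi) * sqInt fun ξ η =>
      a.eval η * q.derivative.eval ξ *
        singF T k ℓ (lft t k + ξ * msize t k) (lft t ℓ + η * msize t ℓ) := by
  have hk := h.msize_pos k
  have hl := h.msize_pos ℓ
  have hcab := continuous_poly_mul_poly a q.derivative
  obtain ⟨hc1, hc2, hc3⟩ := continuous_poly_mul_poly_flip a q.derivative
  -- off the diagonal, `singF` may be replaced by its form in reference coordinates
  have key : ∀ G' : ℝ → ℝ → ℝ, SqIntegrable (fun ξ η => a.eval η * q.derivative.eval ξ * G' ξ η) →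
      (∀ ξ ∈ Ioc (0 : ℝ) 1, ∀ η ∈ Ioc (0 : ℝ) 1, ξ ≠ η →
        singF T k ℓ (lft t k + ξ * msize t k) (lft t ℓ + η * msize t ℓ) = G' ξ η) →
      exactSum (singTerms t k ℓ a q) = -(msize t ℓ / Real.pi) * sqInt (fun ξ η =>
        a.eval η * q.derivative.eval ξ * G' ξ η) →
      SqIntegrable (fun ξ η => a.eval η * q.derivative.eval ξ *
        singF T k ℓ (lft t k + ξ * msize t k) (lft t ℓ + η * msize t ℓ)) ∧
      exactSum (singTerms t k ℓ a q) = -(msize t ℓ / Real.pi) * sqInt fun ξ η =>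
        a.eval η * q.derivative.eval ξ *
          singF T k ℓ (lft t k + ξ * msize t k) (lft t ℓ + η * msize t ℓ) := by
    intro G' hG' he hs
    have := hG'.congr_of_ne (G := fun ξ η => a.eval η * q.derivative.eval ξ *
      singF T k ℓ (lft t k + ξ * msize t k) (lft t ℓ + η * msize t ℓ))
      fun ξ hξ η hη hne => by rw [he ξ hξ η hη hne]
    exact ⟨this.1, hs.trans (by rw [this.2])⟩
  have iabs := sqIntegrable_log_abs_sub.continuousOn_mul hcab.continuousOn
  have iconst : ∀ c : ℝ, SqIntegrable fun ξ η => a.eval η * q.derivative.eval ξ * c := fun c =>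
    sqIntegrable_of_continuousOn (hcab.mul continuous_const).continuousOn
  have labs : (k : ℕ) = ℓ → ∀ ξ η, ξ ≠ η → Real.log |(lft t k + ξ * msize t k) -
      (lft t ℓ + η * msize t ℓ)| = Real.log (msize t ℓ) + Real.log |ξ - η| := by
    intro e ξ η hne
    obtain rfl : k = ℓ := Fin.ext e
    have : (lft t k + ξ * msize t k) - (lft t k + η * msize t k) = msize t k * (ξ - η) := by ring
    rw [this, Real.log_abs, Real.log_mul hk.ne' (sub_ne_zero.2 hne), Real.log_abs]
  by_cases hf : BothFirst k ℓ
  · have hkl : k = ℓ := Fin.ext (hf.1.trans hf.2.symm)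
    have ilog := (sqIntegrable_log_add one_pos one_pos).continuousOn_mul hcab.continuousOn
    refine key (fun ξ η => 2 * Real.log (msize t ℓ) + Real.log |ξ - η| +
      Real.log (1 * ξ + 1 * η)) ?_ ?_ ?_
    · simp only [mul_add (_ * _)]
      exact ((iconst _).add iabs).add ilog
    · intro ξ hξ η hη hne
      rw [singF, if_pos hf, labs (by rw [hkl]) ξ η hne, h.lft_eq_zero hf.1, h.lft_eq_zero hf.2, hkl]
      have e : (0 + ξ * msize t ℓ) + (0 + η * msize t ℓ) = msize t ℓ * (1 * ξ + 1 * η) := by ring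
      rw [e, Real.log_mul hl.ne' (by linarith [hξ.1, hη.1])]
      ring
    · have e := exactSum_splitTerms_pair (-(msize t ℓ / Real.pi)) hcab one_pos one_pos
        (P₁ := fun x y => a.eval y * y * q.derivative.eval (x * y))
        (P₂ := fun x y => a.eval (y * x) * y * q.derivative.eval y)
        (r₁ := fun x => Real.log (1 + x)) (r₂ := fun x => Real.log (1 + x))
        (by intros; ring) (by intros; ring_nf) (by intros; rw [mul_comm]; ring_nf)
        (by intros; ring_nf)
      simp only [mul_add (_ * _)]
      rw [((iconst _).add iabs).sqInt_add ilog, (iconst _).sqInt_add iabs, sqInt_poly_mul_poly]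
      simp only [singTerms, if_pos hf, exactSum_append, exactSum_cons, exactSum_nil,
        QTerm.exactValue]
      rw [add_assoc, e]
      ring
  by_cases hL : BothLast k ℓ
  · have hkl : k = ℓ := Fin.ext (by have := hL.1; have := hL.2; omega)
    have il : SqIntegrable fun ξ η => Real.log (1 * (1 - ξ) + 1 * (1 - η)) :=
      (sqIntegrable_log_add one_pos one_pos).flip_fst.flip_snd
    have ilog := il.continuousOn_mul hcab.continuousOn
    refine key (fun ξ η => Real.log |ξ - η| +
      -1 * Real.log (1 * (1 - ξ) + 1 * (1 - η))) ?_ ?_ ?_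
    · simp only [mul_add (_ * _), mul_left_comm _ (-1 : ℝ)]
      exact iabs.add (ilog.const_mul _)
    · intro ξ hξ η hη hne
      rw [singF, if_neg hf, if_pos hL, labs (by rw [hkl]) ξ η hne]
      have h1 : msize t ℓ + lft t ℓ = T := by rw [msize, h.rgt_eq hL.2]; ring
      have e : 2 * T - (lft t k + ξ * msize t k) - (lft t ℓ + η * msize t ℓ)
          = msize t ℓ * (1 * (1 - ξ) + 1 * (1 - η)) := by
        rw [hkl, ← h1]; ring
      have : (1 - ξ) + (1 - η) ≠ 0 := by
        intro h0
        apply hne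
        linarith [hξ.2, hη.2]
      rw [e, Real.log_mul hl.ne' (by simpa using this)]
      ring
    -- flips of both variables move the right end point to the origin
    · have e := exactSum_splitTerms_pair (-(-(msize t ℓ / Real.pi))) hc3 one_pos one_pos
        (P₁ := fun x y => a.eval (1 - y) * q.derivative.eval (1 - y * x) * y)
        (P₂ := fun x y => a.eval (1 - y * x) * q.derivative.eval (1 - y) * y)
        (r₁ := fun x => Real.log (1 + x)) (r₂ := fun x => Real.log (1 + x))
        (by intro x y; rw [mul_comm y x]) (by intros; ring_nf)
        (by intro x y; rw [mul_comm y x])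
        (by intros; ring_nf)
      have hflip : sqInt (fun ξ η => a.eval η * q.derivative.eval ξ *
            Real.log (1 * (1 - ξ) + 1 * (1 - η))) =
          sqInt (fun ξ η => a.eval (1 - η) * q.derivative.eval (1 - ξ) *
            Real.log (1 * ξ + 1 * η)) := by
        rw [sqInt_flip_fst, sqInt_flip_snd]
        simp only [sub_sub_cancel]
      simp only [mul_add (_ * _), mul_left_comm _ (-1 : ℝ)]
      rw [iabs.sqInt_add (ilog.const_mul _), sqInt_const_mul, hflip]
      simp only [singTerms, if_neg hf, if_pos hL, exactSum_append, exactSum_cons, exactSum_nil,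
        QTerm.exactValue]
      rw [add_assoc, e]
      ring
  have hsing : ∀ s x, singF T k ℓ s x = Real.log |s - x| := fun s x => by
    rw [singF, if_neg hf, if_neg hL, add_zero]
  by_cases hkl : (k : ℕ) = ℓ
  · refine key (fun ξ η => Real.log (msize t ℓ) + Real.log |ξ - η|) ?_ ?_ ?_
    · simp only [mul_add (_ * _)]
      exact (iconst _).add iabs
    · intro ξ hξ η hη hne
      rw [hsing, labs hkl ξ η hne]
    · simp only [mul_add (_ * _)]
      rw [(iconst _).sqInt_add iabs, sqInt_poly_mul_poly]
      simp only [singTerms, if_neg hf, if_neg hL, if_pos hkl, exactSum_cons, exactSum_nil,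
        QTerm.exactValue]
      ring
  -- for adjacent elements, a flip moves the common end point to the origin
  by_cases hkl1 : (k : ℕ) = ℓ + 1
  · have hr : rgt t ℓ = lft t k := IsMesh.rgt_eq_lft hkl1.symm
    have il : SqIntegrable fun ξ η => Real.log (msize t k * ξ + msize t ℓ * (1 - η)) :=
      (sqIntegrable_log_add hk hl).flip_snd
    refine key _ (il.continuousOn_mul hcab.continuousOn) ?_ ?_
    · intro ξ hξ η hη hne
      have e : (lft t k + ξ * msize t k) - (lft t ℓ + η * msize t ℓ)
          = msize t k * ξ + msize t ℓ * (1 - η) := by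
        rw [← hr, ← IsMesh.lft_add_msize ℓ]; ring
      rw [hsing, e, Real.log_abs]
    · have e := exactSum_splitTerms_pair (-(msize t ℓ / Real.pi)) hc1 hk hl
        (P₁ := fun x y => a.eval (1 - y) * q.derivative.eval (y * x) * y)
        (P₂ := fun x y => a.eval (1 - y + (1 - x) * y) * q.derivative.eval y * y)
        (r₁ := fun x => Real.log (x * msize t k + msize t ℓ))
        (r₂ := fun x => Real.log ((1 - (1 - x)) * msize t ℓ + msize t k))
        (by intro x y; rw [mul_comm y x]) (fun _ => rfl) (by intros; ring_nf) (by intros; ring_nf)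
      have hflip : sqInt (fun ξ η => a.eval η * q.derivative.eval ξ *
            Real.log (msize t k * ξ + msize t ℓ * (1 - η))) =
          sqInt (fun ξ η => a.eval (1 - η) * q.derivative.eval ξ *
            Real.log (msize t k * ξ + msize t ℓ * η)) := by
        rw [sqInt_flip_snd]
        simp only [sub_sub_cancel]
      rw [hflip, ← e]
      simp only [singTerms, if_neg hf, if_neg hL, if_neg hkl, if_pos hkl1, exactSum_append]
      rw [exactSum_splitTerms_flip _ (fun x y => a.eval (1 - y + x * y) * _ * y)]
  by_cases hkl2 : (k : ℕ) + 1 = ℓ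
  · have hr : rgt t k = lft t ℓ := IsMesh.rgt_eq_lft hkl2
    have il : SqIntegrable fun ξ η => Real.log (msize t k * (1 - ξ) + msize t ℓ * η) :=
      (sqIntegrable_log_add hk hl).flip_fst
    refine key _ (il.continuousOn_mul hcab.continuousOn) ?_ ?_
    · intro ξ hξ η hη hne
      have e : (lft t ℓ + η * msize t ℓ) - (lft t k + ξ * msize t k)
          = msize t k * (1 - ξ) + msize t ℓ * η := by
        rw [← hr, ← IsMesh.lft_add_msize k]; ring
      rw [hsing, abs_sub_comm, e, Real.log_abs]
    · have e := exactSum_splitTerms_pair (-(msize t ℓ / Real.pi)) hc2 hk hl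
        (P₁ := fun x y => a.eval y * q.derivative.eval (1 - y + (1 - x) * y) * y)
        (P₂ := fun x y => a.eval ((1 - (1 - x)) * y) * q.derivative.eval (1 - y) * y)
        (r₁ := fun x => Real.log ((1 - (1 - x)) * msize t k + msize t ℓ))
        (r₂ := fun x => Real.log (msize t k + (1 - (1 - x)) * msize t ℓ))
        (by intros; ring_nf) (by intros; ring_nf) (by intros; ring_nf) (by intros; ring_nf)
      have hflip : sqInt (fun ξ η => a.eval η * q.derivative.eval ξ *
            Real.log (msize t k * (1 - ξ) + msize t ℓ * η)) =
          sqInt (fun ξ η => a.eval η * q.derivative.eval (1 - ξ) *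
            Real.log (msize t k * ξ + msize t ℓ * η)) := by
        rw [sqInt_flip_fst]
        simp only [sub_sub_cancel]
      rw [hflip, ← e]
      simp only [singTerms, if_neg hf, if_neg hL, if_neg hkl, if_neg hkl1, if_pos hkl2,
        exactSum_append]
      rw [exactSum_splitTerms_flip _ (fun x y => a.eval ((1 - x) * y) * _ * y),
        exactSum_splitTerms_flip _ (fun x y => a.eval y * q.derivative.eval (1 - y + x * y) * y),
        add_comm]
  · refine key (fun ξ η => Real.log |(lft t k + ξ * msize t k) - (lft t ℓ + η * msize t ℓ)|) ?_
      (fun ξ _ η _ _ => hsing _ _) ?_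
    · exact sqIntegrable_of_continuousOn
        (hcab.continuousOn.mul (PolyApprox₂.log_abs_sub_sub h (by omega)).continuousOn)
    · simp only [singTerms, if_neg hf, if_neg hL, if_neg hkl, if_neg hkl1, if_neg hkl2,
        exactSum_cons, exactSum_nil, QTerm.exactValue, add_zero]

/-! ### The schemes are consistent with the local matrices -/

theorem sqIntegrable_mul_regF (h : IsMesh T t) (k ℓ : Fin N) (a b : ℝ[X]) :
    SqIntegrable fun ξ η => a.eval η * b.eval ξ *
      regF T k ℓ (lft t k + ξ * msize t k) (lft t ℓ + η * msize t ℓ) := by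
  have hP := (PolyApprox₂.poly a (SepPoly.linear_snd (H := fun _ y => y) 0 1 (by intros; ring))).mul
    (PolyApprox₂.poly b (SepPoly.linear_fst (H := fun x _ => x) 0 1 (by intros; ring)))
  have hF := hP.mul (PolyApprox₂.regF' h k ℓ
    (SepPoly.bilinear (H := fun x _ => lft t k + x * msize t k) (lft t k) (msize t k) 0 0
      (by intros; ring))
    (SepPoly.bilinear (H := fun _ y => lft t ℓ + y * msize t ℓ) (lft t ℓ) 0 (msize t ℓ) 0
      (by intros; ring))
    (fun _ hx _ _ => h.add_mul_mem k hx) (fun _ _ _ hy => h.add_mul_mem ℓ hy))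
  exact sqIntegrable_of_continuousOn hF.continuousOn

theorem exactSum_kernTerms (h : IsMesh T t) (k ℓ : Fin N) (a q : ℝ[X]) :
    exactSum (kernTerms T t k ℓ a q) = msize t ℓ * ∫ η in (0 : ℝ)..1, a.eval η *
      ∫ ξ in (0 : ℝ)..1, kern T (lft t k + ξ * msize t k) (lft t ℓ + η * msize t ℓ) *
        q.derivative.eval ξ := by
  obtain ⟨hi, hs⟩ := exactSum_singTerms h k ℓ a q
  have hk := h.msize_pos k
  have hFi := sqIntegrable_mul_regF h k ℓ a q.derivative
  have h2 : PolyApprox₂ fun ξ η => a.eval ((1 - η) * ξ) *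
      (regF T k ℓ (lft t k + ξ * msize t k) (lft t ℓ + (1 - η) * ξ * msize t ℓ) * ξ) *
      q.derivative.eval ξ :=
    ((PolyApprox₂.poly a (SepPoly.bilinear 0 1 0 (-1) (by intros; ring))).mul
      ((PolyApprox₂.regF_duffy_snd h k ℓ).mul (PolyApprox₂.of_sepPoly
        (SepPoly.linear_fst 0 1 (by intros; ring))))).mul
      (PolyApprox₂.poly _ (SepPoly.linear_fst 0 1 (by intros; ring)))
  have e1 : sqInt (fun ξ η => a.eval η *
      (regF T k ℓ (lft t k + (1 - ξ) * η * msize t k) (lft t ℓ + η * msize t ℓ) * η) *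
      q.derivative.eval ((1 - ξ) * η)) + sqInt (fun ξ η => a.eval ((1 - η) * ξ) *
      (regF T k ℓ (lft t k + ξ * msize t k) (lft t ℓ + (1 - η) * ξ * msize t ℓ) * ξ) *
      q.derivative.eval ξ) = sqInt fun ξ η => a.eval η * q.derivative.eval ξ *
      regF T k ℓ (lft t k + ξ * msize t k) (lft t ℓ + η * msize t ℓ) := by
    rw [hFi.sqInt_duffy]
    congr 1
    · rw [sqInt_flip_fst]
      simp only [sub_sub_cancel]
      congr 1; ext x y; ring
    · rw [(sqIntegrable_of_continuousOn h2.continuousOn).sqInt_swap, sqInt_flip_fst]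
      simp only [sub_sub_cancel]
      congr 1; ext x y; ring
  have e2 : exactSum (kernTerms T t k ℓ a q) = -(msize t ℓ / Real.pi) * sqInt fun ξ η =>
      a.eval η * q.derivative.eval ξ *
        regF T k ℓ (lft t k + ξ * msize t k) (lft t ℓ + η * msize t ℓ) +
      a.eval η * q.derivative.eval ξ *
        singF T k ℓ (lft t k + ξ * msize t k) (lft t ℓ + η * msize t ℓ) := by
    rw [hFi.sqInt_add hi, ← e1, kernTerms, exactSum_append, hs]
    simp only [exactSum_cons, exactSum_nil, QTerm.exactValue]
    ring
  have e3 : msize t ℓ * ∫ η in (0 : ℝ)..1, a.eval η *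
      ∫ ξ in (0 : ℝ)..1, kern T (lft t k + ξ * msize t k) (lft t ℓ + η * msize t ℓ) *
        q.derivative.eval ξ = msize t ℓ * sqInt fun ξ η => a.eval η *
          (kern T (lft t k + ξ * msize t k) (lft t ℓ + η * msize t ℓ) *
        q.derivative.eval ξ) := by
    simp only [sqInt, intervalIntegral.integral_const_mul]
  rw [e2, e3, neg_mul, div_eq_mul_inv, mul_assoc, ← mul_neg, ← neg_mul, ← sqInt_const_mul]
  congr 1
  refine sqInt_congr_ae fun η hη => ?_
  filter_upwards [compl_mem_ae_iff.2 (measure_singleton (μ := volume)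
    ((lft t ℓ + η * msize t ℓ - lft t k) / msize t k))] with ξ hξ hξ'
  have hs := h.add_mul_mem k (Ioo_subset_Icc_self hξ')
  have hne : lft t k + ξ * msize t k ≠ lft t ℓ + η * msize t ℓ := fun e => hξ (by
    rw [mem_singleton_iff, eq_div_iff hk.ne', ← e]; ring)
  obtain ⟨h0, h2⟩ := add_mem_of_mem_Ioo h (ℓ := ℓ) hs hη
  rw [kern, log_tan_mul_tan h hs hne h0 h2]
  ring

end

section
variable {T : ℝ} {N : ℕ} {t : Fin (N + 1) → ℝ}

theorem PolyApprox₂.intervalIntegrable {f : ℝ → ℝ} (hf : PolyApprox₂ fun x _ => f x) :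
    IntervalIntegrable f volume 0 1 := by
  have : ContinuousOn f (Icc 0 1) :=
    hf.continuousOn.comp (f := fun x : ℝ => (x, (0 : ℝ))) (by fun_prop) fun x hx => ⟨hx, by simp⟩
  exact this.intervalIntegrable_of_Icc zero_le_one

theorem intervalIntegral_congr_Ioo {f g : ℝ → ℝ} (h : ∀ x ∈ Ioo (0 : ℝ) 1, f x = g x) :
    ∫ x in (0 : ℝ)..1, f x = ∫ x in (0 : ℝ)..1, g x := by
  rw [intervalIntegral.integral_of_le zero_le_one, intervalIntegral.integral_of_le zero_le_one,
    integral_Ioc_eq_integral_Ioo, integral_Ioc_eq_integral_Ioo]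
  exact setIntegral_congr_fun measurableSet_Ioo h

theorem intervalIntegrable_mul_log_one_sub (q : ℝ[X]) :
    IntervalIntegrable (fun η => q.eval η * Real.log (1 - η)) volume 0 1 := by
  have := (intervalIntegral.intervalIntegrable_log' (a := 1) (b := 0)).comp_sub_left 1
  simp only [sub_zero, sub_self] at this
  exact this.continuousOn_mul q.continuous.continuousOn

theorem integral_mul_log_one_sub (q : ℝ[X]) :
    ∫ η in (0 : ℝ)..1, q.eval η * Real.log (1 - η) =
      ∫ η in (0 : ℝ)..1, q.eval (1 - η) * Real.log η := by
  have := intervalIntegral.integral_comp_sub_left (a := 0) (b := 1)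
    (fun η => q.eval (1 - η) * Real.log η) 1
  simpa using this

theorem integral_derivative_mul_const (u : ℝ[X]) (c : ℝ) :
    ∫ η in (0 : ℝ)..1, u.derivative.eval η * c = (u.eval 1 - u.eval 0) * c := by
  rw [intervalIntegral.integral_mul_const, intervalIntegral.integral_eq_sub_of_hasDerivAt
    (fun x _ => u.hasDerivAt x) (u.derivative.continuous.intervalIntegrable _ _)]

/-- The integral of the kernel along a mesh line, split into its regular and its singular part. -/
theorem integral_kern_line (h : IsMesh T t) {k ℓ : Fin N} {s : ℝ} (hs : s ∈ Icc (lft t k) (rgt t k))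
    (hs' : s ≤ lft t ℓ ∨ rgt t ℓ ≤ s) (d : ℝ[X]) {R : ℝ → ℝ}
    (hR : IntervalIntegrable (fun η => d.eval η * R η) volume 0 1)
    (he : ∀ η ∈ Ioo (0 : ℝ) 1, singF T k ℓ s (lft t ℓ + η * msize t ℓ) = R η) :
    -Real.pi * ∫ η in (0 : ℝ)..1, d.eval η * kern T s (lft t ℓ + η * msize t ℓ) =
      (∫ η in (0 : ℝ)..1, d.eval η * regF T k ℓ s (lft t ℓ + η * msize t ℓ)) +
        ∫ η in (0 : ℝ)..1, d.eval η * R η := by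
  have hF := ((PolyApprox₂.fst_poly d).mul
    (PolyApprox₂.regF_line h k ℓ hs)).intervalIntegrable
  rw [← intervalIntegral.integral_add hF hR, ← intervalIntegral.integral_const_mul]
  refine intervalIntegral_congr_Ioo fun η hη => ?_
  obtain ⟨h0, h2⟩ := add_mem_of_mem_Ioo h (ℓ := ℓ) hs hη
  have hl := h.msize_pos ℓ
  have hne : s ≠ lft t ℓ + η * msize t ℓ := by
    rcases hs' with hs' | hs'
    · exact (hs'.trans_lt (by have := mul_pos hη.1 hl; linarith)).ne
    · refine (lt_of_lt_of_le ?_ hs').ne'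
      have := mul_lt_mul_of_pos_right hη.2 hl
      rw [← IsMesh.lft_add_msize ℓ]; linarith
  rw [kern, log_tan_mul_tan h hs hne h0 h2, he η hη]
  field_simp

theorem le_lft_or_rgt_le (h : IsMesh T t) (k ℓ : Fin N) :
    (lft t k ≤ lft t ℓ ∨ rgt t ℓ ≤ lft t k) ∧ (rgt t k ≤ lft t ℓ ∨ rgt t ℓ ≤ rgt t k) := by
  rcases lt_trichotomy k ℓ with hlt | rfl | hlt
  · have := h.rgt_le_lft hlt
    exact ⟨Or.inl ((h.lft_lt_rgt k).le.trans this), Or.inl this⟩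
  · exact ⟨Or.inl le_rfl, Or.inr le_rfl⟩
  · have := h.rgt_le_lft hlt
    exact ⟨Or.inr this, Or.inr (this.trans (h.lft_lt_rgt k).le)⟩

theorem singF_of_not {k ℓ : Fin N} (h1 : ¬BothFirst k ℓ) (h2 : ¬BothLast k ℓ) (s x : ℝ) :
    singF T k ℓ s x = Real.log |s - x| := by
  rw [singF, if_neg h1, if_neg h2, add_zero]

theorem exactSum_J0Terms (h : IsMesh T t) (k ℓ : Fin N) (c : ℝ) (u : ℝ[X]) :
    exactSum (J0Terms T t k ℓ c u) = c * J0 T t k ℓ u := by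
  have hk := h.msize_pos k
  have hl := h.msize_pos ℓ
  set d := u.derivative with hd
  have key := fun R => integral_kern_line h (R := R)
    (show lft t k ∈ Icc (lft t k) (rgt t k) from ⟨le_rfl, (h.lft_lt_rgt k).le⟩)
    (le_lft_or_rgt_le h k ℓ).1 d
  have ilog := intervalIntegrable_mul_log (f := fun x => d.eval x) d.continuous 0 1
  have iconst : ∀ c : ℝ, IntervalIntegrable (fun x => d.eval x * c) volume 0 1 := fun c =>
    (d.continuous.mul continuous_const).intervalIntegrable _ _
  have hlog : ∀ η ∈ Ioo (0 : ℝ) 1, Real.log (η * msize t ℓ) = Real.log (msize t ℓ) + Real.log η :=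
    fun η hη => by rw [Real.log_mul hη.1.ne' hl.ne', add_comm]
  have hlog' : ∀ η ∈ Ioo (0 : ℝ) 1, Real.log ((1 - η) * msize t ℓ) =
      Real.log (msize t ℓ) + Real.log (1 - η) :=
    fun η hη => by rw [Real.log_mul (by linarith [hη.2]) hl.ne', add_comm]
  have hsame : (k : ℕ) = ℓ → ∀ η, Real.log |lft t k - (lft t ℓ + η * msize t ℓ)| =
      Real.log (η * msize t ℓ) := fun e η => by
    rw [show k = ℓ from Fin.ext e, sub_add_cancel_left, Real.log_abs, Real.log_neg_eq_log]
  rw [J0, J0Terms, exactSum_append]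
  simp only [exactSum_cons, exactSum_nil, QTerm.exactValue, add_zero, ← hd]
  split_ifs with h1 h2 h3 h4 h5
  · rw [key (fun η => Real.log (msize t ℓ) * 2 + Real.log η * 2)]
    · simp only [mul_add (eval _ _), exactSum_cons, exactSum_nil, QTerm.exactValue, add_zero,
        ← mul_assoc (eval _ _) (Real.log _)]
      rw [intervalIntegral.integral_add ((iconst _).mul_const _) (ilog.mul_const _),
        intervalIntegral.integral_mul_const, hd, integral_derivative_mul_const,
        intervalIntegral.integral_mul_const]
      ring
    · simp only [mul_add (eval _ _), ← mul_assoc (eval _ _) (Real.log _)]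
      exact ((iconst _).mul_const _).add (ilog.mul_const _)
    · intro η hη
      rw [singF, if_pos h1, hsame (h1.1.trans h1.2.symm), h.lft_eq_zero h1.1, h.lft_eq_zero h1.2,
        zero_add, zero_add, hlog η hη]
      ring
  · have ilog2 : IntervalIntegrable (fun η => d.eval η * Real.log (2 - η)) volume 0 1 := by
      refine ContinuousOn.intervalIntegrable_of_Icc zero_le_one
        (d.continuous.continuousOn.mul (ContinuousOn.log (by fun_prop) fun x hx => ?_))
      linarith [hx.2]
    rw [key (fun η => Real.log η - Real.log (2 - η))]
    · simp only [mul_sub (eval _ _), exactSum_cons, exactSum_nil, QTerm.exactValue, add_zero]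
      rw [intervalIntegral.integral_sub ilog ilog2]
      ring
    · simp only [mul_sub (eval _ _)]
      exact ilog.sub ilog2
    · intro η hη
      have hkl : k = ℓ := Fin.ext (by have := h2.1; have := h2.2; omega)
      have h3 : msize t ℓ + lft t ℓ = T := by rw [msize, h.rgt_eq h2.2]; ring
      have e : 2 * T - lft t k - (lft t ℓ + η * msize t ℓ) = (2 - η) * msize t ℓ := by
        rw [hkl, ← h3]; ring
      rw [singF, if_neg h1, if_pos h2, hsame (by rw [hkl]), e, hlog η hη,
        Real.log_mul (by linarith [hη.2]) hl.ne']
      ring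
  · rw [key (fun η => Real.log (msize t ℓ) + Real.log η)]
    · simp only [mul_add (eval _ _), exactSum_cons, exactSum_nil, QTerm.exactValue, add_zero]
      rw [intervalIntegral.integral_add (iconst _) ilog, hd, integral_derivative_mul_const]
      ring
    · simp only [mul_add (eval _ _)]
      exact (iconst _).add ilog
    · intro η hη
      rw [singF_of_not h1 h2, hsame h3, hlog η hη]
  · have ilog1 := intervalIntegrable_mul_log_one_sub d
    rw [key (fun η => Real.log (msize t ℓ) + Real.log (1 - η))]
    · simp only [mul_add (eval _ _), exactSum_cons, exactSum_nil, QTerm.exactValue, add_zero]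
      rw [intervalIntegral.integral_add (iconst _) ilog1, integral_mul_log_one_sub, hd,
        integral_derivative_mul_const]
      ring
    · simp only [mul_add (eval _ _)]
      exact (iconst _).add ilog1
    · intro η hη
      have e : lft t k - (lft t ℓ + η * msize t ℓ) = (1 - η) * msize t ℓ := by
        rw [← IsMesh.rgt_eq_lft h4.symm, ← IsMesh.lft_add_msize]; ring
      rw [singF_of_not h1 h2, e, Real.log_abs, hlog' η hη]
  · rw [key (fun η => Real.log (msize t k + η * msize t ℓ))]
    · simp only [exactSum_cons, exactSum_nil, QTerm.exactValue, add_zero]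
      ring
    · refine ContinuousOn.intervalIntegrable_of_Icc zero_le_one
        (d.continuous.continuousOn.mul (ContinuousOn.log (by fun_prop) fun x hx => ?_))
      have := hx.1
      positivity
    · intro η hη
      have e : lft t k - (lft t ℓ + η * msize t ℓ) = -(msize t k + η * msize t ℓ) := by
        rw [← IsMesh.rgt_eq_lft h5, ← IsMesh.lft_add_msize]; ring
      rw [singF_of_not h1 h2, e, Real.log_abs, Real.log_neg_eq_log]
  · rw [key (fun η => Real.log |lft t k - (lft t ℓ + η * msize t ℓ)|)]
    · simp only [exactSum_cons, exactSum_nil, QTerm.exactValue, add_zero]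
      ring
    · refine ((PolyApprox₂.fst_poly d).mul (PolyApprox₂.log_abs_sub h ?_)).intervalIntegrable
      rcases lt_or_ge (k : ℕ) ℓ with hlt | hge
      · exact Or.inl ((h.lft_lt_rgt k).trans_le (h.rgt_le_lft hlt))
      · exact Or.inr (h.rgt_lt_lft (by omega))
    · intro η hη
      rw [singF_of_not h1 h2]

/-- The two tangents are reciprocal to each other, as their angles add up to `π/2`. In this form the
identity also holds at their zeros and poles, where the logarithm of zero is zero. -/
theorem kern_right_end (hT : 0 < T) {x : ℝ} : kern T T x = 0 := by
  have e1 : Real.tan (Real.pi * (T - x) / (4 * T)) =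
      (Real.tan (Real.pi * (T + x) / (4 * T)))⁻¹ := by
    rw [← Real.tan_pi_div_two_sub]
    congr 1; field_simp; ring
  have e2 : |Real.tan (Real.pi * |x - T| / (4 * T))| = |Real.tan (Real.pi * (T - x) / (4 * T))| := by
    rw [abs_sub_comm]
    rcases abs_choice (T - x) with h | h <;> rw [h]
    rw [mul_neg, neg_div, Real.tan_neg, abs_neg]
  rw [kern, ← Real.log_abs, abs_mul, e2, e1, abs_inv]
  by_cases h : |Real.tan (Real.pi * (T + x) / (4 * T))| = 0
  · simp [h]
  · simp [mul_inv_cancel₀ h]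

theorem exactSum_J1Terms (h : IsMesh T t) (k ℓ : Fin N) (c : ℝ) (u : ℝ[X]) :
    exactSum (J1Terms T t k ℓ c u) = c * J1 T t k ℓ u := by
  have hk := h.msize_pos k
  have hl := h.msize_pos ℓ
  set d := u.derivative with hd
  have key := fun R => integral_kern_line h (R := R)
    (show rgt t k ∈ Icc (lft t k) (rgt t k) from ⟨(h.lft_lt_rgt k).le, le_rfl⟩)
    (le_lft_or_rgt_le h k ℓ).2 d
  have ilog := intervalIntegrable_mul_log (f := fun x => d.eval x) d.continuous 0 1
  have ilog1 := intervalIntegrable_mul_log_one_sub d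
  have iconst : ∀ c : ℝ, IntervalIntegrable (fun x => d.eval x * c) volume 0 1 := fun c =>
    (d.continuous.mul continuous_const).intervalIntegrable _ _
  have hlog : ∀ η ∈ Ioo (0 : ℝ) 1, Real.log (η * msize t ℓ) = Real.log (msize t ℓ) + Real.log η :=
    fun η hη => by rw [Real.log_mul hη.1.ne' hl.ne', add_comm]
  have hlog' : ∀ η ∈ Ioo (0 : ℝ) 1, Real.log ((1 - η) * msize t ℓ) =
      Real.log (msize t ℓ) + Real.log (1 - η) :=
    fun η hη => by rw [Real.log_mul (by linarith [hη.2]) hl.ne', add_comm]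
  have hsame : (k : ℕ) = ℓ → ∀ η, Real.log |rgt t k - (lft t ℓ + η * msize t ℓ)| =
      Real.log ((1 - η) * msize t ℓ) := fun e η => by
    rw [show k = ℓ from Fin.ext e, ← IsMesh.lft_add_msize, Real.log_abs]; ring_nf
  rw [J1, J1Terms]
  by_cases h2 : BothLast k ℓ
  · rw [if_pos h2, h.rgt_eq h2.1]
    simp [exactSum_nil, kern_right_end h.pos]
  simp only [if_neg h2]
  rw [exactSum_append]
  simp only [exactSum_cons, exactSum_nil, QTerm.exactValue, add_zero, ← hd]
  split_ifs with h1 h3 h4 h5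
  · have ilog2 : IntervalIntegrable (fun η => d.eval η * Real.log (1 + η)) volume 0 1 := by
      refine ContinuousOn.intervalIntegrable_of_Icc zero_le_one
        (d.continuous.continuousOn.mul (ContinuousOn.log (by fun_prop) fun x hx => ?_))
      linarith [hx.1]
    rw [key (fun η => Real.log (msize t ℓ) * 2 + Real.log (1 + η) + Real.log (1 - η))]
    · simp only [mul_add (eval _ _), exactSum_cons, exactSum_nil, QTerm.exactValue, add_zero,
        ← mul_assoc (eval _ _) (Real.log _) (2 : ℝ)]
      rw [intervalIntegral.integral_add (((iconst _).mul_const _).add ilog2) ilog1,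
        intervalIntegral.integral_add ((iconst _).mul_const _) ilog2,
        intervalIntegral.integral_mul_const,
        integral_mul_log_one_sub, hd, integral_derivative_mul_const]
      ring
    · simp only [mul_add (eval _ _), ← mul_assoc (eval _ _) (Real.log _)]
      exact (((iconst _).mul_const _).add ilog2).add ilog1
    · intro η hη
      have hkl : k = ℓ := Fin.ext (h1.1.trans h1.2.symm)
      have e : rgt t k + (lft t ℓ + η * msize t ℓ) = (1 + η) * msize t ℓ := by
        rw [hkl, ← IsMesh.lft_add_msize, h.lft_eq_zero h1.2]; ring
      rw [singF, if_pos h1, hsame (by rw [hkl]), e, hlog' η hη,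
        Real.log_mul (by linarith [hη.1]) hl.ne']
      ring
  · rw [key (fun η => Real.log (msize t ℓ) + Real.log (1 - η))]
    · simp only [mul_add (eval _ _), exactSum_cons, exactSum_nil, QTerm.exactValue, add_zero]
      rw [intervalIntegral.integral_add (iconst _) ilog1, integral_mul_log_one_sub, hd,
        integral_derivative_mul_const]
      ring
    · simp only [mul_add (eval _ _)]
      exact (iconst _).add ilog1
    · intro η hη
      rw [singF_of_not h1 h2, hsame h3, hlog' η hη]
  · rw [key (fun η => Real.log (msize t k + (1 - η) * msize t ℓ))]
    · simp only [exactSum_cons, exactSum_nil, QTerm.exactValue, add_zero]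
      ring
    · refine ContinuousOn.intervalIntegrable_of_Icc zero_le_one
        (d.continuous.continuousOn.mul (ContinuousOn.log (by fun_prop) fun x hx => ?_))
      have : 0 ≤ 1 - x := by linarith [hx.2]
      positivity
    · intro η hη
      have e : rgt t k - (lft t ℓ + η * msize t ℓ) = msize t k + (1 - η) * msize t ℓ := by
        rw [← IsMesh.lft_add_msize k, ← IsMesh.rgt_eq_lft h4.symm, ← IsMesh.lft_add_msize ℓ]; ring
      rw [singF_of_not h1 h2, e, Real.log_abs]
  · rw [key (fun η => Real.log (msize t ℓ) + Real.log η)]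
    · simp only [mul_add (eval _ _), exactSum_cons, exactSum_nil, QTerm.exactValue, add_zero]
      rw [intervalIntegral.integral_add (iconst _) ilog, hd, integral_derivative_mul_const]
      ring
    · simp only [mul_add (eval _ _)]
      exact (iconst _).add ilog
    · intro η hη
      rw [singF_of_not h1 h2, IsMesh.rgt_eq_lft h5, sub_add_cancel_left, Real.log_abs,
        Real.log_neg_eq_log, hlog η hη]
  · rw [key (fun η => Real.log |rgt t k - (lft t ℓ + η * msize t ℓ)|)]
    · simp only [exactSum_cons, exactSum_nil, QTerm.exactValue, add_zero]
      ring
    · refine ((PolyApprox₂.fst_poly d).mul (PolyApprox₂.log_abs_sub h ?_)).intervalIntegrable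
      rcases lt_or_ge (k : ℕ) ℓ with hlt | hge
      · exact Or.inl (h.rgt_lt_lft (by omega))
      · exact Or.inr ((h.rgt_le_lft (show ℓ < k from Fin.lt_def.2 (by omega))).trans_lt
          (h.lft_lt_rgt k))
    · intro η hη
      rw [singF_of_not h1 h2]

theorem exactSum_initTerms (h : IsMesh T t) (k ℓ : Fin N) (a q : ℝ[X]) :
    exactSum (initTerms T t k ℓ a q) =
      -((if (k : ℕ) = 0 then 1 else 0) * q.eval 0 * (2 * msize t ℓ / Real.pi) *
        ∫ η in (0 : ℝ)..1, a.eval η *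
          Real.log (Real.tan (Real.pi * (lft t ℓ + η * msize t ℓ) / (4 * T)))) := by
  have hl := h.msize_pos ℓ
  have hT := h.pos
  unfold initTerms
  split_ifs with h1 h2
  · have i1 := ((PolyApprox₂.fst_poly a).mul
      (PolyApprox₂.log_tanQuot_init h h2)).intervalIntegrable
    have i2 := intervalIntegrable_mul_log (f := fun x => a.eval x) a.continuous 0 1
    have i3 : IntervalIntegrable (fun x => a.eval x * Real.log (msize t ℓ)) volume 0 1 :=
      (a.continuous.mul continuous_const).intervalIntegrable _ _
    have e : ∫ η in (0 : ℝ)..1, a.eval η *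
          Real.log (Real.tan (Real.pi * (lft t ℓ + η * msize t ℓ) / (4 * T))) =
        ∫ η in (0 : ℝ)..1, (a.eval η * Real.log (tanQuot T (η * msize t ℓ)) +
          a.eval η * Real.log η + a.eval η * Real.log (msize t ℓ)) := by
      refine intervalIntegral_congr_Ioo fun η hη => ?_
      have hp : 0 < η * msize t ℓ := mul_pos hη.1 hl
      have hm := (h.add_mul_mem ℓ (Ioo_subset_Icc_self hη)).2
      rw [h.lft_eq_zero h2, zero_add] at hm ⊢
      have := h.rgt_le ℓ
      rw [tan_eq_tanQuot_mul hp.ne', Real.log_mul (tanQuot_pos hT (by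
        rw [abs_of_pos hp]; linarith)).ne' hp.ne', Real.log_mul hη.1.ne' hl.ne']
      ring
    rw [e, intervalIntegral.integral_add (i1.add i2) i3, intervalIntegral.integral_add i1 i2,
      intervalIntegral.integral_mul_const]
    simp only [exactSum_cons, exactSum_nil, QTerm.exactValue]
    ring
  · simp only [exactSum_cons, exactSum_nil, QTerm.exactValue]
    ring
  · simp [exactSum_nil]

theorem exactSum_scheme (h : IsMesh T t) (k ℓ : Fin N) (un um : ℝ[X]) (X : Kind) :
    exactSum (scheme T t k ℓ un um X) = localEntry T t k ℓ un um X := by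
  have hk := h.msize_pos k
  have hl := h.msize_pos ℓ
  cases X
  · simp only [scheme, localEntry, exactSum_append, exactSum_initTerms h, exactSum_kernTerms h]
  · have e1 : ∀ I, 2 * msize t ℓ / Real.pi * (1 / msize t ℓ * I) = 2 / Real.pi * I := fun I => by
      field_simp
    have e2 : ∀ I, msize t ℓ * (1 / msize t ℓ * I) = I := fun I => by field_simp
    simp only [scheme, localEntry, exactSum_append, exactSum_initTerms h, exactSum_kernTerms h,
      eval_mul, eval_C, mul_assoc, intervalIntegral.integral_const_mul, e1, e2]
  · simp only [scheme, localEntry, exactSum_append, exactSum_J0Terms h, exactSum_J1Terms h,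
      exactSum_kernTerms h, eval_mul, eval_C, derivative_C_mul, mul_assoc,
      mul_left_comm _ (1 / msize t k), intervalIntegral.integral_const_mul]
    field_simp

end

/-! ### Convergence of the computed local entries -/

theorem ExpConv.add {e e' : ℕ → ℝ} (h : ExpConv e) (h' : ExpConv e') :
    ExpConv fun K => e K + e' K := by
  obtain ⟨C, ρ, h0, h1, h⟩ := h
  obtain ⟨C', ρ', h0', h1', h'⟩ := h'
  have hC : 0 ≤ C := nonneg_of_mul_nonneg_left ((abs_nonneg _).trans (h 1 le_rfl)) (by positivity)
  have hC' : 0 ≤ C' :=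
    nonneg_of_mul_nonneg_left ((abs_nonneg _).trans (h' 1 le_rfl)) (by positivity)
  refine ⟨C + C', max ρ ρ', h0.trans_le (le_max_left _ _), max_lt h1 h1', fun K hK => ?_⟩
  rw [add_mul]
  refine (abs_add_le _ _).trans (add_le_add ((h K hK).trans ?_) ((h' K hK).trans ?_))
  · exact mul_le_mul_of_nonneg_left (pow_le_pow_left₀ h0.le (le_max_left _ _) _) hC
  · exact mul_le_mul_of_nonneg_left (pow_le_pow_left₀ h0'.le (le_max_right _ _) _) hC'

theorem ExpConv.const_mul {e : ℕ → ℝ} (h : ExpConv e) (c : ℝ) : ExpConv fun K => c * e K := by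
  obtain ⟨C, ρ, h0, h1, h⟩ := h
  refine ⟨|c| * C, ρ, h0, h1, fun K hK => ?_⟩
  rw [abs_mul, mul_assoc]
  exact mul_le_mul_of_nonneg_left (h K hK) (abs_nonneg _)

theorem ExpConv.zero : ExpConv fun _ => 0 :=
  ⟨0, 1 / 2, by norm_num, by norm_num, fun K _ => by simp⟩

theorem ExpConv.sum {ι : Type*} (s : Finset ι) {e : ι → ℕ → ℝ} (h : ∀ i ∈ s, ExpConv (e i)) :
    ExpConv fun K => ∑ i ∈ s, e i K := by
  classical
  induction s using Finset.induction_on with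
  | empty => simpa using ExpConv.zero
  | insert i s hi ih =>
    simp only [Finset.sum_insert hi]
    exact (h i (Finset.mem_insert_self _ _)).add
      (ih fun j hj => h j (Finset.mem_insert_of_mem hj))

theorem ExpConv₂.diag {e : ℕ → ℕ → ℝ} (h : ExpConv₂ e) : ExpConv fun K => e K K := by
  obtain ⟨C, ρ, h0, h1, h⟩ := h
  exact ⟨2 * C, ρ, h0, h1, fun K hK => (h K K hK hK).trans (le_of_eq (by ring))⟩

theorem QTerm.expConv {LR : ∀ K, LegendreRule K} {JR : ∀ K, LogRule K} {o : ℕ × ℕ} {τ : QTerm}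
    (h1 : τ.LegConv LR) (h2 : τ.LogExact LR JR o) :
    ExpConv fun K => τ.quad LR JR K o - τ.exactValue := by
  cases τ with
  | const c => simpa [QTerm.quad, QTerm.exactValue] using ExpConv.zero
  | leg c f =>
    simp only [QTerm.quad, QTerm.exactValue, ← mul_sub]
    exact ExpConv.const_mul h1 c
  | tensor c G =>
    simp only [QTerm.quad, QTerm.exactValue, ← mul_sub]
    exact (ExpConv₂.diag h1).const_mul c
  | log c f =>
    have : quadLog JR o.1 f = _ := h2
    simpa [QTerm.quad, QTerm.exactValue, this] using ExpConv.zero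
  | mixed c G =>
    have : quadMixed LR JR o.1 o.2 G = _ := h2
    simpa [QTerm.quad, QTerm.exactValue, this, sqInt] using ExpConv.zero
  | logTensor c g =>
    have : quadLogTensor LR JR o.1 g = _ := h2
    simpa [QTerm.quad, QTerm.exactValue, this, sqInt] using ExpConv.zero

theorem expConv_exactSum {LR : ∀ K, LegendreRule K} {JR : ∀ K, LogRule K} {L : QTerm → ℕ × ℕ}
    {l : List QTerm} (h1 : ∀ τ ∈ l, τ.LegConv LR) (h2 : ∀ τ ∈ l, τ.LogExact LR JR (L τ)) :
    ExpConv fun K => (l.map fun τ => τ.quad LR JR K (L τ)).sum - exactSum l := by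
  induction l with
  | nil => simpa [exactSum_nil] using ExpConv.zero
  | cons τ l ih =>
    rw [List.forall_mem_cons] at h1 h2
    simp only [List.map_cons, List.sum_cons, exactSum_cons, add_sub_add_comm]
    exact (QTerm.expConv h1.1 h2.1).add (ih h1.2 h2.2)

theorem expConv_localQuad {T : ℝ} {N : ℕ} {t : Fin (N + 1) → ℝ} (h : IsMesh T t)
    {LR : ∀ K, LegendreRule K} {JR : ∀ K, LogRule K} {L : QTerm → ℕ × ℕ} {k ℓ : Fin N}
    {un um : ℝ[X]} {X : Kind}
    (hL : ∀ τ ∈ scheme T t k ℓ un um X, τ.LogExact LR JR (L τ)) :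
    ExpConv fun K => localQuad T t k ℓ LR JR L un um X K - localEntry T t k ℓ un um X := by
  have := expConv_exactSum (legConv_scheme h LR k ℓ un um X) hL
  rwa [exactSum_scheme h] at this

/-! ### The kernel as a cosine series -/

/-- The odd cosine series `2 ∑ r^(2k+1) cos((2k+1)θ)/(2k+1)`, in closed form. -/
noncomputable def oddCosSum (r θ : ℝ) : ℝ :=
  (Real.log (1 + 2 * r * Real.cos θ + r ^ 2) - Real.log (1 - 2 * r * Real.cos θ + r ^ 2)) / 2

theorem hasSum_log_sub_log_complex {z : ℂ} (h : ‖z‖ < 1) :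
    HasSum (fun k : ℕ => 2 / (2 * k + 1) * z ^ (2 * k + 1))
      (Complex.log (1 + z) - Complex.log (1 - z)) := by
  set term := fun n : ℕ => (-1) ^ (n + 1) * z ^ n / n + z ^ n / n
  have hinj : Function.Injective fun k : ℕ => 2 * k + 1 := fun a b hab => by simpa using hab
  have hterm : term ∘ (fun k => 2 * k + 1) = fun k : ℕ => 2 / (2 * k + 1) * z ^ (2 * k + 1) := by
    ext n
    dsimp only [term, Function.comp]
    rw [Even.neg_one_pow (⟨n + 1, by ring⟩ : Even (2 * n + 1 + 1))]
    push_cast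
    ring
  rw [← hterm, hinj.hasSum_iff]
  · rw [sub_eq_add_neg]
    exact (Complex.hasSum_taylorSeries_log h).add (Complex.hasSum_taylorSeries_neg_log h)
  · intro m hm
    have : Even m := by
      rw [← Nat.not_odd_iff_even]
      rintro ⟨k, rfl⟩
      exact hm ⟨k, rfl⟩
    dsimp only [term]
    rw [Odd.neg_one_pow this.add_one]
    ring

theorem hasSum_oddCosSum {r : ℝ} (h0 : 0 ≤ r) (h1 : r < 1) (θ : ℝ) :
    HasSum (fun k : ℕ => 2 / (2 * k + 1) * r ^ (2 * k + 1) * Real.cos ((2 * k + 1) * θ))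
      (oddCosSum r θ) := by
  set z : ℂ := r * Complex.exp (θ * Complex.I) with hz
  have hn : ‖z‖ < 1 := by
    rw [hz, norm_mul, Complex.norm_exp_ofReal_mul_I, mul_one, Complex.norm_real]
    simpa [abs_of_nonneg h0] using h1
  have := Complex.hasSum_re (hasSum_log_sub_log_complex hn)
  convert this using 1
  · ext k
    have e : z ^ (2 * k + 1) = (r ^ (2 * k + 1) : ℝ) * Complex.exp (((2 * k + 1) * θ : ℝ) *
        Complex.I) := by
      rw [hz, mul_pow, ← Complex.exp_nat_mul]
      push_cast
      ring_nf
    have e2 : (2 / (2 * k + 1) : ℂ) = ((2 / (2 * k + 1) : ℝ) : ℂ) := by push_cast; rfl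
    rw [e, e2, Complex.re_ofReal_mul, Complex.re_ofReal_mul, Complex.exp_ofReal_mul_I_re]
    ring
  · have hr : z = ⟨r * Real.cos θ, r * Real.sin θ⟩ := by
      rw [hz]
      apply Complex.ext <;> simp [Complex.exp_ofReal_mul_I_re, Complex.exp_ofReal_mul_I_im]
    have hcs := Real.sin_sq_add_cos_sq θ
    have n1 : Complex.normSq (1 + z) = 1 + 2 * r * Real.cos θ + r ^ 2 := by
      rw [hr, Complex.normSq_apply]; simp only [Complex.add_re, Complex.one_re, Complex.add_im,
        Complex.one_im]; linear_combination r ^ 2 * hcs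
    have n2 : Complex.normSq (1 - z) = 1 - 2 * r * Real.cos θ + r ^ 2 := by
      rw [hr, Complex.normSq_apply]; simp only [Complex.sub_re, Complex.one_re, Complex.sub_im,
        Complex.one_im]; linear_combination r ^ 2 * hcs
    rw [Complex.sub_re, Complex.log_re, Complex.log_re, oddCosSum, ← n1, ← n2,
      Complex.normSq_eq_norm_sq, Complex.normSq_eq_norm_sq, Real.log_pow, Real.log_pow]
    push_cast; ring

/-- The function `ln tan(πu/(4T))`, with the value zero at the singularities. -/
noncomputable def logTan (T u : ℝ) : ℝ := Real.log (Real.tan (Real.pi * u / (4 * T)))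

theorem logTan_eq (T u : ℝ) : logTan T u =
    Real.log (Real.sin (Real.pi * u / (4 * T))) - Real.log (Real.cos (Real.pi * u / (4 * T))) := by
  set x := Real.pi * u / (4 * T) with hx
  rw [logTan, ← hx, Real.tan_eq_sin_div_cos]
  have hsq := Real.sin_sq_add_cos_sq x
  by_cases hs : Real.sin x = 0
  · have : Real.cos x = 1 ∨ Real.cos x = -1 := by
      rw [← sq_eq_one_iff]; rw [hs] at hsq; linarith
    rcases this with h | h <;> simp [hs, h]
  by_cases hc : Real.cos x = 0
  · have : Real.sin x = 1 ∨ Real.sin x = -1 := by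
      rw [← sq_eq_one_iff]; rw [hc] at hsq; linarith
    rcases this with h | h <;> simp [hc, h]
  exact Real.log_div hs hc

theorem intervalIntegrable_logTan {T : ℝ} (hT : 0 < T) (a b : ℝ) :
    IntervalIntegrable (logTan T) volume a b := by
  have hc : Real.pi / (4 * T) ≠ 0 := by have := Real.pi_pos; positivity
  have h1 := (intervalIntegrable_log_sin (a := Real.pi / (4 * T) * a)
    (b := Real.pi / (4 * T) * b)).comp_mul_left (c := Real.pi / (4 * T))
  have h2 := (intervalIntegrable_log_cos (a := Real.pi / (4 * T) * a)
    (b := Real.pi / (4 * T) * b)).comp_mul_left (c := Real.pi / (4 * T))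
  rw [mul_div_cancel_left₀ _ hc, mul_div_cancel_left₀ _ hc] at h1 h2
  refine (h1.sub h2).congr_ae (Eventually.of_forall fun x => ?_)
  simp only [Function.comp, logTan_eq]
  ring_nf

/-- The closed form increases in absolute value with `r`, and its limit at `r = 1` is a logarithm of
the tangent of the half angle. -/
theorem oddCosSum_bound {r θ : ℝ} (h0 : 0 ≤ r) (h1 : r < 1) {T : ℝ} (hT : 0 < T) {u : ℝ}
    (hu : θ = Real.pi * u / (2 * T)) (hθ : Real.sin θ ≠ 0) :
    |oddCosSum r θ| ≤ |logTan T u| ∧ oddCosSum 1 θ = -logTan T u := by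
  set x := Real.pi * u / (4 * T) with hx
  have hθx : θ = 2 * x := by rw [hu, hx]; field_simp; ring
  have hsx : Real.sin x ≠ 0 := fun h => hθ (by rw [hθx, Real.sin_two_mul, h]; ring)
  have hcx : Real.cos x ≠ 0 := fun h => hθ (by rw [hθx, Real.sin_two_mul, h]; ring)
  set c := Real.cos θ with hc
  have hP : 1 + c = 2 * Real.cos x ^ 2 := by rw [hc, hθx, Real.cos_two_mul]; ring
  have hQ : 1 - c = 2 * Real.sin x ^ 2 := by
    rw [hc, hθx, Real.cos_two_mul, Real.cos_sq']; ring
  have hP0 : 0 < 1 + c := by rw [hP]; positivity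
  have hQ0 : 0 < 1 - c := by rw [hQ]; positivity
  have e : (Real.log (1 + c) - Real.log (1 - c)) / 2 = -logTan T u := by
    rw [logTan_eq, ← hx, hP, hQ, Real.log_mul (by norm_num) (by positivity),
      Real.log_mul (by norm_num) (by positivity), Real.log_pow, Real.log_pow]
    push_cast; ring
  constructor
  · rw [← abs_neg (logTan T u), ← e, oddCosSum, abs_div, abs_div]
    refine div_le_div_of_nonneg_right ?_ (abs_nonneg _)
    have hA : 0 < 1 + 2 * r * c + r ^ 2 := by nlinarith [sq_nonneg (1 - r), mul_nonneg h0 hP0.le]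
    have hB : 0 < 1 - 2 * r * c + r ^ 2 := by nlinarith [sq_nonneg (1 - r), mul_nonneg h0 hQ0.le]
    have hr : 0 < (1 - r) ^ 2 := by have : 0 < 1 - r := by linarith
                                    positivity
    rcases le_total 0 c with h | h
    · have l1 : Real.log (1 - 2 * r * c + r ^ 2) ≤ Real.log (1 + 2 * r * c + r ^ 2) :=
        Real.log_le_log hB (by nlinarith [mul_nonneg h0 h])
      have l2 : Real.log (1 + 2 * r * c + r ^ 2) + Real.log (1 - c) ≤
          Real.log (1 + c) + Real.log (1 - 2 * r * c + r ^ 2) := by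
        rw [← Real.log_mul hA.ne' hQ0.ne', ← Real.log_mul hP0.ne' hB.ne']
        exact Real.log_le_log (mul_pos hA hQ0) (by nlinarith [mul_nonneg h hr.le])
      rw [abs_of_nonneg (by linarith), abs_of_nonneg (by linarith)]
      linarith
    · have l1 : Real.log (1 + 2 * r * c + r ^ 2) ≤ Real.log (1 - 2 * r * c + r ^ 2) :=
        Real.log_le_log hA (by nlinarith [mul_nonneg h0 (neg_nonneg.2 h)])
      have l2 : Real.log (1 + c) + Real.log (1 - 2 * r * c + r ^ 2) ≤
          Real.log (1 + 2 * r * c + r ^ 2) + Real.log (1 - c) := by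
        rw [← Real.log_mul hA.ne' hQ0.ne', ← Real.log_mul hP0.ne' hB.ne']
        exact Real.log_le_log (mul_pos hP0 hB) (by nlinarith [mul_nonneg (neg_nonneg.2 h) hr.le])
      rw [abs_of_nonpos (by linarith), abs_of_nonpos (by linarith)]
      linarith
  · rw [← e, oddCosSum, ← hc]
    have e1 : 1 + 2 * 1 * c + 1 ^ 2 = 2 * (1 + c) := by ring
    have e2 : 1 - 2 * 1 * c + 1 ^ 2 = 2 * (1 - c) := by ring
    rw [e1, e2, Real.log_mul (by norm_num) hP0.ne', Real.log_mul (by norm_num) hQ0.ne']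
    ring

theorem ae_sin_ne_zero {a : ℝ} (ha : a ≠ 0) (b : ℝ) : ∀ᵐ t : ℝ, Real.sin (a * t + b) ≠ 0 := by
  have hc : {t : ℝ | Real.sin (a * t + b) = 0}.Countable := by
    refine (countable_range fun n : ℤ => (n * Real.pi - b) / a).mono ?_
    intro t ht
    obtain ⟨n, hn⟩ := Real.sin_eq_zero_iff.1 ht
    exact ⟨n, by simp only [hn]; field_simp; ring⟩
  exact (compl_mem_ae_iff.2 (hc.measure_zero volume))

/-- The kernel of the modified Hilbert transformation, as a sum of two functions of one variable;
it agrees with `kern` off the singularities. -/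
noncomputable def sumKern (T s t : ℝ) : ℝ := -(1 / Real.pi) * (logTan T (s + t) + logTan T (t - s))

theorem intervalIntegrable_logTan_shift {T : ℝ} (hT : 0 < T) (s c d : ℝ) :
    IntervalIntegrable (fun t => logTan T (s + t)) volume c d ∧
    IntervalIntegrable (fun t => logTan T (t - s)) volume c d := by
  constructor
  · simpa using (intervalIntegrable_logTan hT (s + c) (s + d)).comp_add_left s
  · simpa using (intervalIntegrable_logTan hT (c - s) (d - s)).comp_sub_right s

theorem freq_eq (T : ℝ) (k : ℕ) : freq T k = (2 * k + 1) * (Real.pi / (2 * T)) := by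
  rw [freq]; ring

theorem freq_pos {T : ℝ} (hT : 0 < T) (k : ℕ) : 0 < freq T k := by
  have := Real.pi_pos
  rw [freq_eq]; positivity

theorem hasSum_integral_mul {g : ℕ → ℝ → ℝ} (hg : ∀ n, Continuous (g n)) {B : ℕ → ℝ}
    (hB : Summable B) (hb : ∀ n x, |g n x| ≤ B n) {w : ℝ → ℝ} (hw : Continuous w) {G : ℝ → ℝ}
    (hG : ∀ x, HasSum (fun n => g n x) (G x)) (a b : ℝ) :
    HasSum (fun n => ∫ x in a..b, w x * g n x) (∫ x in a..b, w x * G x) := by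
  refine intervalIntegral.hasSum_integral_of_dominated_convergence (fun n x => |w x| * B n)
    (fun n => (hw.mul (hg n)).aestronglyMeasurable) (fun n => Eventually.of_forall fun x _ => ?_)
    (Eventually.of_forall fun x _ => hB.mul_left _) ?_
    (Eventually.of_forall fun x _ => (hG x).mul_left _)
  · rw [Real.norm_eq_abs, abs_mul]
    exact mul_le_mul_of_nonneg_left (hb n x) (abs_nonneg _)
  · simp_rw [tsum_mul_left]
    exact (hw.abs.mul continuous_const).intervalIntegrable _ _

theorem coef_eq {T : ℝ} (hT : 0 < T) (k : ℕ) :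
    2 / (T * freq T k) = 2 / Real.pi * (2 / (2 * k + 1)) := by
  have := Real.pi_pos
  rw [freq_eq]; field_simp

theorem hasSum_abel_kernel {T : ℝ} (hT : 0 < T) {r : ℝ} (h0 : 0 ≤ r) (h1 : r < 1) (s t : ℝ) :
    HasSum (fun k : ℕ => r ^ (2 * k + 1) * (2 / (T * freq T k)) * Real.cos (freq T k * s) *
        Real.cos (freq T k * t))
      (1 / Real.pi * (oddCosSum r (Real.pi * (s + t) / (2 * T)) +
        oddCosSum r (Real.pi * (t - s) / (2 * T)))) := by
  refine (((hasSum_oddCosSum h0 h1 _).add (hasSum_oddCosSum h0 h1 _)).mul_left _).congr_fun ?_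
  intro k
  have e1 : (2 * k + 1) * (Real.pi * (s + t) / (2 * T)) = freq T k * t + freq T k * s := by
    rw [freq_eq]; ring
  have e2 : (2 * k + 1) * (Real.pi * (t - s) / (2 * T)) = freq T k * t - freq T k * s := by
    rw [freq_eq]; ring
  rw [e1, e2, coef_eq hT, Real.cos_add, Real.cos_sub]
  ring

/-- Integration by parts: an oscillating factor with a small antiderivative makes the integral of
a polynomial small. -/
theorem abs_integral_mul_le_of_antideriv (w : ℝ[X]) (c d : ℝ) :
    ∃ C, 0 ≤ C ∧ ∀ (f : ℝ) (g G : ℝ → ℝ), 0 < f → Continuous g →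
      (∀ x, HasDerivAt (fun x => G x / f) (g x) x) → (∀ x, |G x| ≤ 1) →
      |∫ t in c..d, w.eval t * g t| ≤ C / f := by
  refine ⟨|w.eval d| + |w.eval c| + |(∫ t in c..d, |w.derivative.eval t|)|, by positivity,
    fun f g G hf hg hd hG => ?_⟩
  have := intervalIntegral.integral_mul_deriv_eq_deriv_mul (a := c) (b := d)
    (fun x _ => w.hasDerivAt x) (fun x _ => hd x)
    (w.derivative.continuous.intervalIntegrable _ _) (hg.intervalIntegrable _ _)
  rw [this]
  have b1 : ∀ y z : ℝ, |y * (G z / f)| ≤ |y| / f := fun y z => by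
    rw [abs_mul, abs_div, abs_of_pos hf, ← mul_div_assoc]
    exact div_le_div_of_nonneg_right (mul_le_of_le_one_right (abs_nonneg _) (hG z)) hf.le
  have b2 : |∫ x in c..d, w.derivative.eval x * (G x / f)| ≤
      |(∫ t in c..d, |w.derivative.eval t|)| / f := by
    have := intervalIntegral.norm_integral_le_abs_of_norm_le (a := c) (b := d)
      (μ := volume) (f := fun x => w.derivative.eval x * (G x / f))
      (g := fun x => |w.derivative.eval x| / f) (Eventually.of_forall fun x => b1 _ _)
      ((w.derivative.continuous.abs.div_const f).intervalIntegrable _ _)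
    rw [intervalIntegral.integral_div, abs_div, abs_of_pos hf] at this
    exact this
  calc _ ≤ |w.eval d| / f + |w.eval c| / f + |(∫ t in c..d, |w.derivative.eval t|)| / f :=
        (abs_sub _ _).trans (add_le_add ((abs_sub _ _).trans (add_le_add (b1 _ _) (b1 _ _))) b2)
    _ = _ := by ring

theorem hasDerivAt_sin_div {f : ℝ} (hf : f ≠ 0) (x : ℝ) :
    HasDerivAt (fun t => Real.sin (f * t) / f) (Real.cos (f * x)) x := by
  have := ((Real.hasDerivAt_sin (f * x)).comp x ((hasDerivAt_id x).const_mul f)).div_const f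
  refine HasDerivAt.congr_deriv this ?_
  field_simp

theorem hasDerivAt_neg_cos_div {f : ℝ} (hf : f ≠ 0) (x : ℝ) :
    HasDerivAt (fun t => -Real.cos (f * t) / f) (Real.sin (f * x)) x := by
  have := ((Real.hasDerivAt_cos (f * x)).comp x ((hasDerivAt_id x).const_mul f)).neg.div_const f
  refine HasDerivAt.congr_deriv this ?_
  field_simp

theorem integral_mul_cos_bound (w : ℝ[X]) (c d : ℝ) :
    ∃ C, 0 ≤ C ∧ ∀ f : ℝ, 0 < f → |∫ t in c..d, w.eval t * Real.cos (f * t)| ≤ C / f := by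
  obtain ⟨C, hC, h⟩ := abs_integral_mul_le_of_antideriv w c d
  exact ⟨C, hC, fun f hf => h f _ (fun x => Real.sin (f * x)) hf (by fun_prop)
    (fun x => hasDerivAt_sin_div hf.ne' x) fun x => Real.abs_sin_le_one _⟩

theorem integral_mul_sin_bound (w : ℝ[X]) (c d : ℝ) :
    ∃ C, 0 ≤ C ∧ ∀ f : ℝ, 0 < f → |∫ t in c..d, w.eval t * Real.sin (f * t)| ≤ C / f := by
  obtain ⟨C, hC, h⟩ := abs_integral_mul_le_of_antideriv w c d
  exact ⟨C, hC, fun f hf => h f _ (fun x => -Real.cos (f * x)) hf (by fun_prop)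
    (fun x => hasDerivAt_neg_cos_div hf.ne' x) fun x => by
      rw [abs_neg]; exact Real.abs_cos_le_one _⟩

theorem summable_one_div_odd_sq : Summable fun k : ℕ => 1 / (2 * (k : ℝ) + 1) ^ 2 := by
  have h := (Real.summable_one_div_nat_pow (p := 2)).2 (by norm_num)
  have := h.comp_injective (i := fun k : ℕ => 2 * k + 1) fun a b hab => by simpa using hab
  simpa [Function.comp_def] using this

theorem freq_inv_sq_summable {T : ℝ} : Summable fun k => 1 / freq T k ^ 2 := by
  have := summable_one_div_odd_sq.mul_left ((1 / (Real.pi / (2 * T))) ^ 2)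
  refine this.congr fun k => ?_
  rw [freq_eq]
  simp only [one_div, mul_pow, mul_inv, inv_pow]
  ring

/-- Abel summation of the cosine series of the kernel along a line: for `r < 1` the series converges
uniformly, so that it may be integrated termwise; the integrals converge as `r → 1` since `oddCosSum` is
dominated by its limit, and their sums do since the coefficients are of order `1 / k²`. -/
theorem hasSum_sumKern {T : ℝ} (hT : 0 < T) (w : ℝ[X]) (c d s : ℝ) :
    HasSum (fun k : ℕ => 2 / (T * freq T k) * (∫ t in c..d, w.eval t * Real.cos (freq T k * t)) *
      Real.cos (freq T k * s)) (∫ t in c..d, w.eval t * sumKern T s t) := by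
  have hpi := Real.pi_pos
  obtain ⟨C, hC, hβ⟩ := integral_mul_cos_bound w c d
  set β := fun k => ∫ t in c..d, w.eval t * Real.cos (freq T k * t) with hβd
  have hbd : ∀ k : ℕ, |2 / (T * freq T k) * β k * Real.cos (freq T k * s)| ≤
      2 / T * C * (1 / freq T k ^ 2) := by
    intro k
    have hf := freq_pos hT k
    rw [abs_mul, abs_mul, abs_of_pos (by positivity)]
    calc _ ≤ 2 / (T * freq T k) * (C / freq T k) * 1 := by
          gcongr
          · exact hβ _ hf
          · exact Real.abs_cos_le_one _
      _ = _ := by field_simp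
  have hsum : Summable fun k : ℕ => 2 / T * C * (1 / freq T k ^ 2) :=
    freq_inv_sq_summable.mul_left _
  have hsum' : Summable fun k : ℕ => 2 / (T * freq T k) * β k * Real.cos (freq T k * s) :=
    Summable.of_norm_bounded hsum hbd
  have hev : ∀ᶠ r : ℝ in 𝓝[<] 1, 0 ≤ r ∧ r < 1 := by
    filter_upwards [Ioo_mem_nhdsLT (show (0 : ℝ) < 1 by norm_num)] with r hr
    exact ⟨hr.1.le, hr.2⟩
  -- the Abel sums tend to the sum of the series
  have lim1 : Tendsto (fun r : ℝ => ∑' k : ℕ, r ^ (2 * k + 1) *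
      (2 / (T * freq T k) * β k * Real.cos (freq T k * s))) (𝓝[<] 1)
      (𝓝 (∑' k : ℕ, 2 / (T * freq T k) * β k * Real.cos (freq T k * s))) := by
    refine tendsto_tsum_of_dominated_convergence hsum (fun k => ?_) ?_
    · have : Tendsto (fun r : ℝ => r ^ (2 * k + 1)) (𝓝[<] 1) (𝓝 (1 ^ (2 * k + 1))) :=
        ((continuous_pow _).tendsto 1).mono_left nhdsWithin_le_nhds
      simpa using this.mul_const (2 / (T * freq T k) * β k * Real.cos (freq T k * s))
    · filter_upwards [hev] with r hr k
      rw [norm_mul, norm_pow, Real.norm_eq_abs, abs_of_nonneg hr.1]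
      exact (mul_le_of_le_one_left (norm_nonneg _) (pow_le_one₀ hr.1 hr.2.le)).trans (hbd k)
  -- for `r < 1` they are integrals of the closed form
  have heq : ∀ r : ℝ, 0 ≤ r → r < 1 → ∑' k : ℕ, r ^ (2 * k + 1) *
      (2 / (T * freq T k) * β k * Real.cos (freq T k * s)) =
      ∫ t in c..d, w.eval t * (1 / Real.pi * (oddCosSum r (Real.pi * (s + t) / (2 * T)) +
        oddCosSum r (Real.pi * (t - s) / (2 * T)))) := by
    intro r h0 h1
    refine HasSum.tsum_eq ?_
    have hB : Summable fun k : ℕ => (2 / Real.pi * 2) * r ^ k :=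
      (summable_geometric_of_lt_one h0 h1).mul_left _
    have := hasSum_integral_mul (g := fun k t => r ^ (2 * k + 1) * (2 / (T * freq T k)) *
      Real.cos (freq T k * s) * Real.cos (freq T k * t)) (fun k => by fun_prop) hB
      (fun k t => ?_) w.continuous (fun t => hasSum_abel_kernel hT h0 h1 s t) c d
    · refine this.congr_fun fun k => ?_
      rw [hβd, ← intervalIntegral.integral_const_mul, ← intervalIntegral.integral_mul_const,
        ← intervalIntegral.integral_const_mul]
      congr 1; ext t; ring
    · have h2 : (2 : ℝ) / (2 * k + 1) ≤ 2 := by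
        rw [div_le_iff₀ (by positivity)]; nlinarith [(Nat.cast_nonneg k : (0 : ℝ) ≤ k)]
      rw [coef_eq hT, abs_mul, abs_mul, abs_mul, abs_of_nonneg (by positivity : 0 ≤ r ^ (2 * k + 1)),
        abs_of_pos (by positivity)]
      have hp : r ^ (2 * k + 1) ≤ r ^ k := pow_le_pow_of_le_one h0 h1.le (by omega)
      calc _ ≤ r ^ k * (2 / Real.pi * 2) * 1 * 1 :=
            mul_le_mul (mul_le_mul (mul_le_mul hp (by gcongr) (by positivity) (by positivity))
              (Real.abs_cos_le_one _) (abs_nonneg _) (by positivity))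
              (Real.abs_cos_le_one _) (abs_nonneg _) (by positivity)
        _ = _ := by ring
  have hcπ : Real.pi / (2 * T) ≠ 0 := by positivity
  have hae : ∀ᵐ t : ℝ, Real.sin (Real.pi * (s + t) / (2 * T)) ≠ 0 ∧
      Real.sin (Real.pi * (t - s) / (2 * T)) ≠ 0 := by
    filter_upwards [ae_sin_ne_zero hcπ (Real.pi / (2 * T) * s),
      ae_sin_ne_zero hcπ (-(Real.pi / (2 * T) * s))] with t h1 h2
    have e1 : Real.pi * (s + t) / (2 * T) = Real.pi / (2 * T) * t + Real.pi / (2 * T) * s := by ring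
    have e2 : Real.pi * (t - s) / (2 * T) = Real.pi / (2 * T) * t + -(Real.pi / (2 * T) * s) := by
      ring
    rw [e1, e2]
    exact ⟨h1, h2⟩
  have lim2 : Tendsto (fun r : ℝ => ∫ t in c..d, w.eval t * (1 / Real.pi *
      (oddCosSum r (Real.pi * (s + t) / (2 * T)) + oddCosSum r (Real.pi * (t - s) / (2 * T)))))
      (𝓝[<] 1) (𝓝 (∫ t in c..d, w.eval t * sumKern T s t)) := by
    obtain ⟨i1, i2⟩ := intervalIntegrable_logTan_shift hT s c d
    refine intervalIntegral.tendsto_integral_filter_of_dominated_convergence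
      (fun t => |w.eval t| * (1 / Real.pi * (|logTan T (s + t)| + |logTan T (t - s)|)))
      (Eventually.of_forall fun r => ?_) ?_
      (((i1.abs.add i2.abs).const_mul _).continuousOn_mul w.continuous.abs.continuousOn) ?_
    · refine Measurable.aestronglyMeasurable ?_
      have := w.continuous.measurable
      unfold oddCosSum
      fun_prop
    · filter_upwards [hev] with r hr
      filter_upwards [hae] with t ht _
      rw [Real.norm_eq_abs, abs_mul, abs_mul, abs_of_pos (by positivity : 0 < 1 / Real.pi)]
      gcongr
      exact (abs_add_le _ _).trans (add_le_add (oddCosSum_bound hr.1 hr.2 hT rfl ht.1).1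
        (oddCosSum_bound hr.1 hr.2 hT rfl ht.2).1)
    · filter_upwards [hae] with t ht _
      have hlim : ∀ u : ℝ, Real.sin (Real.pi * u / (2 * T)) ≠ 0 →
          Tendsto (fun r => oddCosSum r (Real.pi * u / (2 * T))) (𝓝[<] 1) (𝓝 (-logTan T u)) := by
        intro u hu
        rw [← (oddCosSum_bound le_rfl one_pos hT rfl hu).2]
        refine Tendsto.mono_left (ContinuousAt.tendsto ?_) nhdsWithin_le_nhds
        have hc1 := Real.neg_one_le_cos (Real.pi * u / (2 * T))
        have hc2 := Real.cos_le_one (Real.pi * u / (2 * T))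
        have hne : Real.cos (Real.pi * u / (2 * T)) ^ 2 ≠ 1 := fun h => hu (by
          have := Real.sin_sq_add_cos_sq (Real.pi * u / (2 * T))
          rw [h] at this
          exact pow_eq_zero_iff two_ne_zero |>.1 (by linarith))
        unfold oddCosSum
        refine ((ContinuousAt.log (by fun_prop) ?_).sub (ContinuousAt.log (by fun_prop) ?_)).div_const _
        · intro h; apply hne; nlinarith
        · intro h; apply hne; nlinarith
      have := (((hlim _ ht.1).add (hlim _ ht.2)).const_mul (1 / Real.pi)).const_mul (w.eval t)
      convert this using 2
      rw [sumKern]; ring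
  have : ∑' k : ℕ, 2 / (T * freq T k) * β k * Real.cos (freq T k * s) =
      ∫ t in c..d, w.eval t * sumKern T s t := by
    refine tendsto_nhds_unique lim1 (lim2.congr' ?_)
    filter_upwards [hev] with r hr
    exact (heq r hr.1 hr.2).symm
  rw [← this]
  exact hsum'.hasSum

/-- Integration by parts in each coefficient, and termwise integration against the derivative. -/
theorem hasSum_sin_mul_cos {T : ℝ} (hT : 0 < T) (v w : ℝ[X]) (a b c d : ℝ) :
    HasSum (fun k : ℕ => 2 / T * (∫ x in a..b, v.eval x * Real.sin (freq T k * x)) *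
        ∫ x in c..d, w.eval x * Real.cos (freq T k * x))
      (v.eval a * (∫ t in c..d, w.eval t * sumKern T a t) -
        v.eval b * (∫ t in c..d, w.eval t * sumKern T b t) +
        ∫ s in a..b, v.derivative.eval s * ∫ t in c..d, w.eval t * sumKern T s t) := by
  obtain ⟨C, hC, hβ⟩ := integral_mul_cos_bound w c d
  have hB : Summable fun k : ℕ => 2 / T * C * (1 / freq T k ^ 2) :=
    freq_inv_sq_summable.mul_left _
  have h3 := hasSum_integral_mul (g := fun k s => 2 / (T * freq T k) *
    (∫ t in c..d, w.eval t * Real.cos (freq T k * t)) * Real.cos (freq T k * s))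
    (fun k => by fun_prop) hB (fun k s => ?_) v.derivative.continuous
    (fun s => hasSum_sumKern hT w c d s) a b
  · refine ((((hasSum_sumKern hT w c d a).mul_left (v.eval a)).sub
      ((hasSum_sumKern hT w c d b).mul_left (v.eval b))).add h3).congr_fun fun k => ?_
    have hf := freq_pos hT k
    have := intervalIntegral.integral_mul_deriv_eq_deriv_mul (a := a) (b := b)
      (fun x _ => v.hasDerivAt x) (fun x _ => hasDerivAt_neg_cos_div hf.ne' x)
      (v.derivative.continuous.intervalIntegrable _ _)
      ((by fun_prop : Continuous fun x => Real.sin (freq T k * x)).intervalIntegrable _ _)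
    have e : ∀ β : ℝ, ∫ x in a..b, v.derivative.eval x * (2 / (T * freq T k) * β *
        Real.cos (freq T k * x)) = -(2 / T * β) * ∫ x in a..b, v.derivative.eval x *
          (-Real.cos (freq T k * x) / freq T k) := fun β => by
      rw [← intervalIntegral.integral_const_mul]
      congr 1; ext x; field_simp
    rw [this, e]
    field_simp
    ring
  · have hf := freq_pos hT k
    rw [abs_mul, abs_mul, abs_of_pos (by positivity)]
    calc _ ≤ 2 / (T * freq T k) * (C / freq T k) * 1 := by
          gcongr
          · exact hβ _ hf
          · exact Real.abs_cos_le_one _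
      _ = _ := by field_simp

/-! ### Convergence of the modified Hilbert transformation in `L²` -/

theorem integral_cos_mul_eq_zero {T g : ℝ} (hg : g ≠ 0) (n : ℤ) (hgT : g * T = n * Real.pi) :
    ∫ x in (0 : ℝ)..T, Real.cos (g * x) = 0 := by
  have := intervalIntegral.integral_eq_sub_of_hasDerivAt (a := 0) (b := T)
    (fun x _ => hasDerivAt_sin_div hg x)
    ((by fun_prop : Continuous fun x => Real.cos (g * x)).intervalIntegrable _ _)
  rw [this, hgT, Real.sin_int_mul_pi]
  simp

theorem integral_cos_freq_mul_cos_freq {T : ℝ} (hT : 0 < T) (j k : ℕ) :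
    ∫ x in (0 : ℝ)..T, Real.cos (freq T j * x) * Real.cos (freq T k * x) =
      if j = k then T / 2 else 0 := by
  have hpi := Real.pi_pos
  have e : ∀ x, Real.cos (freq T j * x) * Real.cos (freq T k * x) =
      1 / 2 * (Real.cos ((freq T j + freq T k) * x) + Real.cos ((freq T j - freq T k) * x)) := by
    intro x
    rw [add_mul, sub_mul, Real.cos_add, Real.cos_sub]; ring
  have i : ∀ g : ℝ, IntervalIntegrable (fun x => Real.cos (g * x)) volume 0 T := fun g =>
    (by fun_prop : Continuous fun x => Real.cos (g * x)).intervalIntegrable _ _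
  have h1 : ∫ x in (0 : ℝ)..T, Real.cos ((freq T j + freq T k) * x) = 0 := by
    refine integral_cos_mul_eq_zero (add_pos (freq_pos hT j) (freq_pos hT k)).ne' (j + k + 1) ?_
    rw [freq_eq, freq_eq]; push_cast; field_simp; ring
  simp_rw [e]
  rw [intervalIntegral.integral_const_mul, intervalIntegral.integral_add (i _) (i _), h1]
  split_ifs with h
  · subst h; simp; ring
  · rw [integral_cos_mul_eq_zero (n := j - k)]
    · simp
    · rw [freq_eq, freq_eq, ← sub_mul]
      refine mul_ne_zero ?_ (by positivity)
      intro h0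
      exact h (by exact_mod_cast (by linarith : (j : ℝ) = k))
    · rw [freq_eq, freq_eq]; push_cast; field_simp; ring

theorem inner_toLp {T : ℝ} {g : ℝ → ℝ} (hg : MemLp g 2 (vol T)) (u : Lp ℝ 2 (vol T)) :
    inner ℝ (hg.toLp g) u = ∫ x in Ioo 0 T, g x * u x := by
  rw [L2.inner_def]
  refine integral_congr_ae ?_
  filter_upwards [hg.coeFn_toLp] with x hx
  rw [hx, RCLike.inner_apply, conj_trivial, mul_comm]

theorem inner_toLp_cosLp {T : ℝ} {g : ℝ → ℝ} (hg : MemLp g 2 (vol T)) (k : ℕ) :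
    inner ℝ (hg.toLp g) (cosLp T k) = ∫ x in Ioo 0 T, g x * Real.cos (freq T k * x) := by
  rw [inner_toLp]
  refine integral_congr_ae ?_
  filter_upwards [(memLp_cos T k).coeFn_toLp] with x hx
  rw [cosLp, hx]

theorem inner_cosLp {T : ℝ} (hT : 0 < T) (j k : ℕ) :
    inner ℝ (cosLp T j) (cosLp T k) = if j = k then T / 2 else 0 := by
  rw [cosLp, inner_toLp_cosLp, ← integral_cos_freq_mul_cos_freq hT j k,
    intervalIntegral.integral_of_le hT.le, integral_Ioc_eq_integral_Ioo]

theorem orthonormal_cosLp {T : ℝ} (hT : 0 < T) :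
    Orthonormal ℝ fun k => √(2 / T) • cosLp T k := by
  rw [orthonormal_iff_ite]
  intro j k
  rw [inner_smul_left, inner_smul_right, inner_cosLp hT, conj_trivial, ← mul_assoc,
    Real.mul_self_sqrt (by positivity)]
  split_ifs
  · field_simp
  · simp

/-- The series that defines the modified Hilbert transformation converges, and may be tested
termwise. -/
theorem hasSum_integral_mul_modHilbert {T : ℝ} (hT : 0 < T) {f g : ℝ → ℝ}
    (hf : Summable fun k => sinCoeff T f k ^ 2) (hg : MemLp g 2 (vol T)) :
    HasSum (fun k => sinCoeff T f k * ∫ x in Ioo 0 T, g x * Real.cos (freq T k * x))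
      (∫ x in Ioo 0 T, g x * modHilbert T f x) := by
  have hs : Summable fun k => sinCoeff T f k • cosLp T k := by
    have := ((orthonormal_cosLp hT).orthogonalFamily.summable_iff_norm_sq_summable
      fun k => sinCoeff T f k * √(T / 2)).2
        ((hf.mul_right (T / 2)).congr fun k => by
          rw [Real.norm_eq_abs, sq_abs, mul_pow, Real.sq_sqrt (by positivity)])
    refine this.congr fun k => ?_
    rw [LinearIsometry.toSpanSingleton_apply, smul_smul, mul_assoc,
      ← Real.sqrt_mul (by positivity)]
    have : T / 2 * (2 / T) = 1 := by field_simp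
    rw [this, Real.sqrt_one, mul_one]
  have := hs.hasSum.mapL (innerSL ℝ (hg.toLp g))
  simp only [innerSL_apply_apply, inner_smul_right, inner_toLp_cosLp] at this
  rwa [← inner_toLp hg]

/-! ### Piecewise polynomials -/

section Piecewise
variable {T : ℝ} {N : ℕ} {t : Fin (N + 1) → ℝ}

/-- The function `f` is given on the open mesh elements by the polynomials `v`. -/
def IsPiecewise (t : Fin (N + 1) → ℝ) (f : ℝ → ℝ) (v : Fin N → ℝ[X]) : Prop :=
  ∀ ℓ, ∀ x ∈ Ioo (lft t ℓ) (rgt t ℓ), f x = (v ℓ).eval x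

theorem IsMesh.exists_mem_Ioo (h : IsMesh T t) {x : ℝ} (hx : x ∈ Ioo 0 T) (hxt : x ∉ range t) :
    ∃ ℓ, x ∈ Ioo (lft t ℓ) (rgt t ℓ) := by
  have key : ∀ i : Fin (N + 1), x < t i → ∃ ℓ, x ∈ Ioo (lft t ℓ) (rgt t ℓ) := by
    intro i
    induction i using Fin.induction with
    | zero => intro hi; rw [h.zero] at hi; exact absurd hi hx.1.not_gt
    | succ i ih =>
      intro hi
      rcases lt_trichotomy x (t i.castSucc) with hlt | heq | hgt
      · exact ih hlt
      · exact absurd ⟨_, heq.symm⟩ hxt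
      · exact ⟨i, hgt, hi⟩
  exact key (Fin.last N) (h.last ▸ hx.2)

theorem IsMesh.Ioo_ae_eq_iUnion (h : IsMesh T t) :
    Ioo 0 T =ᵐ[volume] ⋃ ℓ, Ioo (lft t ℓ) (rgt t ℓ) := by
  have hn : ∀ᵐ x : ℝ, x ∉ range t :=
    compl_mem_ae_iff.2 ((finite_range t).countable.measure_zero volume)
  rw [eventuallyEq_set]
  filter_upwards [hn] with x hx
  rw [mem_iUnion]
  refine ⟨fun hm => h.exists_mem_Ioo hm hx, fun ⟨ℓ, hℓ⟩ => ?_⟩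
  exact ⟨(h.lft_nonneg ℓ).trans_lt hℓ.1, hℓ.2.trans_le (h.rgt_le ℓ)⟩

theorem IsMesh.pairwise_disjoint (h : IsMesh T t) :
    Pairwise (Function.onFun Disjoint fun ℓ : Fin N => Ioo (lft t ℓ) (rgt t ℓ)) := by
  intro k ℓ hkℓ
  rw [Function.onFun, Set.disjoint_left]
  intro x hk hl
  rcases lt_or_gt_of_ne hkℓ with hlt | hlt
  · exact absurd (hk.2.trans_le (h.rgt_le_lft hlt)) hl.1.not_gt
  · exact absurd (hl.2.trans_le (h.rgt_le_lft hlt)) hk.1.not_gt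

theorem IsPiecewise.memLp (h : IsMesh T t) {f : ℝ → ℝ} {v : Fin N → ℝ[X]}
    (hf : IsPiecewise t f v) : MemLp f 2 (vol T) := by
  have e : vol T = volume.restrict (⋃ ℓ, Ioo (lft t ℓ) (rgt t ℓ)) :=
    Measure.restrict_congr_set h.Ioo_ae_eq_iUnion
  have hb : ∀ ℓ, ∃ C, ∀ x ∈ Icc (lft t ℓ) (rgt t ℓ), |(v ℓ).eval x| ≤ C := fun ℓ =>
    isCompact_Icc.exists_bound_of_continuousOn (v ℓ).continuous.continuousOn
  choose C hC using hb
  refine MemLp.of_bound ?_ (∑ ℓ, |C ℓ|) ?_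
  · rw [e, aestronglyMeasurable_iUnion_iff]
    intro ℓ
    refine (v ℓ).continuous.aestronglyMeasurable.congr ?_
    filter_upwards [ae_restrict_mem measurableSet_Ioo] with x hx
    exact (hf ℓ x hx).symm
  · rw [e]
    filter_upwards [ae_restrict_mem (MeasurableSet.iUnion fun ℓ => measurableSet_Ioo)] with x hx
    obtain ⟨ℓ, hℓ⟩ := mem_iUnion.1 hx
    rw [hf ℓ x hℓ]
    exact ((hC ℓ x (Ioo_subset_Icc_self hℓ)).trans (le_abs_self _)).trans
      (Finset.single_le_sum (f := fun ℓ => |C ℓ|) (fun i _ => abs_nonneg _) (Finset.mem_univ ℓ))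

theorem IsPiecewise.integral_mul (h : IsMesh T t) {f : ℝ → ℝ} {v : Fin N → ℝ[X]}
    (hf : IsPiecewise t f v) {g : ℝ → ℝ} (hg : Continuous g) :
    ∫ x in Ioo 0 T, f x * g x = ∑ ℓ, ∫ x in (lft t ℓ)..(rgt t ℓ), (v ℓ).eval x * g x := by
  have e : ∀ ℓ, EqOn (fun x => f x * g x) (fun x => (v ℓ).eval x * g x)
      (Ioo (lft t ℓ) (rgt t ℓ)) := fun ℓ x hx => by simp only [hf ℓ x hx]
  rw [setIntegral_congr_set h.Ioo_ae_eq_iUnion, integral_iUnion_fintype (fun ℓ => measurableSet_Ioo)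
    h.pairwise_disjoint]
  · refine Finset.sum_congr rfl fun ℓ _ => ?_
    rw [intervalIntegral.integral_of_le (h.lft_lt_rgt ℓ).le, integral_Ioc_eq_integral_Ioo]
    exact setIntegral_congr_fun measurableSet_Ioo (e ℓ)
  · intro ℓ
    refine IntegrableOn.congr_fun ?_ (e ℓ).symm measurableSet_Ioo
    exact (((v ℓ).continuous.mul hg).continuousOn.integrableOn_Icc).mono_set Ioo_subset_Icc_self

theorem IsPiecewise.sinCoeff_eq (h : IsMesh T t) {f : ℝ → ℝ} {v : Fin N → ℝ[X]}
    (hf : IsPiecewise t f v) (k : ℕ) : sinCoeff T f k =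
      ∑ ℓ, 2 / T * ∫ x in (lft t ℓ)..(rgt t ℓ), (v ℓ).eval x * Real.sin (freq T k * x) := by
  rw [sinCoeff, hf.integral_mul h (by fun_prop : Continuous fun x => Real.sin (freq T k * x)),
    Finset.mul_sum]

theorem IsPiecewise.summable_sinCoeff_sq (h : IsMesh T t) {f : ℝ → ℝ} {v : Fin N → ℝ[X]}
    (hf : IsPiecewise t f v) : Summable fun k => sinCoeff T f k ^ 2 := by
  choose C hC hb using fun ℓ => integral_mul_sin_bound (v ℓ) (lft t ℓ) (rgt t ℓ)
  have hT := h.pos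
  refine Summable.of_nonneg_of_le (fun k => sq_nonneg _) (fun k => ?_)
    ((freq_inv_sq_summable (T := T)).mul_left ((2 / T * ∑ ℓ, C ℓ) ^ 2))
  have hk := freq_pos hT k
  have : |sinCoeff T f k| ≤ 2 / T * (∑ ℓ, C ℓ) * (1 / freq T k) := by
    rw [hf.sinCoeff_eq h, Finset.mul_sum, Finset.sum_mul]
    refine (Finset.abs_sum_le_sum_abs _ _).trans (Finset.sum_le_sum fun ℓ _ => ?_)
    rw [abs_mul, abs_of_pos (by positivity), mul_assoc]
    gcongr
    simpa [div_eq_mul_inv] using hb ℓ _ hk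
  rw [← sq_abs]
  calc _ ≤ (2 / T * (∑ ℓ, C ℓ) * (1 / freq T k)) ^ 2 := by gcongr
    _ = _ := by ring

/-- The bilinear form of the modified Hilbert transformation on piecewise polynomials. -/
theorem integral_mul_modHilbert (h : IsMesh T t) {f g : ℝ → ℝ} {v w : Fin N → ℝ[X]}
    (hf : IsPiecewise t f v) (hg : IsPiecewise t g w) :
    ∫ x in Ioo 0 T, g x * modHilbert T f x = ∑ k, ∑ ℓ,
      ((v k).eval (lft t k) *
          (∫ x in (lft t ℓ)..(rgt t ℓ), (w ℓ).eval x * sumKern T (lft t k) x) -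
        (v k).eval (rgt t k) *
          (∫ x in (lft t ℓ)..(rgt t ℓ), (w ℓ).eval x * sumKern T (rgt t k) x) +
        ∫ s in (lft t k)..(rgt t k), (v k).derivative.eval s *
          ∫ x in (lft t ℓ)..(rgt t ℓ), (w ℓ).eval x * sumKern T s x) := by
  refine HasSum.unique (hasSum_integral_mul_modHilbert h.pos (hf.summable_sinCoeff_sq h)
    (hg.memLp h)) ?_
  have := hasSum_sum (s := Finset.univ) fun (k : Fin N) _ =>
    hasSum_sum (s := Finset.univ) fun (ℓ : Fin N) _ =>
      hasSum_sin_mul_cos h.pos (v k) (w ℓ) (lft t k) (rgt t k) (lft t ℓ) (rgt t ℓ)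
  refine this.congr_fun fun n => ?_
  rw [hf.sinCoeff_eq h, hg.integral_mul h
    (by fun_prop : Continuous fun x => Real.cos (freq T n * x)), Finset.sum_mul_sum]

end Piecewise

/-! ### Local representation of the bilinear forms -/

section
variable {T : ℝ} {N : ℕ} {t : Fin (N + 1) → ℝ}

theorem kern_eq_sumKern (hT : 0 < T) {s x : ℝ} (h0 : 0 < s + x) (h2 : s + x < 2 * T) (hne : s ≠ x)
    (hd : |x - s| < 2 * T) : kern T s x = sumKern T s x := by
  have hx : x - s ≠ 0 := sub_ne_zero.2 hne.symm
  have h1 : Real.tan (Real.pi * (s + x) / (4 * T)) ≠ 0 := by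
    rw [tan_eq_tanQuot_mul h0.ne']
    exact mul_ne_zero (tanQuot_pos hT (by rwa [abs_of_pos h0])).ne' h0.ne'
  have h3 : Real.tan (Real.pi * |x - s| / (4 * T)) ≠ 0 := by
    rw [tan_eq_tanQuot_mul (abs_ne_zero.2 hx)]
    exact mul_ne_zero (tanQuot_pos hT (by rwa [abs_abs])).ne' (abs_ne_zero.2 hx)
  have e : Real.log (Real.tan (Real.pi * |x - s| / (4 * T))) = logTan T (x - s) := by
    rw [logTan]
    rcases abs_choice (x - s) with h | h <;> rw [h]
    rw [mul_neg, neg_div, Real.tan_neg, Real.log_neg_eq_log]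
  rw [kern, Real.log_mul h1 h3, e, sumKern]
  rfl

/-- A polynomial on the reference interval `[0,1]`, transported to the element `k`. -/
noncomputable def localPoly (t : Fin (N + 1) → ℝ) (k : Fin N) (q : ℝ[X]) : ℝ[X] :=
  q.comp (C (1 / msize t k) * (X - C (lft t k)))

theorem eval_localPoly (k : Fin N) (q : ℝ[X]) (x : ℝ) :
    (localPoly t k q).eval x = q.eval ((x - lft t k) / msize t k) := by
  rw [localPoly, eval_comp]
  congr 1
  simp only [eval_mul, eval_sub, eval_C, eval_X]
  ring

theorem derivative_localPoly (k : Fin N) (q : ℝ[X]) :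
    (localPoly t k q).derivative = localPoly t k (C (1 / msize t k) * q.derivative) := by
  simp [localPoly, derivative_comp]

theorem IsMesh.localCoord (h : IsMesh T t) (k : Fin N) (ξ : ℝ) :
    (lft t k + ξ * msize t k - lft t k) / msize t k = ξ := by
  rw [add_sub_cancel_left, mul_div_cancel_right₀ _ (h.msize_pos k).ne']

theorem IsMesh.eval_localPoly_lft (k : Fin N) (q : ℝ[X]) :
    (localPoly t k q).eval (lft t k) = q.eval 0 := by
  rw [eval_localPoly, sub_self, zero_div]

theorem IsMesh.eval_localPoly_rgt (h : IsMesh T t) (k : Fin N) (q : ℝ[X]) :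
    (localPoly t k q).eval (rgt t k) = q.eval 1 := by
  rw [eval_localPoly, ← msize, div_self (h.msize_pos k).ne']

theorem integral_mesh (k : Fin N) (f : ℝ → ℝ) : ∫ x in (lft t k)..(rgt t k), f x =
    msize t k * ∫ ξ in (0 : ℝ)..1, f (lft t k + ξ * msize t k) := by
  have := intervalIntegral.mul_integral_comp_add_mul (a := 0) (b := 1) (f := f) (msize t k) (lft t k)
  simp only [mul_zero, add_zero, mul_one, IsMesh.lft_add_msize] at this
  rw [← this]
  simp only [mul_comm]

theorem integral_localPoly_mul_sumKern (h : IsMesh T t) {k : Fin N} (ℓ : Fin N) (a : ℝ[X]) {s : ℝ}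
    (hs : s ∈ Icc (lft t k) (rgt t k)) :
    ∫ x in (lft t ℓ)..(rgt t ℓ), (localPoly t ℓ a).eval x * sumKern T s x =
      msize t ℓ * ∫ η in (0 : ℝ)..1, a.eval η * kern T s (lft t ℓ + η * msize t ℓ) := by
  have hl := h.msize_pos ℓ
  rw [integral_mesh]
  simp only [eval_localPoly, h.localCoord]
  congr 1
  rw [intervalIntegral.integral_of_le zero_le_one, intervalIntegral.integral_of_le zero_le_one,
    integral_Ioc_eq_integral_Ioo, integral_Ioc_eq_integral_Ioo]
  refine setIntegral_congr_ae measurableSet_Ioo ?_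
  filter_upwards [compl_mem_ae_iff.2 (measure_singleton (μ := volume)
    ((s - lft t ℓ) / msize t ℓ))] with η hη hη'
  have hne : s ≠ lft t ℓ + η * msize t ℓ := fun e => hη (by
    rw [mem_singleton_iff, eq_div_iff hl.ne', e]; ring)
  obtain ⟨h0, h2⟩ := add_mem_of_mem_Ioo h (ℓ := ℓ) hs hη'
  have hx := h.add_mul_mem ℓ (Ioo_subset_Icc_self hη')
  have := h.lft_nonneg k
  have := h.lft_nonneg ℓ
  have := h.rgt_le k
  have := h.rgt_le ℓ
  have hT := h.pos
  rw [kern_eq_sumKern hT h0 h2 hne]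
  rw [abs_lt]
  constructor <;> linarith [hx.1, hx.2, hs.1, hs.2]

theorem sqIntegrable_mul_kern (h : IsMesh T t) (k ℓ : Fin N) (a q : ℝ[X]) :
    SqIntegrable fun ξ η => a.eval η * q.derivative.eval ξ *
      kern T (lft t k + ξ * msize t k) (lft t ℓ + η * msize t ℓ) := by
  refine ((((sqIntegrable_mul_regF h k ℓ a q.derivative).add
    (exactSum_singTerms h k ℓ a q).1).const_mul (-(1 / Real.pi))).congr_of_ne ?_).1
  intro ξ hξ η hη hne
  have hs := h.add_mul_mem k (Ioc_subset_Icc_self hξ)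
  have hx := h.add_mul_mem ℓ (Ioc_subset_Icc_self hη)
  have hs0 := mul_pos hξ.1 (h.msize_pos k)
  have hx0 := mul_pos hη.1 (h.msize_pos ℓ)
  have := h.lft_nonneg k
  have := h.lft_nonneg ℓ
  have := h.rgt_le k
  have := h.rgt_le ℓ
  have hsx : lft t k + ξ * msize t k ≠ lft t ℓ + η * msize t ℓ := by
    rcases lt_trichotomy k ℓ with hlt | rfl | hlt
    · have := h.rgt_le_lft hlt
      exact (by linarith [hs.2] : _ < _).ne
    · intro e
      exact hne (mul_right_cancel₀ (h.msize_pos k).ne' (add_left_cancel e))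
    · have := h.rgt_le_lft hlt
      exact (by linarith [hx.2] : _ < _).ne'
  have h2 : lft t k + ξ * msize t k + (lft t ℓ + η * msize t ℓ) < 2 * T := by
    rcases lt_or_gt_of_ne hsx with hlt | hlt <;> linarith [hs.2, hx.2]
  rw [kern, log_tan_mul_tan h hs hsx (by linarith) h2]
  ring

/-- The contribution of the elements `k`, `ℓ` to the bilinear form, in reference coordinates. -/
theorem localForm_eq (h : IsMesh T t) (k ℓ : Fin N) (a q : ℝ[X]) :
    (localPoly t k q).eval (lft t k) *
        (∫ x in (lft t ℓ)..(rgt t ℓ), (localPoly t ℓ a).eval x * sumKern T (lft t k) x) -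
      (localPoly t k q).eval (rgt t k) *
        (∫ x in (lft t ℓ)..(rgt t ℓ), (localPoly t ℓ a).eval x * sumKern T (rgt t k) x) +
      ∫ s in (lft t k)..(rgt t k), (localPoly t k q).derivative.eval s *
        ∫ x in (lft t ℓ)..(rgt t ℓ), (localPoly t ℓ a).eval x * sumKern T s x =
    msize t ℓ * (q.eval 0 * (∫ η in (0 : ℝ)..1, a.eval η *
          kern T (lft t k) (lft t ℓ + η * msize t ℓ)) -
      q.eval 1 * (∫ η in (0 : ℝ)..1, a.eval η * kern T (rgt t k) (lft t ℓ + η * msize t ℓ)) +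
      ∫ η in (0 : ℝ)..1, a.eval η *
        ∫ ξ in (0 : ℝ)..1, kern T (lft t k + ξ * msize t k) (lft t ℓ + η * msize t ℓ) *
          q.derivative.eval ξ) := by
  have hk := h.msize_pos k
  have hlr := (h.lft_lt_rgt k).le
  have e : ∫ s in (lft t k)..(rgt t k), (localPoly t k q).derivative.eval s *
        ∫ x in (lft t ℓ)..(rgt t ℓ), (localPoly t ℓ a).eval x * sumKern T s x =
      msize t ℓ * sqInt fun η ξ => a.eval η * q.derivative.eval ξ *
        kern T (lft t k + ξ * msize t k) (lft t ℓ + η * msize t ℓ) := by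
    rw [integral_mesh, derivative_localPoly, sqInt, ← intervalIntegral.integral_const_mul,
      ← intervalIntegral.integral_const_mul]
    refine intervalIntegral_congr_Ioo fun ξ hξ => ?_
    rw [integral_localPoly_mul_sumKern h ℓ a (h.add_mul_mem k (Ioo_subset_Icc_self hξ)),
      eval_localPoly, h.localCoord, eval_mul, eval_C]
    simp only [mul_right_comm (eval _ a), intervalIntegral.integral_mul_const]
    field_simp
  rw [e, ← (sqIntegrable_mul_kern h k ℓ a q).sqInt_swap,
    integral_localPoly_mul_sumKern h ℓ a (left_mem_Icc.2 hlr),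
    integral_localPoly_mul_sumKern h ℓ a (right_mem_Icc.2 hlr), IsMesh.eval_localPoly_lft,
    h.eval_localPoly_rgt]
  simp only [sqInt, mul_assoc, intervalIntegral.integral_const_mul,
    mul_comm (kern _ _ _)]
  ring

theorem kern_zero (x : ℝ) :
    kern T 0 x = -(2 / Real.pi) * Real.log (Real.tan (Real.pi * x / (4 * T))) := by
  have e : |Real.tan (Real.pi * |x| / (4 * T))| = |Real.tan (Real.pi * x / (4 * T))| := by
    rcases abs_choice x with h | h <;> rw [h]
    rw [mul_neg, neg_div, Real.tan_neg, abs_neg]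
  rw [kern, zero_add, sub_zero, ← Real.log_abs, abs_mul, e, ← abs_mul, Real.log_abs, ← sq,
    Real.log_pow]
  push_cast; ring

/-- For a continuous piecewise polynomial `y`, the boundary terms of neighbouring elements cancel;
the one at `T` vanishes with the kernel, and the one at `0` remains. -/
theorem sum_boundary (h : IsMesh T t) (a q : Fin N → ℝ[X]) (R : Fin N → Fin N → ℝ) (y : ℝ → ℝ)
    (h0 : ∀ k, (q k).eval 0 = y (lft t k)) (h1 : ∀ k, (q k).eval 1 = y (rgt t k)) :
    ∑ k, ∑ ℓ, msize t ℓ * ((q k).eval 0 * (∫ η in (0 : ℝ)..1, (a ℓ).eval η *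
          kern T (lft t k) (lft t ℓ + η * msize t ℓ)) -
      (q k).eval 1 * (∫ η in (0 : ℝ)..1, (a ℓ).eval η *
          kern T (rgt t k) (lft t ℓ + η * msize t ℓ)) + R k ℓ) =
    ∑ k : Fin N, ∑ ℓ, (-((if (k : ℕ) = 0 then 1 else 0) * (q k).eval 0 *
        (2 * msize t ℓ / Real.pi) * ∫ η in (0 : ℝ)..1, (a ℓ).eval η *
          Real.log (Real.tan (Real.pi * (lft t ℓ + η * msize t ℓ) / (4 * T)))) +
      msize t ℓ * R k ℓ) := by
  set Φ : ℝ → ℝ := fun x => ∑ ℓ, msize t ℓ * (y x * ∫ η in (0 : ℝ)..1, (a ℓ).eval η *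
    kern T x (lft t ℓ + η * msize t ℓ)) with hΦ
  have hL : ∑ k, Φ (lft t k) - ∑ k, Φ (rgt t k) = Φ 0 - Φ T := by
    have e := (Fin.sum_univ_castSucc fun i => Φ (t i)).symm.trans
      (Fin.sum_univ_succ fun i => Φ (t i))
    rw [h.zero, h.last] at e
    simp only [lft, rgt]
    linarith
  have hΦT : Φ T = 0 := by simp [hΦ, kern_right_end h.pos]
  have hΦ0 : Φ 0 = ∑ k : Fin N, ∑ ℓ, -((if (k : ℕ) = 0 then 1 else 0) * (q k).eval 0 *
        (2 * msize t ℓ / Real.pi) * ∫ η in (0 : ℝ)..1, (a ℓ).eval η *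
          Real.log (Real.tan (Real.pi * (lft t ℓ + η * msize t ℓ) / (4 * T)))) := by
    have hN : N ≠ 0 := by
      rintro rfl
      exact h.pos.ne' (h.last.symm.trans h.zero)
    obtain ⟨n, rfl⟩ := Nat.exists_eq_succ_of_ne_zero hN
    rw [Fin.sum_univ_succ]
    simp only [h0, Fin.val_succ, Nat.succ_ne_zero, if_false, zero_mul, neg_zero,
      Finset.sum_const_zero, add_zero, Fin.val_zero, if_true, one_mul,
      h.lft_eq_zero (k := (0 : Fin (n + 1))) rfl, hΦ, kern_zero]
    refine Finset.sum_congr rfl fun ℓ _ => ?_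
    simp only [mul_left_comm _ (-(2 / Real.pi)), intervalIntegral.integral_const_mul]
    ring
  simp only [Finset.sum_add_distrib, mul_add (msize t _), mul_sub, Finset.sum_sub_distrib]
  rw [← hΦ0]
  rw [show Φ 0 = Φ 0 - Φ T by rw [hΦT, sub_zero], ← hL]
  simp only [hΦ, h0, h1]

end

/-! ### The global matrices -/

section
variable {T : ℝ} {N : ℕ} {t : Fin (N + 1) → ℝ} {p : Fin N → ℕ} {M : ℕ} {φ : Fin M → ℝ → ℝ}
  {ψ : (q : ℕ) → Fin (q + 1) → ℝ[X]} {α : (ℓ : Fin N) → Fin (p ℓ + 1) → Fin M}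

/-- The shape function on the element `k` of the basis function with the global index `i`, zero if
there is none. -/
noncomputable def localShape (p : Fin N → ℕ) (ψ : (q : ℕ) → Fin (q + 1) → ℝ[X])
    (α : (ℓ : Fin N) → Fin (p ℓ + 1) → Fin M) (i : Fin M) (k : Fin N) : ℝ[X] :=
  ∑ n, if α k n = i then ψ (p k) n else 0

theorem localShape_index {k : Fin N} (hα : Function.Injective (α k)) (n : Fin (p k + 1)) :
    localShape p ψ α (α k n) k = ψ (p k) n := by
  simp [localShape, hα.eq_iff]

theorem localShape_of_notMem {i : Fin M} {k : Fin N} (hi : i ∉ range (α k)) :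
    localShape p ψ α i k = 0 :=
  Finset.sum_eq_zero fun n _ => if_neg fun e => hi ⟨n, e⟩

theorem IsFEBasis.eq_localShape (hφ : IsFEBasis T t p φ ψ α) (i : Fin M) (k : Fin N) {x : ℝ}
    (hx : x ∈ Icc (lft t k) (rgt t k)) :
    φ i x = (localShape p ψ α i k).eval ((x - lft t k) / msize t k) := by
  by_cases hi : i ∈ range (α k)
  · obtain ⟨n, rfl⟩ := hi
    rw [localShape_index (hφ.index_injective k), hφ.eq_shape k n x hx]
  · rw [localShape_of_notMem hi, hφ.eq_zero k i hi x hx, Polynomial.eval_zero]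

theorem IsFEBasis.isPiecewise (hφ : IsFEBasis T t p φ ψ α) (i : Fin M) :
    IsPiecewise t (φ i) fun k => localPoly t k (localShape p ψ α i k) := fun k x hx => by
  rw [eval_localPoly, hφ.eq_localShape i k (Ioo_subset_Icc_self hx)]

theorem IsFEBasis.isPiecewise_deriv (hφ : IsFEBasis T t p φ ψ α) (i : Fin M) :
    IsPiecewise t (deriv (φ i)) fun k =>
      localPoly t k (C (1 / msize t k) * derivative (localShape p ψ α i k)) := fun k x hx => by
  have : φ i =ᶠ[𝓝 x] fun x => (localPoly t k (localShape p ψ α i k)).eval x := by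
    filter_upwards [Ioo_mem_nhds hx.1 hx.2] with z hz
    exact hφ.isPiecewise i k z hz
  rw [this.deriv_eq, Polynomial.deriv, derivative_localPoly]

theorem localEntry_zero_left (k ℓ : Fin N) (um : ℝ[X]) (X : Kind) :
    localEntry T t k ℓ 0 um X = 0 := by
  cases X <;> simp [localEntry]

theorem localEntry_zero_right (k ℓ : Fin N) (un : ℝ[X]) (X : Kind) :
    localEntry T t k ℓ un 0 X = 0 := by
  cases X <;> simp [localEntry, J0, J1]

theorem globalEntry_eq_sum (h : IsMesh T t) (hφ : IsFEBasis T t p φ ψ α) (i j : Fin M) (X : Kind) :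
    globalEntry T φ i j X = ∑ k, ∑ ℓ,
      localEntry T t k ℓ (localShape p ψ α i k) (localShape p ψ α j ℓ) X := by
  have hend : ∀ k, (localShape p ψ α i k).eval 0 = φ i (lft t k) ∧
      (localShape p ψ α i k).eval 1 = φ i (rgt t k) := fun k => by
    have hlr := (h.lft_lt_rgt k).le
    rw [hφ.eq_localShape i k (left_mem_Icc.2 hlr), hφ.eq_localShape i k (right_mem_Icc.2 hlr),
      sub_self, zero_div, ← msize, div_self (h.msize_pos k).ne']
    exact ⟨rfl, rfl⟩
  have hb := fun a R => sum_boundary h a (localShape p ψ α i) R (φ i) (fun k => (hend k).1)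
    fun k => (hend k).2
  cases X
  · rw [globalEntry, integral_mul_modHilbert h (hφ.isPiecewise i) (hφ.isPiecewise j)]
    simp only [localForm_eq h]
    exact hb _ _
  · rw [globalEntry, integral_mul_modHilbert h (hφ.isPiecewise i) (hφ.isPiecewise_deriv j)]
    simp only [localForm_eq h]
    rw [hb]
    refine Finset.sum_congr rfl fun k _ => Finset.sum_congr rfl fun ℓ _ => ?_
    have hl := (h.msize_pos ℓ).ne'
    have e1 : ∀ I, 2 * msize t ℓ / Real.pi * (1 / msize t ℓ * I) = 2 / Real.pi * I := fun I => by
      field_simp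
    have e2 : ∀ I, msize t ℓ * (1 / msize t ℓ * I) = I := fun I => by field_simp
    simp only [localEntry, eval_mul, eval_C, mul_assoc, intervalIntegral.integral_const_mul, e1, e2]
  · rw [globalEntry, integral_mul_modHilbert h (hφ.isPiecewise_deriv i) (hφ.isPiecewise_deriv j)]
    simp only [localForm_eq h]
    refine Finset.sum_congr rfl fun k _ => Finset.sum_congr rfl fun ℓ _ => ?_
    have hl := (h.msize_pos ℓ).ne'
    have hk := (h.msize_pos k).ne'
    have hpi := Real.pi_ne_zero
    simp only [localEntry, J0, J1, eval_mul, eval_C, derivative_C_mul, mul_assoc,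
      mul_left_comm _ (1 / msize t k), intervalIntegral.integral_const_mul]
    field_simp
    ring

/-- Element-wise assembly: a bilinear expression in the shape functions of two basis functions is
collected from all pairs of local indices. -/
theorem sum_ite_index (hα : ∀ k, Function.Injective (α k)) (k ℓ : Fin N) (i j : Fin M)
    (F : ℝ[X] → ℝ[X] → ℝ) (h0 : ∀ u, F 0 u = 0) (h0' : ∀ u, F u 0 = 0) :
    (∑ n, ∑ m, if α k n = i ∧ α ℓ m = j then F (ψ (p k) n) (ψ (p ℓ) m) else 0) =
      F (localShape p ψ α i k) (localShape p ψ α j ℓ) := by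
  by_cases hi : i ∈ range (α k)
  · obtain ⟨n, rfl⟩ := hi
    by_cases hj : j ∈ range (α ℓ)
    · obtain ⟨m, rfl⟩ := hj
      rw [localShape_index (hα k), localShape_index (hα ℓ)]
      simp [(hα k).eq_iff, (hα ℓ).eq_iff, ite_and]
    · rw [localShape_of_notMem hj, h0']
      exact Finset.sum_eq_zero fun n _ => Finset.sum_eq_zero fun m _ =>
        if_neg fun e => hj ⟨m, e.2⟩
  · rw [localShape_of_notMem hi, h0]
    exact Finset.sum_eq_zero fun n _ => Finset.sum_eq_zero fun m _ => if_neg fun e => hi ⟨n, e.1⟩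

theorem expConv_globalQuad (h : IsMesh T t) (hφ : IsFEBasis T t p φ ψ α)
    {LR : ∀ K, LegendreRule K} {JR : ∀ K, LogRule K} {L : QTerm → ℕ × ℕ} {X : Kind}
    (hL : ∀ (k ℓ : Fin N) (n : Fin (p k + 1)) (m : Fin (p ℓ + 1)),
      ∀ τ ∈ scheme T t k ℓ (ψ (p k) n) (ψ (p ℓ) m) X, τ.LogExact LR JR (L τ)) (i j : Fin M) :
    ExpConv fun K => globalQuad T t p ψ α LR JR L X K i j - globalEntry T φ i j X := by
  have e : globalEntry T φ i j X = ∑ k, ∑ ℓ, ∑ n, ∑ m, if α k n = i ∧ α ℓ m = j then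
      localEntry T t k ℓ (ψ (p k) n) (ψ (p ℓ) m) X else 0 := by
    rw [globalEntry_eq_sum h hφ]
    refine Finset.sum_congr rfl fun k _ => Finset.sum_congr rfl fun ℓ _ => ?_
    exact (sum_ite_index hφ.index_injective k ℓ i j (fun un um => localEntry T t k ℓ un um X)
      (fun _ => localEntry_zero_left _ _ _ _) fun _ => localEntry_zero_right _ _ _ _).symm
  simp only [e, globalQuad, ← Finset.sum_sub_distrib]
  refine ExpConv.sum _ fun k _ => ExpConv.sum _ fun ℓ _ => ExpConv.sum _ fun n _ =>
    ExpConv.sum _ fun m _ => ?_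
  by_cases hnm : α k n = i ∧ α ℓ m = j
  · simpa only [if_pos hnm] using expConv_localQuad h (hL k ℓ n m)
  · simpa only [if_neg hnm, sub_zero] using ExpConv.zero

end

end ModHilbert

theorem theorem4p1 {T : ℝ} (hT : 0 < T) {N : ℕ}
    (t : Fin (N + 1) → ℝ) (ht : StrictMono t) (ht0 : t 0 = 0) (htN : t (Fin.last N) = T)
    (hmesh : ∀ ℓ : Fin N, ModHilbert.msize t ℓ ≤ T / 2)
    (p : Fin N → ℕ) (hp : ∀ ℓ, 1 ≤ p ℓ)
    {M : ℕ} (φ : Fin M → ℝ → ℝ) (ψ : (q : ℕ) → Fin (q + 1) → Polynomial ℝ)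
    (α : (ℓ : Fin N) → Fin (p ℓ + 1) → Fin M)
    (hφ : ModHilbert.IsFEBasis T t p φ ψ α)
    (LR : ∀ K, ModHilbert.LegendreRule K) (JR : ∀ K, ModHilbert.LogRule K) :
    -- every (tensor) Gauss-Legendre quadrature in the schemes converges exponentially
    (∀ (X : ModHilbert.Kind) (k ℓ : Fin N) (n : Fin (p k + 1)) (m : Fin (p ℓ + 1)),
      ∀ τ ∈ ModHilbert.scheme T t k ℓ (ψ (p k) n) (ψ (p ℓ) m) X, τ.LegConv LR) ∧
    -- explicit orders that make the quadratures for the logarithmic integrals exact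
    (∀ (X : ModHilbert.Kind) (k ℓ : Fin N) (n : Fin (p k + 1)) (m : Fin (p ℓ + 1)),
      ∀ τ ∈ ModHilbert.scheme T t k ℓ (ψ (p k) n) (ψ (p ℓ) m) X, ∀ o : ℕ × ℕ,
        p k + p ℓ + 1 ≤ 2 * o.1 → p k + p ℓ + 1 ≤ 2 * o.2 → τ.LogExact LR JR o) ∧
    -- for all orders that make them exact, the computed entries converge exponentially
    (∀ L : ModHilbert.QTerm → ℕ × ℕ,
      (∀ (X : ModHilbert.Kind) (k ℓ : Fin N) (n : Fin (p k + 1)) (m : Fin (p ℓ + 1)),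
        ∀ τ ∈ ModHilbert.scheme T t k ℓ (ψ (p k) n) (ψ (p ℓ) m) X, τ.LogExact LR JR (L τ)) →
      (∀ (X : ModHilbert.Kind) (k ℓ : Fin N) (n : Fin (p k + 1)) (m : Fin (p ℓ + 1)),
        ModHilbert.ExpConv fun K =>
          ModHilbert.localQuad T t k ℓ LR JR L (ψ (p k) n) (ψ (p ℓ) m) X K -
            ModHilbert.localEntry T t k ℓ (ψ (p k) n) (ψ (p ℓ) m) X) ∧
      (∀ (X : ModHilbert.Kind) (i j : Fin M),
        ModHilbert.ExpConv fun K =>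
          ModHilbert.globalQuad T t p ψ α LR JR L X K i j -
            ModHilbert.globalEntry T φ i j X)) := by
  have h : ModHilbert.IsMesh T t := ⟨hT, ht, ht0, htN, hmesh⟩
  refine ⟨fun X k ℓ n m => ModHilbert.legConv_scheme h LR k ℓ _ _ X,
    fun X k ℓ n m τ hτ o h1 h2 => ModHilbert.logExact_scheme (hφ.natDegree_le ℓ m)
      (hφ.natDegree_le k n) (hp k) h1 h2 LR JR k ℓ X τ hτ, fun L hL => ⟨fun X k ℓ n m => ?_,
    fun X i j => ?_⟩⟩
  · exact ModHilbert.expConv_localQuad h (hL X k ℓ n m)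
  · exact ModHilbert.expConv_globalQuad h hφ (hL X) i j
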